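/- Notation. Let $0<\alpha<\pi$ and $\mathbb{R}_+=(0,\infty)$. Fix a decreasing $\phi\in C^\infty([0,\infty))$ which equals $1$ near $0$ and has support in $[0,1)$. Let $$K_\alpha f(s)=\int_0^\infty K_\alpha(s,t)f(t)\,dt,\qquad K_\alpha(s,t)=-\frac1\pi\operatorname{Im}\frac{e^{i\alpha}}{te^{i\alpha}-s},\qquad \widehat K_\alpha(z)=\frac{\sin((\pi-\alpha)z)}{\sin(\pi z)},\quad \widehat K_\alpha(0)=1-\frac{\alpha}{\pi},$$ so that $K_\alpha$ is the Mellin convolution operator with symbol $\widehat K_\alpha$. Let $\Sigma_{1,\alpha}$ be the closure of $\widehat K_\alpha(-\tfrac12+i\mathbb{R})$, a simple closed curve, let $\widetilde\Sigma_{1,\alpha}$ be its interior (the bounded part of its complement), and let $\mu_\alpha$ be the inverse of the restriction of $\widehat K_\alpha$ to the half-strip $\{|\operatorname{Re}z|<\tfrac12,\ \operatorname{Im}z<0\}$, on which $\widehat K_\alpha$ is injective with image $\widetilde\Sigma_{1,\alpha}\setminus[1-\alpha/\pi,\sin((\pi-\alpha)/2)]$. The spaces $H^{1/2}(\mathbb{R}_+)$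 and $H^1(\mathbb{R}_+)$ are the completions of $C_c^\infty([0,\infty))$ in the norms given by $\|f\|_{L^2}^2+\int_0^\infty\!\int_0^\infty\frac{|f(s)-f(t)|^2}{|s-t|^2}\,ds\,dt$ and $\|f\|_{L^2}^2+\|f'\|_{L^2}^2$, respectively; $W^1_0(\mathbb{R}_+)$ is the completion of $C_c^\infty(\mathbb{R}_+)$ in the norm given by $\int_0^\infty|f|^2s^{-2}\,ds+\|f'\|_{L^2}^2$; and $W^1(\mathbb{R}_+)=\mathbb{C}\phi\oplus W^1_0(\mathbb{R}_+)$ with $\|d\phi+h\|_{W^1}^2=|d|^2+\|h\|_{W_0^1}^2$. Theorem. (1) Let $\lambda\in\widetilde\Sigma_{1,\alpha}$ with $\operatorname{Im}\lambda\neq0$. There is a constant $C_\lambda$ such that, whenever $g\in H^1(\mathbb{R}_+)$ and $f_\lambda\in H^{1/2}(\mathbb{R}_+)$ satisfy $(K_\alpha-\lambda)f_\lambda=g$, there are $c_\lambda\in\mathbb{C}$ and $\tilde f_\lambda\in W^1(\mathbb{R}_+)$ with $$f_\lambda(s)=c_\lambda\,\phi(s)\,s^{-\operatorname{sgn}(\operatorname{Im}\lambda)\,\mu_\alpha(\lambda)}+\tilde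 f_\lambda(s),\qquad |c_\lambda|^2+\|\tilde f_\lambda\|_{W^1(\mathbb{R}_+)}^2\le C_\lambda\|g\|_{H^1(\mathbb{R}_+)}^2 .$$ (2) Let $\lambda\notin\operatorname{clos}\widetilde\Sigma_{1,\alpha}$. There is a constant $C_\lambda$ such that, whenever $g\in H^1(\mathbb{R}_+)$ and $j_\lambda\in H^{1/2}(\mathbb{R}_+)$ satisfy $(K_\alpha-\lambda)j_\lambda=g$, we have $j_\lambda\in W^1(\mathbb{R}_+)$ and $\|j_\lambda\|_{W^1(\mathbb{R}_+)}\le C_\lambda\|g\|_{H^1(\mathbb{R}_+)}$. -/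

import Mathlib

open Set Filter Topology MeasureTheory
open scoped ENNReal NNReal ContDiff

namespace MellinCorner

noncomputable section

/-- Lebesgue measure on the half-line `(0, ∞)`. Functions on the half-line are represented by
functions on `ℝ`, of which only the values on `(0, ∞)`, up to null sets, matter. -/
def halfLine : Measure ℝ := volume.restrict (Ioi 0)

/-! ### The kernel, the operator and its symbol -/

/-- The kernel `K_α(s, t) = -(1/π) Im (e^{iα} / (t e^{iα} - s))`. -/
def kernel (α s t : ℝ) : ℝ :=
  -(1 / Real.pi) *
    (Complex.exp (Complex.I * α) / ((t : ℂ) * Complex.exp (Complex.I * α) - (s : ℂ))).im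

/-- The operator `K_α f(s) = ∫_0^∞ K_α(s, t) f(t) dt`. -/
def opK (α : ℝ) (f : ℝ → ℂ) (s : ℝ) : ℂ :=
  ∫ t in Ioi (0 : ℝ), (kernel α s t : ℂ) * f t

/-- The symbol `sin((π - α) z) / sin(π z)`, with its removable singularity at `0` removed. -/
def symbol (α : ℝ) (z : ℂ) : ℂ :=
  if z = 0 then 1 - (α : ℂ) / (Real.pi : ℂ)
  else Complex.sin (((Real.pi : ℂ) - α) * z) / Complex.sin ((Real.pi : ℂ) * z)

/-- The closed curve `Σ_{η,α}`: the closure of the image of the line `Re z = 1/2 - η`. -/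
def sigmaCurve (η α : ℝ) : Set ℂ :=
  closure (symbol α '' {z : ℂ | z.re = 1 / 2 - η})

/-- The interior of the closed curve `Σ_{η,α}`: the points off the curve whose connected component
in the complement of the curve is bounded. -/
def sigmaInterior (η α : ℝ) : Set ℂ :=
  {w : ℂ | w ∉ sigmaCurve η α ∧
    Bornology.IsBounded (connectedComponentIn (sigmaCurve η α)ᶜ w)}

/-- The half-strip `|Re z| < 1/2`, `Im z < 0`. -/
def halfStrip : Set ℂ := {z : ℂ | |z.re| < 1 / 2 ∧ z.im < 0}

/-- `μ_α`, the inverse of the symbol restricted to the half-strip. -/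
def muInv (α : ℝ) : ℂ → ℂ := Function.invFunOn (symbol α) halfStrip

/-! ### Function spaces on the half-line -/

/-- A decreasing smooth cut-off function on `[0, ∞)`, equal to `1` near `0`, with support
in `[0, 1)`. -/
structure IsCutoff (φ : ℝ → ℝ) : Prop where
  smooth : ContDiffOn ℝ ∞ φ (Ici 0)
  antitone : AntitoneOn φ (Ici 0)
  eq_one : ∃ δ : ℝ, 0 < δ ∧ ∀ s ∈ Icc 0 δ, φ s = 1
  eq_zero : ∃ r : ℝ, r < 1 ∧ ∀ s, 0 ≤ s → r ≤ s → φ s = 0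

/-- `u` (restricted to `[0, ∞)`) belongs to `C_c^∞([0, ∞))`. -/
def IsTestClosed (u : ℝ → ℂ) : Prop := ContDiff ℝ ∞ u ∧ HasCompactSupport u

/-- `u` belongs to `C_c^∞((0, ∞))`. -/
def IsTestOpen (u : ℝ → ℂ) : Prop :=
  ContDiff ℝ ∞ u ∧ HasCompactSupport u ∧ tsupport u ⊆ Ioi 0

/-- The square `∫_0^∞ |f|^2 ds` of the `L^2` norm. -/
def l2Sq (f : ℝ → ℂ) : ℝ≥0∞ := ∫⁻ s, ‖f s‖ₑ ^ 2 ∂halfLine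

/-- The square of the seminorm of `H^{1/2}`,
`∫_0^∞ ∫_0^∞ |f(s) - f(t)|^2 / |s - t|^2 ds dt`. -/
def gagliardoSq (f : ℝ → ℂ) : ℝ≥0∞ :=
  ∫⁻ s, ∫⁻ t, ‖f s - f t‖ₑ ^ 2 / ENNReal.ofReal (|s - t| ^ 2) ∂halfLine ∂halfLine

/-- `f ∈ H^{1/2}`: `f` lies in the completion of `C_c^∞([0, ∞))` in the norm
`(‖f‖_{L^2}^2 + |f|_{H^{1/2}}^2)^{1/2}`. -/
def MemHHalf (f : ℝ → ℂ) : Prop :=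
  AEStronglyMeasurable f halfLine ∧
  ∃ u : ℕ → ℝ → ℂ, (∀ n, IsTestClosed (u n)) ∧
    Tendsto (fun n => l2Sq (fun s => u n s - f s) + gagliardoSq (fun s => u n s - f s))
      atTop (𝓝 0)

/-- `f` lies in the completion of `C_c^∞([0, ∞))` in the norm
`(‖f‖_{L^2}^2 + ‖f'‖_{L^2}^2)^{1/2}`, and `v` is its derivative. -/
def IsHOneWith (f v : ℝ → ℂ) : Prop :=
  AEStronglyMeasurable f halfLine ∧ AEStronglyMeasurable v halfLine ∧
  ∃ u : ℕ → ℝ → ℂ, (∀ n, IsTestClosed (u n)) ∧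
    Tendsto (fun n => l2Sq (fun s => u n s - f s) + l2Sq (fun s => deriv (u n) s - v s))
      atTop (𝓝 0)

/-- `f ∈ H^1`. -/
def MemHOne (f : ℝ → ℂ) : Prop := ∃ v, IsHOneWith f v

/-- The norm of `H^1`. The derivative `v` is unique up to null sets, so that the infimum only
serves to name it; the value is `∞` outside `H^1`. -/
def hOneNorm (f : ℝ → ℂ) : ℝ≥0∞ :=
  (⨅ (v : ℝ → ℂ) (_ : IsHOneWith f v), (l2Sq f + l2Sq v)) ^ (1 / 2 : ℝ)

/-- `f` lies in the completion of `C_c^∞((0, ∞))` in the norm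
`(∫_0^∞ |f|^2 s^{-2} ds + ‖f'‖_{L^2}^2)^{1/2}`, and `v` is its derivative. -/
def IsWZeroWith (f v : ℝ → ℂ) : Prop :=
  AEStronglyMeasurable f halfLine ∧ AEStronglyMeasurable v halfLine ∧
  ∃ u : ℕ → ℝ → ℂ, (∀ n, IsTestOpen (u n)) ∧
    Tendsto (fun n => l2Sq (fun s => (u n s - f s) / (s : ℂ)) +
      l2Sq (fun s => deriv (u n) s - v s)) atTop (𝓝 0)

/-- `f ∈ W_0^1`. -/
def MemWZero (f : ℝ → ℂ) : Prop := ∃ v, IsWZeroWith f v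

/-- The square of the norm of `W_0^1` (`∞` outside `W_0^1`). -/
def wZeroNormSq (f : ℝ → ℂ) : ℝ≥0∞ :=
  ⨅ (v : ℝ → ℂ) (_ : IsWZeroWith f v), (l2Sq (fun s => f s / (s : ℂ)) + l2Sq v)

/-- `f = d φ + h` with `d ∈ ℂ` and `h ∈ W_0^1`. -/
def IsWOneDecomp (φ : ℝ → ℝ) (f : ℝ → ℂ) (d : ℂ) (h : ℝ → ℂ) : Prop :=
  MemWZero h ∧ f =ᵐ[halfLine] fun s => d * (φ s : ℂ) + h s

/-- `f ∈ W^1 = ℂ φ ⊕ W_0^1`. -/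
def MemWOne (φ : ℝ → ℝ) (f : ℝ → ℂ) : Prop := ∃ d h, IsWOneDecomp φ f d h

/-- The norm `‖d φ + h‖ = (|d|^2 + ‖h‖_{W_0^1}^2)^{1/2}` of the direct sum `W^1 = ℂ φ ⊕ W_0^1`.
The decomposition is unique, so that the infimum only serves to name it; the value is `∞`
outside `W^1`. -/
def wOneNorm (φ : ℝ → ℝ) (f : ℝ → ℂ) : ℝ≥0∞ :=
  (⨅ (d : ℂ) (h : ℝ → ℂ) (_ : IsWOneDecomp φ f d h), (‖d‖ₑ ^ 2 + wZeroNormSq h)) ^ (1 / 2 : ℝ)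

/-- `(K_α - w) f = g`, almost everywhere on the half-line. -/
def Solves (α : ℝ) (w : ℂ) (f g : ℝ → ℂ) : Prop :=
  ∀ᵐ s ∂halfLine, opK α f s - w * f s = g s

end

end MellinCorner

open MellinCorner

namespace MellinCorner

/-! The kernel is homogeneous of degree -1, so K averages dilations and multiplies s^p by the symbol
σ(p) when |Re p| < 1. The Mellin line of L² is Re p = -1/2. There 1/(σ - w) = -1/w + σ/(w(σ - w)),
and the last term decays, so K - w is inverted on L² by -1/w plus an average of dilations with a
kernel `mL`. For a right-hand side that is a primitive of an L² function v, differentiation turns a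
kernel m(τ) into τ m(τ) (`dilAvg_prim`). Staying in W¹₀ therefore calls for the inverse Mellin
transform along Re p = 1/2, a kernel `mR`. Between the two lines lie the zeros of σ - w, and their
residues make up mL - mR.

If w lies outside the closed region, there are no zeros and mL = mR: the solution inherits the
regularity of the data. If w is nonreal and inside, there are exactly two simple zeros ±z, with Re z
> 0, and mL - mR is a multiple of τ^(z-1) - τ^(-z-1). It contributes multiples of s^z and s^(-z) to
the solution. The latter is unbounded at the origin and is excluded by H^{1/2}
(`MemHHalf.eq_zero_of_singular`); the former, cut off by φ, is the singular term of the theorem. A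
datum with g(0) ≠ 0 is first reduced to one vanishing at 0 by subtracting a multiple of φ, since (K
- w)φ has the boundary value σ(0) - w ≠ 0 (`exists_reduction`).

Two facts about σ feed this. First, log σ is holomorphic on the convex half-strip and its derivative
has negative imaginary part there, so σ is injective with nonvanishing derivative (`injOn_symbol`).
Second, the interior of the curve is covered by σ of the open strip
(`sigmaInterior_subset_symbol_image`): every ray from 0 meets the curve at most once off the origin,
so the interior lies in a connected union of segments that avoids the curve, and the image of the
strip is open with its boundary on the curve. As σ is even and real on the real axis, the roots of σ
= w are ± the point given by `muInv`.

All estimates are Schur tests for averages of dilations, Hardy's inequality being one of them, and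
Cauchy–Schwarz bounds. -/

/-! ### Trigonometric and hyperbolic inequalities -/

lemma strictMonoOn_of_hasDerivAt_pos {f f' : ℝ → ℝ} {a b : ℝ}
    (hf : ∀ x ∈ Icc a b, HasDerivAt f (f' x) x) (hpos : ∀ x ∈ Ioo a b, 0 < f' x) :
    StrictMonoOn f (Icc a b) := by
  apply strictMonoOn_of_deriv_pos (convex_Icc a b)
  · exact fun x hx => (hf x hx).continuousAt.continuousWithinAt
  · intro x hx
    rw [interior_Icc] at hx
    rw [(hf x (Ioo_subset_Icc_self hx)).deriv]
    exact hpos x hx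

/-- The difference of the two sides vanishes at 0 and has derivative (π² - a²) sin(ax) sin(πx). With
its hyperbolic counterpart it decides the sign of the imaginary part of the symbol. -/
lemma sin_cos_scaled_lt {a x : ℝ} (ha : 0 < a) (haπ : a < Real.pi) (hx : 0 < x) (hx1 : x ≤ 1) :
    Real.pi * (Real.sin (a * x) * Real.cos (Real.pi * x)) <
      a * (Real.cos (a * x) * Real.sin (Real.pi * x)) := by
  have hm : StrictMonoOn (fun x => a * (Real.cos (a * x) * Real.sin (Real.pi * x)) -
      Real.pi * (Real.sin (a * x) * Real.cos (Real.pi * x))) (Icc 0 x) := by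
    refine strictMonoOn_of_hasDerivAt_pos
      (f' := fun x => (Real.pi ^ 2 - a ^ 2) * (Real.sin (a * x) * Real.sin (Real.pi * x))) ?_ ?_
    · intro y _
      have h1 : HasDerivAt (fun y : ℝ => a * y) a y := by
        simpa using (hasDerivAt_id y).const_mul a
      have h2 : HasDerivAt (fun y : ℝ => Real.pi * y) Real.pi y := by
        simpa using (hasDerivAt_id y).const_mul Real.pi
      refine HasDerivAt.congr_deriv
        (((h1.cos.mul h2.sin).const_mul a).sub ((h1.sin.mul h2.cos).const_mul Real.pi)) ?_
      ring
    · intro y hy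
      have h0 : 0 < Real.pi ^ 2 - a ^ 2 := by nlinarith
      have hy1 : y < 1 := lt_of_lt_of_le hy.2 hx1
      have h1 : 0 < Real.sin (a * y) :=
        Real.sin_pos_of_pos_of_lt_pi (mul_pos ha hy.1) (by nlinarith [hy.1])
      have h2 : 0 < Real.sin (Real.pi * y) :=
        Real.sin_pos_of_pos_of_lt_pi (mul_pos Real.pi_pos hy.1) (by nlinarith [hy.1, Real.pi_pos])
      positivity
  have := hm (left_mem_Icc.2 hx.le) (right_mem_Icc.2 hx.le) hx
  simp at this
  linarith

lemma sinh_cosh_scaled_lt {a y : ℝ} (ha : 0 < a) (haπ : a < Real.pi) (hy : 0 < y) :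
    a * (Real.cosh (a * y) * Real.sinh (Real.pi * y)) <
      Real.pi * (Real.sinh (a * y) * Real.cosh (Real.pi * y)) := by
  have hm : StrictMonoOn (fun y => Real.pi * (Real.sinh (a * y) * Real.cosh (Real.pi * y)) -
      a * (Real.cosh (a * y) * Real.sinh (Real.pi * y))) (Icc 0 y) := by
    refine strictMonoOn_of_hasDerivAt_pos
      (f' := fun x => (Real.pi ^ 2 - a ^ 2) * (Real.sinh (a * x) * Real.sinh (Real.pi * x))) ?_ ?_
    · intro y _
      have h1 : HasDerivAt (fun y : ℝ => a * y) a y := by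
        simpa using (hasDerivAt_id y).const_mul a
      have h2 : HasDerivAt (fun y : ℝ => Real.pi * y) Real.pi y := by
        simpa using (hasDerivAt_id y).const_mul Real.pi
      refine HasDerivAt.congr_deriv (((h1.sinh.mul h2.cosh).const_mul Real.pi).sub
        ((h1.cosh.mul h2.sinh).const_mul a)) ?_
      ring
    · intro y hy
      have h0 : 0 < Real.pi ^ 2 - a ^ 2 := by nlinarith
      have h1 : 0 < Real.sinh (a * y) := Real.sinh_pos_iff.2 (mul_pos ha hy.1)
      have h2 : 0 < Real.sinh (Real.pi * y) := Real.sinh_pos_iff.2 (mul_pos Real.pi_pos hy.1)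
      positivity
  have := hm (left_mem_Icc.2 hy.le) (right_mem_Icc.2 hy.le) hy
  simp at this
  linarith

lemma mul_cos_le_sin {x : ℝ} (hx : 0 ≤ x) (hxπ : x ≤ Real.pi) : x * Real.cos x ≤ Real.sin x := by
  rcases lt_or_ge x (Real.pi / 2) with h | h
  · rcases hx.eq_or_lt with rfl | hx
    · simp
    have hc : 0 < Real.cos x := Real.cos_pos_of_mem_Ioo ⟨by linarith, h⟩
    have := Real.lt_tan hx h
    rw [Real.tan_eq_sin_div_cos, lt_div_iff₀ hc] at this
    exact this.le
  · have hc : Real.cos x ≤ 0 := Real.cos_nonpos_of_pi_div_two_le_of_le h (by linarith)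
    have := Real.sin_nonneg_of_nonneg_of_le_pi hx hxπ
    nlinarith

lemma sinh_le_mul_cosh {y : ℝ} (hy : 0 ≤ y) : Real.sinh y ≤ y * Real.cosh y := by
  have hm : MonotoneOn (fun y => y * Real.cosh y - Real.sinh y) (Ici 0) := by
    apply monotoneOn_of_deriv_nonneg (convex_Ici 0) (by fun_prop) (by fun_prop)
    intro x hx
    rw [interior_Ici] at hx
    have : HasDerivAt (fun y => y * Real.cosh y - Real.sinh y)
        (1 * Real.cosh x + x * Real.sinh x - Real.cosh x) x :=
      ((hasDerivAt_id x).mul (Real.hasDerivAt_cosh x)).sub (Real.hasDerivAt_sinh x)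
    rw [this.deriv]
    have : 0 ≤ x * Real.sinh x := mul_nonneg (le_of_lt hx) (Real.sinh_nonneg_iff.2 (le_of_lt hx))
    linarith
  have := hm (mem_Ici.2 le_rfl) (mem_Ici.2 hy) hy
  simp at this
  linarith

/-- The expression is even in x. It is nondecreasing on [0, π] because x cos x ≤ sin x and sinh y ≤
y cosh y, and at x = 0 it factors as (sinh y - y)(cosh y - 1). It is the numerator of a derivative
in `scaled_cot_im_lt`. -/
lemma cot_monotone_numerator_pos {x y : ℝ} (hx : |x| ≤ Real.pi) (hy : 0 < y) :
    0 < Real.sinh y * Real.cosh y - Real.sinh y * Real.cos x + y - y * Real.cosh y * Real.cos x -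
      x * Real.sinh y * Real.sin x := by
  wlog h0 : 0 ≤ x generalizing x
  · have := this (x := -x) (by simpa using hx) (by linarith)
    simpa using this
  rw [abs_of_nonneg h0] at hx
  have hs : 0 < Real.sinh y := Real.sinh_pos_iff.2 hy
  have hm : MonotoneOn (fun x => Real.sinh y * Real.cosh y - Real.sinh y * Real.cos x + y -
      y * Real.cosh y * Real.cos x - x * Real.sinh y * Real.sin x) (Icc 0 x) := by
    have hd : ∀ t, HasDerivAt (fun x => Real.sinh y * Real.cosh y - Real.sinh y * Real.cos x + y -
      y * Real.cosh y * Real.cos x - x * Real.sinh y * Real.sin x)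
        (y * Real.cosh y * Real.sin t - t * Real.cos t * Real.sinh y) t := by
      intro t
      have h1 := (Real.hasDerivAt_cos t).const_mul (Real.sinh y)
      have h2 := (Real.hasDerivAt_cos t).const_mul (y * Real.cosh y)
      have h3 := (((hasDerivAt_id t).mul_const (Real.sinh y))).mul (Real.hasDerivAt_sin t)
      refine HasDerivAt.congr_deriv
        ((((h1.const_sub (Real.sinh y * Real.cosh y)).add_const y).sub h2).sub h3) ?_
      simp only [id]
      ring
    apply monotoneOn_of_deriv_nonneg (convex_Icc 0 x)
    · exact fun t _ => (hd t).continuousAt.continuousWithinAt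
    · exact fun t _ => (hd t).differentiableAt.differentiableWithinAt
    · intro t ht
      rw [interior_Icc] at ht
      rw [(hd t).deriv]
      have h1 := mul_cos_le_sin ht.1.le (ht.2.le.trans hx)
      have h2 := sinh_le_mul_cosh hy.le
      have h3 := Real.sin_nonneg_of_nonneg_of_le_pi ht.1.le (ht.2.le.trans hx)
      nlinarith [mul_le_mul_of_nonneg_right h1 hs.le, mul_le_mul_of_nonneg_right h2 h3]
  have h := hm (left_mem_Icc.2 h0) (right_mem_Icc.2 h0) h0
  simp only [Real.cos_zero, zero_mul, sub_zero, mul_one] at h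
  have h2 : 0 < (Real.sinh y - y) * (Real.cosh y - 1) :=
    mul_pos (sub_pos.2 (Real.self_lt_sinh_iff.2 hy)) (sub_pos.2 (Real.one_lt_cosh.2 hy.ne'))
  nlinarith

lemma cos_lt_cosh {x y : ℝ} (hy : y ≠ 0) : Real.cos x < Real.cosh y :=
  lt_of_le_of_lt (Real.cos_le_one x) (Real.one_lt_cosh.2 hy)

/-- Each side is -Im(t cot(t(x + iy))) for t = a, b, and this quantity increases in t. The
logarithmic derivative of the symbol is a difference of two such cotangents, with t = π - α and t =
π. -/
lemma scaled_cot_im_lt {x y a b : ℝ} (ha : 0 < a) (hab : a < b) (hx : |2 * b * x| ≤ Real.pi)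
    (hy : 0 < y) :
    a * (Real.sinh (2 * a * y) / (Real.cosh (2 * a * y) - Real.cos (2 * a * x))) <
      b * (Real.sinh (2 * b * y) / (Real.cosh (2 * b * y) - Real.cos (2 * b * x))) := by
  have hm : StrictMonoOn (fun t => t * (Real.sinh (2 * t * y) /
      (Real.cosh (2 * t * y) - Real.cos (2 * t * x)))) (Icc a b) := by
    refine strictMonoOn_of_hasDerivAt_pos (f' := fun t =>
      1 * (Real.sinh (2 * t * y) / (Real.cosh (2 * t * y) - Real.cos (2 * t * x))) +
      t * ((Real.cosh (2 * t * y) * (2 * y) * (Real.cosh (2 * t * y) - Real.cos (2 * t * x)) -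
        Real.sinh (2 * t * y) * (Real.sinh (2 * t * y) * (2 * y) -
          -Real.sin (2 * t * x) * (2 * x))) /
        (Real.cosh (2 * t * y) - Real.cos (2 * t * x)) ^ 2)) ?_ ?_
    · intro t ht
      have ht0 : 0 < t := lt_of_lt_of_le ha ht.1
      have h1 : HasDerivAt (fun t : ℝ => 2 * t * y) (2 * y) t := by
        simpa using ((hasDerivAt_id t).const_mul 2).mul_const y
      have h2 : HasDerivAt (fun t : ℝ => 2 * t * x) (2 * x) t := by
        simpa using ((hasDerivAt_id t).const_mul 2).mul_const x
      have hne : Real.cosh (2 * t * y) - Real.cos (2 * t * x) ≠ 0 :=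
        (sub_pos.2 (cos_lt_cosh (by positivity))).ne'
      exact (hasDerivAt_id t).mul (h1.sinh.div (h1.cosh.sub h2.cos) hne)
    · intro t ht
      have ht0 : 0 < t := lt_trans ha ht.1
      have hpos : 0 < Real.cosh (2 * t * y) - Real.cos (2 * t * x) :=
        (sub_pos.2 (cos_lt_cosh (by positivity)))
      have hxt : |2 * t * x| ≤ Real.pi := by
        refine le_trans ?_ hx
        rw [abs_mul, abs_mul (2 * b), abs_of_pos (by positivity : 0 < 2 * t),
          abs_of_pos (by linarith : 0 < 2 * b)]
        exact mul_le_mul_of_nonneg_right (by linarith [ht.2]) (abs_nonneg _)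
      have key := cot_monotone_numerator_pos (y := 2 * t * y) hxt (by positivity)
      have hsq := Real.cosh_sq (2 * t * y)
      have : 1 * (Real.sinh (2 * t * y) / (Real.cosh (2 * t * y) - Real.cos (2 * t * x))) +
        t * ((Real.cosh (2 * t * y) * (2 * y) * (Real.cosh (2 * t * y) - Real.cos (2 * t * x)) -
        Real.sinh (2 * t * y) * (Real.sinh (2 * t * y) * (2 * y) -
          -Real.sin (2 * t * x) * (2 * x))) /
        (Real.cosh (2 * t * y) - Real.cos (2 * t * x)) ^ 2) =
        (Real.sinh (2 * t * y) * Real.cosh (2 * t * y) -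
          Real.sinh (2 * t * y) * Real.cos (2 * t * x) + 2 * t * y -
          2 * t * y * Real.cosh (2 * t * y) * Real.cos (2 * t * x) -
          2 * t * x * Real.sinh (2 * t * y) * Real.sin (2 * t * x)) /
        (Real.cosh (2 * t * y) - Real.cos (2 * t * x)) ^ 2 := by
        field_simp
        linear_combination 2 * t * y * hsq
      rw [this]
      positivity
  exact hm (left_mem_Icc.2 hab.le) (right_mem_Icc.2 hab.le) hab

/-! ### The symbol: holomorphy, absence of zeros and decay -/

lemma sin_re_im (z : ℂ) : (Complex.sin z).re = Real.sin z.re * Real.cosh z.im ∧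
    (Complex.sin z).im = Real.cos z.re * Real.sinh z.im := by
  rw [Complex.sin_eq]
  constructor <;>
  simp [Complex.sin_ofReal_re, Complex.cos_ofReal_re, Complex.sinh_ofReal_re,
    Complex.cosh_ofReal_re]

lemma cos_re_im (z : ℂ) : (Complex.cos z).re = Real.cos z.re * Real.cosh z.im ∧
    (Complex.cos z).im = -(Real.sin z.re * Real.sinh z.im) := by
  rw [Complex.cos_eq]
  constructor <;>
  simp [Complex.sin_ofReal_re, Complex.cos_ofReal_re, Complex.sinh_ofReal_re,
    Complex.cosh_ofReal_re]

/-- The entire function `sin (a z) / z`. -/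
noncomputable def sinQuot (a : ℝ) : ℂ → ℂ := dslope (fun z => Complex.sin (a * z)) 0

lemma differentiable_sinQuot (a : ℝ) : Differentiable ℂ (sinQuot a) := by
  have h : Differentiable ℂ (fun z : ℂ => Complex.sin (a * z)) := by fun_prop
  rw [← differentiableOn_univ] at h ⊢
  exact (Complex.differentiableOn_dslope univ_mem).2 h

lemma sinQuot_zero (a : ℝ) : sinQuot a 0 = a := by
  rw [sinQuot, dslope_same]
  have : HasDerivAt (fun z : ℂ => Complex.sin (a * z)) (Complex.cos (a * 0) * (a * 1)) 0 :=
    ((hasDerivAt_id (0 : ℂ)).const_mul (a : ℂ)).csin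
  rw [this.deriv]
  simp

lemma sinQuot_of_ne (a : ℝ) {z : ℂ} (hz : z ≠ 0) : sinQuot a z = Complex.sin (a * z) / z := by
  rw [sinQuot, dslope_of_ne _ hz, slope_def_field]
  simp

lemma sin_mul_ne_zero {a : ℝ} (ha : 0 < a) (haπ : a ≤ Real.pi) {z : ℂ} (hz : |z.re| < 1)
    (hz0 : z ≠ 0) : Complex.sin (a * z) ≠ 0 := by
  intro h
  rw [Complex.sin_eq_zero_iff] at h
  obtain ⟨k, hk⟩ := h
  have hre := congrArg Complex.re hk
  have him := congrArg Complex.im hk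
  simp at hre him
  rcases him with h | h
  · exact ha.ne' h
  · have hk0 : k = 0 := by
      have h1 : |(k : ℝ) * Real.pi| < Real.pi := by
        rw [← hre, abs_mul, abs_of_pos ha]
        nlinarith [abs_nonneg z.re, Real.pi_pos]
      rw [abs_mul, abs_of_pos Real.pi_pos] at h1
      have h2 : |(k : ℝ)| < 1 := by
        by_contra h3
        push Not at h3
        nlinarith [Real.pi_pos]
      exact_mod_cast Int.abs_lt_one_iff.1 (by exact_mod_cast h2)
    rw [hk0] at hre
    have : z.re = 0 := by simpa [ha.ne'] using hre
    exact hz0 (Complex.ext this h)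

lemma sinQuot_ne_zero {a : ℝ} (ha : 0 < a) (haπ : a ≤ Real.pi) {z : ℂ} (hz : |z.re| < 1) :
    sinQuot a z ≠ 0 := by
  by_cases h : z = 0
  · rw [h, sinQuot_zero]
    exact_mod_cast ha.ne'
  · rw [sinQuot_of_ne a h]
    exact div_ne_zero (sin_mul_ne_zero ha haπ hz h) h

/-- Dividing numerator and denominator by z removes the singularity at 0. The two entire functions
have no zeros in |Re z| < 1, which makes the symbol holomorphic and zero-free there. -/
lemma symbol_eq_sinQuot (α : ℝ) (z : ℂ) :
    symbol α z = sinQuot (Real.pi - α) z / sinQuot Real.pi z := by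
  rw [symbol]
  split_ifs with h
  · rw [h, sinQuot_zero, sinQuot_zero]
    have : (Real.pi : ℂ) ≠ 0 := by exact_mod_cast Real.pi_ne_zero
    push_cast
    field_simp
  · rw [sinQuot_of_ne _ h, sinQuot_of_ne _ h, div_div_div_cancel_right₀ h]
    push_cast
    rfl

lemma symbol_of_ne (α : ℝ) {z : ℂ} (hz : z ≠ 0) :
    symbol α z = Complex.sin (((Real.pi - α : ℝ) : ℂ) * z) / Complex.sin ((Real.pi : ℂ) * z) := by
  rw [symbol, if_neg hz]
  push_cast
  rfl

lemma symbol_zero (α : ℝ) : symbol α 0 = ((1 - α / Real.pi : ℝ) : ℂ) := by simp [symbol]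

lemma symbol_neg (α : ℝ) (z : ℂ) : symbol α (-z) = symbol α z := by
  simp [symbol, neg_div_neg_eq]

/-- The strip `|Re z| < r`. -/
def strip (r : ℝ) : Set ℂ := {z | |z.re| < r}

lemma isOpen_strip (r : ℝ) : IsOpen (strip r) :=
  isOpen_lt (Complex.continuous_re.abs) continuous_const

lemma convex_strip (r : ℝ) : Convex ℝ (strip r) := by
  have : strip r = Complex.reLm ⁻¹' (Ioo (-r) r) := by
    ext z; simp [strip, abs_lt]
  rw [this]
  exact (convex_Ioo _ _).linear_preimage _

lemma differentiableOn_symbol (α : ℝ) : DifferentiableOn ℂ (symbol α) (strip 1) := by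
  have h : symbol α = fun z => sinQuot (Real.pi - α) z / sinQuot Real.pi z :=
    funext (symbol_eq_sinQuot α)
  rw [h]
  exact (differentiable_sinQuot _).differentiableOn.div (differentiable_sinQuot _).differentiableOn
    fun z hz => sinQuot_ne_zero Real.pi_pos le_rfl hz

lemma symbol_ne_zero {α : ℝ} (hα0 : 0 < α) (hαπ : α < Real.pi) {z : ℂ} (hz : z ∈ strip 1) :
    symbol α z ≠ 0 := by
  rw [symbol_eq_sinQuot]
  exact div_ne_zero (sinQuot_ne_zero (by linarith) (by linarith) hz)
    (sinQuot_ne_zero Real.pi_pos le_rfl hz)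

/-- |sin(x + iy)| lies between |sinh y| and cosh y, so the quotient is of size e^((π-α)|y|) /
e^(π|y|). The 4 comes from sinh(π|y|) ≥ e^(π|y|)/4 for |y| ≥ 1. -/
lemma norm_symbol_le {α : ℝ} (hα0 : 0 < α) (hαπ : α < Real.pi) {z : ℂ} (hz : 1 ≤ |z.im|) :
    ‖symbol α z‖ ≤ 4 * Real.exp (-(α * |z.im|)) := by
  have hz0 : z ≠ 0 := by rintro rfl; simp at hz; linarith
  rw [symbol_of_ne α hz0, norm_div]
  have hpi := Real.pi_gt_three
  have habs : ∀ w : ℂ, ‖w‖ ^ 2 = w.re ^ 2 + w.im ^ 2 := fun w => by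
    rw [Complex.sq_norm, Complex.normSq_apply]; ring
  have h1 : ‖Complex.sin (((Real.pi - α : ℝ) : ℂ) * z)‖ ≤ Real.cosh ((Real.pi - α) * z.im) := by
    refine abs_le_of_sq_le_sq' ?_ (Real.cosh_pos _).le |>.2
    rw [habs, (sin_re_im _).1, (sin_re_im _).2, Complex.re_ofReal_mul, Complex.im_ofReal_mul]
    nlinarith [Real.sin_sq_add_cos_sq ((Real.pi - α) * z.re), Real.cosh_sq ((Real.pi - α) * z.im),
      sq_nonneg (Real.cos ((Real.pi - α) * z.re))]
  have h2 : Real.sinh (Real.pi * |z.im|) ≤ ‖Complex.sin ((Real.pi : ℂ) * z)‖ := by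
    refine abs_le_of_sq_le_sq' ?_ (norm_nonneg _) |>.2
    rw [habs, (sin_re_im _).1, (sin_re_im _).2, Complex.re_ofReal_mul, Complex.im_ofReal_mul]
    have h3 : Real.sinh (Real.pi * |z.im|) ^ 2 = Real.sinh (Real.pi * z.im) ^ 2 := by
      rcases abs_choice z.im with h | h
      · rw [h]
      · rw [h]
        simp
    rw [h3]
    nlinarith [Real.sin_sq_add_cos_sq (Real.pi * z.re), Real.cosh_sq (Real.pi * z.im),
      sq_nonneg (Real.sin (Real.pi * z.re))]
  have h3 : Real.cosh ((Real.pi - α) * z.im) ≤ Real.exp ((Real.pi - α) * |z.im|) := by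
    rw [← Real.cosh_abs, abs_mul, abs_of_pos (by linarith : 0 < Real.pi - α), Real.cosh_eq]
    have : Real.exp (-((Real.pi - α) * |z.im|)) ≤ Real.exp ((Real.pi - α) * |z.im|) := by
      apply Real.exp_le_exp.2
      have : 0 ≤ (Real.pi - α) * |z.im| := mul_nonneg (by linarith) (abs_nonneg _)
      linarith
    linarith
  have h4 : Real.exp (Real.pi * |z.im|) / 4 ≤ Real.sinh (Real.pi * |z.im|) := by
    rw [Real.sinh_eq]
    have h5 : 2 ≤ Real.exp (Real.pi * |z.im|) := by
      have := Real.add_one_le_exp (Real.pi * |z.im|)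
      nlinarith
    have h6 : Real.exp (-(Real.pi * |z.im|)) ≤ 1 := by
      apply Real.exp_le_one_iff.2
      have : 0 ≤ Real.pi * |z.im| := by positivity
      linarith
    linarith
  calc _ ≤ Real.exp ((Real.pi - α) * |z.im|) / (Real.exp (Real.pi * |z.im|) / 4) :=
        div_le_div₀ (Real.exp_pos _).le (h1.trans h3) (by positivity) (h4.trans h2)
    _ = _ := by
      rw [show -(α * |z.im|) = (Real.pi - α) * |z.im| - Real.pi * |z.im| by ring, Real.exp_sub]
      field_simp

lemma norm_symbol_le_inv_sq {α : ℝ} (hα0 : 0 < α) (hαπ : α < Real.pi) {z : ℂ} (hz : 1 ≤ |z.im|) :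
    ‖symbol α z‖ ≤ 8 / α ^ 2 / z.im ^ 2 := by
  refine (norm_symbol_le hα0 hαπ hz).trans ?_
  have h0 : 0 < α * |z.im| := by positivity
  have h := Real.quadratic_le_exp_of_nonneg h0.le
  rw [Real.exp_neg, ← sq_abs z.im, div_div, ← mul_pow, ← div_eq_mul_inv,
    div_le_div_iff₀ (Real.exp_pos _) (by positivity)]
  nlinarith

/-! ### The sign of the imaginary part of the symbol -/

lemma sin_div_sin_im (A B : ℂ) : (Complex.sin A / Complex.sin B).im =
    (Real.cos A.re * Real.sinh A.im * (Real.sin B.re * Real.cosh B.im) -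
      Real.sin A.re * Real.cosh A.im * (Real.cos B.re * Real.sinh B.im)) /
      Complex.normSq (Complex.sin B) := by
  rw [Complex.div_im, (sin_re_im A).1, (sin_re_im A).2, (sin_re_im B).1, (sin_re_im B).2]
  ring

lemma symbol_im_of_im_eq_zero (α : ℝ) {z : ℂ} (hz : z.im = 0) : (symbol α z).im = 0 := by
  by_cases h : z = 0
  · rw [h, symbol_zero, Complex.ofReal_im]
  · rw [symbol_of_ne _ h, sin_div_sin_im]
    simp [hz]

lemma symbol_pos_of_re_eq_zero {α : ℝ} (hαπ : α < Real.pi) {z : ℂ} (hz : z.re = 0)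
    (hz' : z.im ≠ 0) : 0 < (symbol α z).re ∧ (symbol α z).im = 0 := by
  have h : z ≠ 0 := by rintro rfl; simp at hz'
  have hne : Complex.sin (Real.pi * z) ≠ 0 :=
    sin_mul_ne_zero Real.pi_pos le_rfl (by simp [hz]) h
  rw [symbol_of_ne _ h]
  constructor
  · rw [Complex.div_re, (sin_re_im _).1, (sin_re_im _).2, (sin_re_im _).1, (sin_re_im _).2,
      Complex.re_ofReal_mul, Complex.im_ofReal_mul, Complex.re_ofReal_mul, Complex.im_ofReal_mul,
      hz]
    simp only [mul_zero, Real.sin_zero, zero_mul, zero_div, Real.cos_zero, one_mul, zero_add]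
    refine div_pos ?_ (Complex.normSq_pos.2 hne)
    rcases lt_or_gt_of_ne hz' with hz' | hz'
    · exact mul_pos_of_neg_of_neg (Real.sinh_neg_iff.2 (mul_neg_of_pos_of_neg (by linarith) hz'))
        (Real.sinh_neg_iff.2 (mul_neg_of_pos_of_neg Real.pi_pos hz'))
    · exact mul_pos (Real.sinh_pos_iff.2 (mul_pos (by linarith) hz'))
        (Real.sinh_pos_iff.2 (mul_pos Real.pi_pos hz'))
  · rw [sin_div_sin_im]
    simp [hz]

lemma symbol_im_pos_of_pos_pos {α : ℝ} (hα0 : 0 < α) (hαπ : α < Real.pi) {z : ℂ}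
    (hz : 0 < z.re) (hz2 : z.re < 1 / 2) (hz' : 0 < z.im) : 0 < (symbol α z).im := by
  have h : z ≠ 0 := by rintro rfl; simp at hz'
  have hne : Complex.sin (Real.pi * z) ≠ 0 :=
    sin_mul_ne_zero Real.pi_pos le_rfl (by rw [abs_of_pos hz]; linarith) h
  rw [symbol_of_ne _ h, sin_div_sin_im]
  refine div_pos ?_ (Complex.normSq_pos.2 hne)
  simp only [Complex.re_ofReal_mul, Complex.im_ofReal_mul]
  set a := Real.pi - α with ha
  have ha0 : 0 < a := by rw [ha]; linarith
  have haπ : a < Real.pi := by rw [ha]; linarith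
  have hpi := Real.pi_pos
  have h1 := sin_cos_scaled_lt ha0 haπ hz (by linarith)
  have h2 := sinh_cosh_scaled_lt ha0 haπ hz'
  have c1 : 0 < Real.cos (a * z.re) := Real.cos_pos_of_mem_Ioo
    ⟨by nlinarith [mul_pos ha0 hz], by nlinarith⟩
  have c2 : 0 < Real.cos (Real.pi * z.re) := Real.cos_pos_of_mem_Ioo
    ⟨by nlinarith [mul_pos hpi hz], by nlinarith⟩
  have s1 : 0 < Real.sin (a * z.re) :=
    Real.sin_pos_of_pos_of_lt_pi (mul_pos ha0 hz) (by nlinarith)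
  have s2 : 0 < Real.sin (Real.pi * z.re) :=
    Real.sin_pos_of_pos_of_lt_pi (mul_pos hpi hz) (by nlinarith)
  have t1 : 0 < Real.sinh (a * z.im) := Real.sinh_pos_iff.2 (mul_pos ha0 hz')
  have t2 : 0 < Real.sinh (Real.pi * z.im) := Real.sinh_pos_iff.2 (mul_pos hpi hz')
  have k1 := Real.cosh_pos (a * z.im)
  have k2 := Real.cosh_pos (Real.pi * z.im)
  -- The product of the trigonometric and the hyperbolic inequality, divided by aπ, is the
  -- positivity of the numerator of the imaginary part. Multiplying them needs cos(π Re z) > 0,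
  -- hence Re z < 1/2.
  have h3 := mul_lt_mul'' h1 h2 (by positivity) (by positivity)
  have h4 : 0 < a * Real.pi := by positivity
  refine pos_of_mul_pos_right (b := _) (a := a * Real.pi) ?_ h4.le
  linarith

lemma symbol_conj (α : ℝ) (z : ℂ) :
    symbol α ((starRingEnd ℂ) z) = (starRingEnd ℂ) (symbol α z) := by
  rw [symbol, symbol]
  simp only [map_eq_zero]
  split_ifs
  · simp
  · rw [map_div₀, ← Complex.sin_conj, ← Complex.sin_conj]
    simp

lemma symbol_im_neg {α : ℝ} (hα0 : 0 < α) (hαπ : α < Real.pi) {z : ℂ}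
    (hz : 0 < z.re) (hz2 : z.re < 1 / 2) (hz' : z.im < 0) : (symbol α z).im < 0 := by
  have := symbol_im_pos_of_pos_pos hα0 hαπ (z := (starRingEnd ℂ) z) (by simpa)
    (by rwa [Complex.conj_re]) (by simpa)
  rw [symbol_conj] at this
  simpa using this

lemma symbol_im_pos {α : ℝ} (hα0 : 0 < α) (hαπ : α < Real.pi) {z : ℂ}
    (hz : z.re < 0) (hz2 : -(1 / 2) < z.re) (hz' : z.im < 0) : 0 < (symbol α z).im := by
  have := symbol_im_pos_of_pos_pos hα0 hαπ (z := -z) (by simpa) (by simp; linarith)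
    (by simpa)
  rwa [symbol_neg] at this

/-- Off the imaginary axis the value is not real, and on it the value is positive. Hence the
principal logarithm of the symbol is holomorphic on the half-strip. -/
lemma symbol_mem_slitPlane {α : ℝ} (hα0 : 0 < α) (hαπ : α < Real.pi) {z : ℂ}
    (hz : z ∈ halfStrip) : symbol α z ∈ Complex.slitPlane := by
  obtain ⟨h1, h2⟩ := hz
  rw [abs_lt] at h1
  rw [Complex.mem_slitPlane_iff]
  rcases lt_trichotomy z.re 0 with h | h | h
  · exact Or.inr (symbol_im_pos hα0 hαπ h (by linarith) h2).ne'
  · exact Or.inl (symbol_pos_of_re_eq_zero hαπ h h2.ne).1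
  · exact Or.inr (symbol_im_neg hα0 hαπ h h1.2 h2).ne

/-! ### Injectivity of the symbol on the half-strip -/

lemma cos_div_sin_im (w : ℂ) (hw : w.im ≠ 0) : (Complex.cos w / Complex.sin w).im =
    -(Real.sinh (2 * w.im) / (Real.cosh (2 * w.im) - Real.cos (2 * w.re))) := by
  have h1 := Real.sin_sq_add_cos_sq w.re
  have h2 := Real.cosh_sq w.im
  have hs := sin_re_im w
  have hc := cos_re_im w
  have hn : Complex.normSq (Complex.sin w) =
      (Real.cosh (2 * w.im) - Real.cos (2 * w.re)) / 2 := by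
    rw [Complex.normSq_apply, hs.1, hs.2, Real.cosh_two_mul, Real.cos_two_mul]
    linear_combination (Real.cosh w.im ^ 2) * h1 - (Real.cos w.re ^ 2 - 1 / 2) * h2
  have hpos : 0 < Real.cosh (2 * w.im) - Real.cos (2 * w.re) :=
    sub_pos.2 (cos_lt_cosh (by simpa using hw))
  rw [Complex.div_im, hn, hs.1, hs.2, hc.1, hc.2, Real.sinh_two_mul]
  field_simp
  linear_combination -h1

lemma hasDerivAt_symbol {α : ℝ} (hαπ : α < Real.pi) (hα0 : 0 < α) {z : ℂ} (hz : z ∈ strip 1)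
    (hz0 : z ≠ 0) : HasDerivAt (symbol α) (symbol α z *
      ((Real.pi - α : ℝ) * (Complex.cos ((Real.pi - α : ℝ) * z) /
          Complex.sin ((Real.pi - α : ℝ) * z)) -
        Real.pi * (Complex.cos (Real.pi * z) / Complex.sin (Real.pi * z)))) z := by
  set a : ℝ := Real.pi - α with ha
  have hne1 : Complex.sin (a * z) ≠ 0 :=
    sin_mul_ne_zero (by rw [ha]; linarith) (by rw [ha]; linarith) hz hz0
  have hne2 : Complex.sin (Real.pi * z) ≠ 0 := sin_mul_ne_zero Real.pi_pos le_rfl hz hz0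
  have h1 : HasDerivAt (fun z : ℂ => Complex.sin (a * z)) (Complex.cos (a * z) * (a * 1)) z :=
    ((hasDerivAt_id z).const_mul (a : ℂ)).csin
  have h2 : HasDerivAt (fun z : ℂ => Complex.sin (Real.pi * z))
      (Complex.cos (Real.pi * z) * (Real.pi * 1)) z :=
    ((hasDerivAt_id z).const_mul (Real.pi : ℂ)).csin
  have h3 := h1.div h2 hne2
  have h4 : symbol α =ᶠ[𝓝 z] (fun z : ℂ => Complex.sin (a * z)) /
      (fun z : ℂ => Complex.sin (Real.pi * z)) := by
    filter_upwards [isOpen_ne.mem_nhds hz0] with w hw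
    exact symbol_of_ne α hw
  refine (h3.congr_of_eventuallyEq h4).congr_deriv ?_
  rw [symbol_of_ne α hz0, ← ha]
  generalize Complex.sin (Real.pi * z) = B at hne2
  generalize Complex.sin (a * z) = A at hne1
  field_simp

lemma symbol_logDeriv_im_neg {α : ℝ} (hα0 : 0 < α) (hαπ : α < Real.pi) {z : ℂ}
    (hz : z ∈ halfStrip) :
    ((Real.pi - α : ℝ) * (Complex.cos ((Real.pi - α : ℝ) * z) /
          Complex.sin ((Real.pi - α : ℝ) * z)) -
        Real.pi * (Complex.cos (Real.pi * z) / Complex.sin (Real.pi * z))).im < 0 := by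
  obtain ⟨h1, h2⟩ := hz
  set a : ℝ := Real.pi - α with ha
  have ha0 : 0 < a := by rw [ha]; linarith
  have haπ : a < Real.pi := by rw [ha]; linarith
  have key := scaled_cot_im_lt (x := z.re) (y := -z.im) ha0 haπ (by
    rw [abs_mul, abs_of_pos (by positivity)]; nlinarith [Real.pi_pos, abs_nonneg z.re])
    (by linarith)
  rw [Complex.sub_im, Complex.im_ofReal_mul, Complex.im_ofReal_mul, cos_div_sin_im, cos_div_sin_im]
  · simp only [Complex.re_ofReal_mul, Complex.im_ofReal_mul]
    simp only [mul_neg, Real.sinh_neg, Real.cosh_neg, neg_div, mul_assoc] at key ⊢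
    linarith
  · simpa [Real.pi_ne_zero] using h2.ne
  · simpa [ha0.ne'] using h2.ne

lemma halfStrip_subset : halfStrip ⊆ strip 1 := fun z hz => by
  have := hz.1
  show |z.re| < 1
  linarith

lemma ne_zero_of_mem_halfStrip {z : ℂ} (hz : z ∈ halfStrip) : z ≠ 0 := by
  rintro rfl
  simpa using hz.2

lemma convex_halfStrip : Convex ℝ halfStrip := by
  have : halfStrip = strip (1 / 2) ∩ Complex.imLm ⁻¹' (Iio 0) := by
    ext z; simp [strip, halfStrip]
  rw [this]
  exact (convex_strip _).inter ((convex_Iio _).linear_preimage _)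

/-- The Noshiro–Warschawski argument applied to log σ: along the segment joining two points of the
convex half-strip, the increment of log σ divided by z₂ - z₁ is an average of derivatives with
negative imaginary part, so it cannot vanish. -/
lemma injOn_symbol {α : ℝ} (hα0 : 0 < α) (hαπ : α < Real.pi) : InjOn (symbol α) halfStrip := by
  intro z₁ h₁ z₂ h₂ heq
  by_contra hne
  have hd : z₂ - z₁ ≠ 0 := sub_ne_zero.2 (Ne.symm hne)
  have hmem : ∀ t ∈ Icc (0 : ℝ) 1, z₁ + t * (z₂ - z₁) ∈ halfStrip := fun t ht => by
    have := convex_halfStrip.add_smul_sub_mem h₁ h₂ ht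
    simpa using this
  have hder : ∀ t ∈ Icc (0 : ℝ) 1, HasDerivAt
      (fun t : ℝ => -(Complex.log (symbol α (z₁ + t * (z₂ - z₁))) / (z₂ - z₁)).im)
      (-((Real.pi - α : ℝ) * (Complex.cos ((Real.pi - α : ℝ) * (z₁ + t * (z₂ - z₁))) /
          Complex.sin ((Real.pi - α : ℝ) * (z₁ + t * (z₂ - z₁)))) -
        Real.pi * (Complex.cos (Real.pi * (z₁ + t * (z₂ - z₁))) /
          Complex.sin (Real.pi * (z₁ + t * (z₂ - z₁))))).im) t := by
    intro t ht
    have hm := hmem t ht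
    have hs := hasDerivAt_symbol hαπ hα0 (halfStrip_subset hm) (ne_zero_of_mem_halfStrip hm)
    have hl := hs.clog (symbol_mem_slitPlane hα0 hαπ hm)
    have hlin : HasDerivAt (fun t : ℝ => z₁ + (t : ℂ) * (z₂ - z₁)) (z₂ - z₁) t := by
      simpa using ((Complex.ofRealCLM.hasDerivAt (x := t)).mul_const (z₂ - z₁)).const_add z₁
    have hc := (hl.scomp t hlin).div_const (z₂ - z₁)
    have him := (Complex.imCLM.hasFDerivAt.comp_hasDerivAt t hc).neg
    refine him.congr_deriv ?_
    simp only [Complex.imCLM_apply, smul_eq_mul]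
    have := symbol_ne_zero hα0 hαπ (halfStrip_subset hm)
    rw [mul_div_cancel_left₀ _ hd, mul_div_cancel_left₀ _ this]
  have hmono := strictMonoOn_of_hasDerivAt_pos hder fun t ht => by
    have := symbol_logDeriv_im_neg hα0 hαπ (hmem t (Ioo_subset_Icc_self ht))
    linarith
  have := hmono (left_mem_Icc.2 zero_le_one) (right_mem_Icc.2 zero_le_one) zero_lt_one
  simp [heq] at this

lemma deriv_symbol_ne_zero {α : ℝ} (hα0 : 0 < α) (hαπ : α < Real.pi) {z : ℂ}
    (hz : z ∈ halfStrip) : deriv (symbol α) z ≠ 0 := by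
  rw [(hasDerivAt_symbol hαπ hα0 (halfStrip_subset hz) (ne_zero_of_mem_halfStrip hz)).deriv]
  refine mul_ne_zero (symbol_ne_zero hα0 hαπ (halfStrip_subset hz)) fun h => ?_
  have := symbol_logDeriv_im_neg hα0 hαπ hz
  rw [h] at this
  simp at this

/-! ### The closed curve and the region that it bounds -/

/-- Inside the closed strip the symbol tends to 0 at infinity, so 0 is the only limit value that the
image of a closed set can miss. -/
lemma isCompact_insert_symbol_image {α : ℝ} (hα0 : 0 < α) (hαπ : α < Real.pi) {A : Set ℂ}
    (hA : IsClosed A) (hA' : ∀ z ∈ A, |z.re| ≤ 1 / 2) : IsCompact (insert 0 (symbol α '' A)) := by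
  have hr : symbol α '' A = range (fun z : A => symbol α z) := by
    rw [image_eq_range]
  rw [hr]
  apply Filter.Tendsto.isCompact_insert_range_of_cocompact
  · have h1 : Tendsto (fun z : A => ‖(z : ℂ)‖) (cocompact A) atTop :=
      tendsto_norm_cocompact_atTop.comp hA.isClosedEmbedding_subtypeVal.tendsto_cocompact
    have h2 : Tendsto (fun z : A => 4 * Real.exp (-(α * (‖(z : ℂ)‖ - 1 / 2)))) (cocompact A)
        (𝓝 0) := by
      rw [← mul_zero (4 : ℝ)]
      refine Tendsto.const_mul _ (Real.tendsto_exp_neg_atTop_nhds_zero.comp ?_)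
      exact (tendsto_atTop_add_const_right _ _ h1).const_mul_atTop hα0
    refine squeeze_zero_norm' ?_ h2
    filter_upwards [h1.eventually_ge_atTop 2] with z hz
    have h3 : ‖(z : ℂ)‖ - 1 / 2 ≤ |(z : ℂ).im| := by
      have := Complex.norm_le_abs_re_add_abs_im z
      linarith [hA' z z.2]
    refine (norm_symbol_le hα0 hαπ (by linarith)).trans ?_
    gcongr
  · have : ContinuousOn (symbol α) A := (differentiableOn_symbol α).continuousOn.mono fun z hz => by
      have := hA' z hz
      show |z.re| < 1
      linarith
    exact continuousOn_iff_continuous_domRestrict.1 this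

/-- The line `Re z = -1/2`. -/
def leftLine : Set ℂ := {z | z.re = 1 / 2 - 1}

lemma isClosed_leftLine : IsClosed leftLine :=
  isClosed_eq Complex.continuous_re continuous_const

lemma abs_re_of_mem_leftLine {z : ℂ} (hz : z ∈ leftLine) : |z.re| = 1 / 2 := by
  have : z.re = 1 / 2 - 1 := hz
  rw [this]; norm_num

lemma sigmaCurve_eq {α : ℝ} (hα0 : 0 < α) (hαπ : α < Real.pi) :
    sigmaCurve 1 α = insert 0 (symbol α '' leftLine) := by
  apply Subset.antisymm
  · exact closure_minimal (subset_insert _ _) (isCompact_insert_symbol_image hα0 hαπ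
      isClosed_leftLine fun z hz => (abs_re_of_mem_leftLine hz).le).isClosed
  · refine insert_subset ?_ subset_closure
    have h : Tendsto (fun n : ℕ => symbol α ⟨1 / 2 - 1, n⟩) atTop (𝓝 0) := by
      have h2 : Tendsto (fun n : ℕ => 4 * Real.exp (-(α * (n : ℝ)))) atTop (𝓝 0) := by
        rw [← mul_zero (4 : ℝ)]
        refine Tendsto.const_mul _ (Real.tendsto_exp_neg_atTop_nhds_zero.comp ?_)
        exact tendsto_natCast_atTop_atTop.const_mul_atTop hα0
      refine squeeze_zero_norm' ?_ h2
      filter_upwards [eventually_ge_atTop 1] with n hn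
      have hn' : (1 : ℝ) ≤ n := by exact_mod_cast hn
      have := norm_symbol_le hα0 hαπ (z := ⟨1 / 2 - 1, n⟩) (by simpa using hn')
      simpa using this
    exact mem_closure_of_tendsto h (Eventually.of_forall fun n => ⟨_, rfl, rfl⟩)

lemma symbol_mem_sigmaCurve {α : ℝ} {z : ℂ} (hz : |z.re| = 1 / 2) :
    symbol α z ∈ sigmaCurve 1 α := by
  apply subset_closure
  rcases (abs_eq (by norm_num)).1 hz with h | h
  · exact ⟨-z, by simp [h]; norm_num, symbol_neg α z⟩
  · exact ⟨z, by simp [h]; norm_num, rfl⟩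

/-- On this line sin(πz) is the real number -cosh(π Im z), so real and imaginary parts separate. -/
lemma symbol_leftLine {α : ℝ} {z : ℂ} (hz : z ∈ leftLine) :
    (symbol α z).re = Real.sin ((Real.pi - α) / 2) * Real.cosh ((Real.pi - α) * z.im) /
        Real.cosh (Real.pi * z.im) ∧
      (symbol α z).im = -(Real.cos ((Real.pi - α) / 2) * Real.sinh ((Real.pi - α) * z.im)) /
        Real.cosh (Real.pi * z.im) := by
  have hre : z.re = -(1 / 2) := by
    have : z.re = 1 / 2 - 1 := hz
    rw [this]; norm_num
  have h0 : z ≠ 0 := by rintro rfl; simp at hre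
  have hs : Complex.sin (Real.pi * z) = ((-Real.cosh (Real.pi * z.im) : ℝ) : ℂ) := by
    apply Complex.ext
    · rw [(sin_re_im _).1, Complex.re_ofReal_mul, Complex.im_ofReal_mul, hre, Complex.ofReal_re,
        mul_neg, Real.sin_neg, mul_one_div, Real.sin_pi_div_two]
      ring
    · rw [(sin_re_im _).2, Complex.re_ofReal_mul, Complex.im_ofReal_mul, hre, Complex.ofReal_im,
        mul_neg, Real.cos_neg, mul_one_div, Real.cos_pi_div_two]
      ring
  rw [symbol_of_ne _ h0, hs, Complex.div_ofReal_re, Complex.div_ofReal_im, (sin_re_im _).1,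
    (sin_re_im _).2, Complex.re_ofReal_mul, Complex.im_ofReal_mul, hre, mul_neg, Real.sin_neg,
    Real.cos_neg, mul_one_div]
  constructor
  · rw [neg_mul, neg_div_neg_eq]
  · rw [div_neg, neg_div]

/-- The union of the open segments from `0` to the points of the curve. -/
def segmentDomain (α : ℝ) : Set ℂ :=
  {w | ∃ z ∈ leftLine, ∃ r ∈ Ioo (0 : ℝ) 1, w = r * symbol α z}

/-- Along the line the ratio of imaginary to real part is a nonzero constant times tanh((π - α) Im
z), which is injective. So a line through 0 meets the curve in at most one point besides 0. -/
lemma eq_of_mul_symbol_leftLine {α : ℝ} (hα0 : 0 < α) (hαπ : α < Real.pi) {z z' : ℂ}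
    (hz : z ∈ leftLine) (hz' : z' ∈ leftLine) {r : ℝ} (hr : r * symbol α z = symbol α z') :
    r = 1 := by
  set a := Real.pi - α with ha
  have ha0 : 0 < a := by rw [ha]; linarith
  have haπ : a < Real.pi := by rw [ha]; linarith
  have hs : 0 < Real.sin (a / 2) := Real.sin_pos_of_pos_of_lt_pi (by linarith) (by linarith)
  have hc : 0 < Real.cos (a / 2) := Real.cos_pos_of_mem_Ioo ⟨by linarith, by linarith⟩
  have h1 := congrArg Complex.re hr
  have h2 := congrArg Complex.im hr
  rw [Complex.re_ofReal_mul, (symbol_leftLine hz).1, (symbol_leftLine hz').1, ← ha] at h1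
  rw [Complex.im_ofReal_mul, (symbol_leftLine hz).2, (symbol_leftLine hz').2, ← ha] at h2
  have k1 := Real.cosh_pos (Real.pi * z.im)
  have k2 := Real.cosh_pos (Real.pi * z'.im)
  have k3 := Real.cosh_pos (a * z.im)
  have k4 := Real.cosh_pos (a * z'.im)
  have h3 : Real.sinh (a * (z'.im - z.im)) = 0 := by
    rw [mul_sub, Real.sinh_sub]
    field_simp at h1 h2
    have hr0 : r ≠ 0 := by
      rintro rfl
      rw [Complex.ofReal_zero, zero_mul] at hr
      refine symbol_ne_zero hα0 hαπ (z := z') ?_ hr.symm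
      show |z'.re| < 1
      rw [abs_re_of_mem_leftLine hz']; norm_num
    -- Eliminating the trigonometric constants between the two coordinate equations leaves a
    -- multiple of sinh(a(Im z' - Im z)).
    have hE : r * Real.cosh (Real.pi * z'.im) *
        (Real.sinh (a * z'.im) * Real.cosh (a * z.im) -
          Real.cosh (a * z'.im) * Real.sinh (a * z.im)) = 0 := by
      linear_combination Real.sinh (a * z'.im) * h1 + Real.cosh (a * z'.im) * h2
    rcases mul_eq_zero.1 hE with h | h
    · exact absurd h (mul_ne_zero hr0 k2.ne')
    · exact h
  have h4 : z'.im = z.im := by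
    have := Real.sinh_eq_zero.1 h3
    rcases mul_eq_zero.1 this with h | h
    · exact absurd h ha0.ne'
    · linarith
  have h5 : z' = z := Complex.ext (Eq.trans hz' (Eq.symm hz)) h4
  rw [h5] at hr
  have hne : symbol α z ≠ 0 := symbol_ne_zero hα0 hαπ (by
    show |z.re| < 1
    rw [abs_re_of_mem_leftLine hz]; norm_num)
  exact_mod_cast mul_right_cancel₀ hne (hr.trans (one_mul _).symm)

lemma segmentDomain_disjoint_sigmaCurve {α : ℝ} (hα0 : 0 < α) (hαπ : α < Real.pi) {w : ℂ}
    (hw : w ∈ segmentDomain α) : w ∉ sigmaCurve 1 α := by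
  obtain ⟨z, hz, r, hr, rfl⟩ := hw
  have hne : symbol α z ≠ 0 := symbol_ne_zero hα0 hαπ (by
    show |z.re| < 1
    rw [abs_re_of_mem_leftLine hz]; norm_num)
  rw [sigmaCurve_eq hα0 hαπ]
  rintro (h | ⟨z', hz', h⟩)
  · rcases mul_eq_zero.1 h with h | h
    · exact hr.1.ne' (by exact_mod_cast h)
    · exact hne h
  · exact hr.2.ne (eq_of_mul_symbol_leftLine hα0 hαπ hz hz' h.symm)

lemma isPreconnected_segmentDomain (α : ℝ) : IsPreconnected (segmentDomain α) := by
  have h : segmentDomain α = (fun p : ℝ × ℝ => (p.1 : ℂ) * symbol α (⟨1 / 2 - 1, p.2⟩ : ℂ)) ''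
      (Ioo (0 : ℝ) 1 ×ˢ univ) := by
    ext w
    constructor
    · rintro ⟨z, hz, r, hr, rfl⟩
      refine ⟨(r, z.im), ⟨hr, trivial⟩, ?_⟩
      have : (⟨1 / 2 - 1, z.im⟩ : ℂ) = z := Complex.ext hz.symm rfl
      simp only [this]
    · rintro ⟨p, hp, rfl⟩
      exact ⟨⟨1 / 2 - 1, p.2⟩, rfl, p.1, hp.1, rfl⟩
  rw [h]
  refine (isPreconnected_Ioo.prod isPreconnected_univ).image _ ?_
  refine ContinuousOn.mul (by fun_prop) ?_
  refine (differentiableOn_symbol α).continuousOn.comp (t := strip 1) ?_ ?_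
  · have : (fun p : ℝ × ℝ => (⟨1 / 2 - 1, p.2⟩ : ℂ)) =
        fun p : ℝ × ℝ => ((1 / 2 - 1 : ℝ) : ℂ) + p.2 * Complex.I := by
      ext p
      apply Complex.ext <;> simp
    rw [this]
    fun_prop
  · intro p _
    show |(1 / 2 - 1 : ℝ)| < 1
    norm_num [abs_lt]

/-- If w is on no open segment from 0 to the curve, the outward ray from w avoids the curve, so the
component of w is unbounded. -/
lemma sigmaInterior_subset_segmentDomain {α : ℝ} (hα0 : 0 < α) (hαπ : α < Real.pi) :
    sigmaInterior 1 α ⊆ segmentDomain α := by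
  rintro w ⟨hw, hb⟩
  have hw0 : w ≠ 0 := by
    rintro rfl
    rw [sigmaCurve_eq hα0 hαπ] at hw
    exact hw (mem_insert _ _)
  by_contra hD
  have hray : (fun t : ℝ => (t : ℂ) * w) '' Ici 1 ⊆ (sigmaCurve 1 α)ᶜ := by
    rintro _ ⟨t, ht, rfl⟩ hmem
    have ht' : (1 : ℝ) ≤ t := ht
    have ht0 : (t : ℂ) ≠ 0 := by
      have : t ≠ 0 := by linarith
      exact_mod_cast this
    have hcopy := hmem
    rw [sigmaCurve_eq hα0 hαπ] at hmem
    rcases hmem with h | ⟨z, hz, h⟩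
    · exact (mul_ne_zero ht0 hw0) h
    · rcases ht'.eq_or_lt with h1 | h1
      · rw [← h1] at hcopy
        simp at hcopy
        exact hw hcopy
      · refine hD ⟨z, hz, t⁻¹, ⟨by positivity, inv_lt_one_of_one_lt₀ h1⟩, ?_⟩
        rw [h]
        push_cast
        field_simp
  have hpre : IsPreconnected ((fun t : ℝ => (t : ℂ) * w) '' Ici 1) :=
    isPreconnected_Ici.image _ (by fun_prop)
  have hsub := hpre.subset_connectedComponentIn (x := w) ⟨1, mem_Ici.2 le_rfl, by simp⟩ hray
  obtain ⟨R, hR⟩ := (hb.subset hsub).exists_norm_le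
  have hwn : 0 < ‖w‖ := norm_pos_iff.2 hw0
  -- This point of the ray has norm |R| + ‖w‖, beyond the supposed bound R.
  have h1 := hR _ ⟨|R| / ‖w‖ + 1, by show (1 : ℝ) ≤ _; have := abs_nonneg R; simp; positivity, rfl⟩
  rw [norm_mul, Complex.norm_real, Real.norm_of_nonneg (by positivity), add_mul,
    div_mul_cancel₀ _ hwn.ne'] at h1
  linarith [le_abs_self R]

/-! ### The interior of the curve and the image of the open strip -/

/-- Open mapping theorem; the symbol is not constant, being real at 0 and nonreal at 1/4 - i. -/
lemma isOpen_symbol_image {α : ℝ} (hα0 : 0 < α) (hαπ : α < Real.pi) :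
    IsOpen (symbol α '' strip (1 / 2)) := by
  have hsub : strip (1 / 2) ⊆ strip 1 := fun z (hz : |z.re| < 1 / 2) =>
    show |z.re| < 1 by linarith
  have han : AnalyticOnNhd ℂ (symbol α) (strip (1 / 2)) :=
    ((differentiableOn_symbol α).mono hsub).analyticOnNhd (isOpen_strip _)
  rcases han.is_constant_or_isOpen (convex_strip _).isPreconnected with ⟨w, hw⟩ | h
  · exfalso
    have h1 := hw 0 (by simp [strip])
    have h2 := hw ⟨1 / 4, -1⟩ (by simp [strip, abs_lt]; norm_num)
    have h3 := symbol_im_neg hα0 hαπ (z := ⟨1 / 4, -1⟩) (by norm_num) (by norm_num) (by norm_num)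
    rw [h2, ← h1, symbol_im_of_im_eq_zero _ (by simp)] at h3
    exact lt_irrefl _ h3
  · exact h _ subset_rfl (isOpen_strip _)

lemma strip_subset_closedStrip : strip (1 / 2) ⊆ {z : ℂ | |z.re| ≤ 1 / 2} :=
  fun z (hz : |z.re| < 1 / 2) => hz.le

lemma closure_symbol_image_subset {α : ℝ} (hα0 : 0 < α) (hαπ : α < Real.pi) :
    closure (symbol α '' strip (1 / 2)) ⊆ symbol α '' strip (1 / 2) ∪ sigmaCurve 1 α := by
  have hcl : IsClosed {z : ℂ | |z.re| ≤ 1 / 2} :=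
    isClosed_le (Complex.continuous_re.abs) continuous_const
  have hc := isCompact_insert_symbol_image hα0 hαπ hcl fun z hz => hz
  have h1 : closure (symbol α '' strip (1 / 2)) ⊆ insert 0 (symbol α '' {z : ℂ | |z.re| ≤ 1 / 2}) :=
    closure_minimal ((image_mono strip_subset_closedStrip).trans
      (subset_insert _ _)) hc.isClosed
  intro w hw
  rcases h1 hw with rfl | ⟨z, hz, rfl⟩
  · right
    rw [sigmaCurve_eq hα0 hαπ]
    exact mem_insert _ _
  · rcases (show |z.re| ≤ 1 / 2 from hz).lt_or_eq with h | h
    · exact Or.inl ⟨z, h, rfl⟩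
    · exact Or.inr (symbol_mem_sigmaCurve h)

lemma isBounded_symbol_image {α : ℝ} (hα0 : 0 < α) (hαπ : α < Real.pi) :
    Bornology.IsBounded (symbol α '' strip (1 / 2)) := by
  have hcl : IsClosed {z : ℂ | |z.re| ≤ 1 / 2} :=
    isClosed_le (Complex.continuous_re.abs) continuous_const
  exact (isCompact_insert_symbol_image hα0 hαπ hcl fun z hz => hz).isBounded.subset
    ((image_mono strip_subset_closedStrip).trans (subset_insert _ _))

/-- The image of the strip is open and its closure adds only points of the curve. Relative to the
complement of the curve it is thus clopen, and a component meeting it stays inside this bounded set.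
-/
lemma symbol_image_diff_subset_sigmaInterior {α : ℝ} (hα0 : 0 < α) (hαπ : α < Real.pi) :
    symbol α '' strip (1 / 2) \ sigmaCurve 1 α ⊆ sigmaInterior 1 α := by
  rintro w ⟨hw, hwc⟩
  refine ⟨hwc, (isBounded_symbol_image hα0 hαπ).subset ?_⟩
  refine isPreconnected_connectedComponentIn.subset_of_closure_inter_subset
    (isOpen_symbol_image hα0 hαπ) ⟨w, mem_connectedComponentIn hwc, hw⟩ ?_
  rintro v ⟨hv, hv'⟩
  rcases closure_symbol_image_subset hα0 hαπ hv with h | h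
  · exact h
  · exact absurd h (connectedComponentIn_subset _ _ hv')

/-- A differentiable image of a null line, plus one point. Being null, the curve has dense
complement, so the open image of the strip has points off the curve and its part off the curve is
dense in it; no proof that image and curve are disjoint is needed. -/
lemma volume_sigmaCurve {α : ℝ} (hα0 : 0 < α) (hαπ : α < Real.pi) :
    volume (sigmaCurve 1 α) = 0 := by
  rw [sigmaCurve_eq hα0 hαπ, insert_eq]
  refine measure_union_null (by simp) ?_
  refine addHaar_image_eq_zero_of_differentiableOn_of_addHaar_eq_zero volume ?_ ?_
  · refine ((differentiableOn_symbol α).restrictScalars ℝ).mono fun z hz => ?_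
    show |z.re| < 1
    rw [abs_re_of_mem_leftLine hz]; norm_num
  · have h : leftLine = Complex.measurableEquivRealProd ⁻¹' ({1 / 2 - 1} ×ˢ univ) := by
      ext z
      simp [leftLine, Complex.measurableEquivRealProd]
    rw [h, Complex.volume_preserving_equiv_real_prod.measure_preimage_equiv]
    rw [Measure.volume_eq_prod, Measure.prod_prod]
    simp

lemma dense_diff_sigmaCurve {α : ℝ} (hα0 : 0 < α) (hαπ : α < Real.pi) {U : Set ℂ}
    (hU : IsOpen U) : U ⊆ closure (U \ sigmaCurve 1 α) := by
  have hd : Dense (sigmaCurve 1 α)ᶜ := by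
    rw [← interior_eq_empty_iff_dense_compl]
    exact Measure.interior_eq_empty_of_null (volume_sigmaCurve hα0 hαπ)
  exact hd.open_subset_closure_inter hU

/-- The union of segments is connected, avoids the curve and contains a point of the image. By the
clopen argument all of it lies in the image. -/
lemma sigmaInterior_subset_symbol_image {α : ℝ} (hα0 : 0 < α) (hαπ : α < Real.pi) :
    sigmaInterior 1 α ⊆ symbol α '' strip (1 / 2) := by
  refine (sigmaInterior_subset_segmentDomain hα0 hαπ).trans ?_
  have hne : (symbol α '' strip (1 / 2) \ sigmaCurve 1 α).Nonempty := by
    rw [← closure_nonempty_iff]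
    refine Set.Nonempty.mono (dense_diff_sigmaCurve hα0 hαπ (isOpen_symbol_image hα0 hαπ)) ?_
    exact ⟨_, 0, by simp [strip], rfl⟩
  obtain ⟨w, hw⟩ := hne
  refine (isPreconnected_segmentDomain α).subset_of_closure_inter_subset
    (isOpen_symbol_image hα0 hαπ) ⟨w, sigmaInterior_subset_segmentDomain hα0 hαπ
      (symbol_image_diff_subset_sigmaInterior hα0 hαπ hw), hw.1⟩ ?_
  rintro v ⟨hv, hv'⟩
  rcases closure_symbol_image_subset hα0 hαπ hv with h | h
  · exact h
  · exact absurd h (segmentDomain_disjoint_sigmaCurve hα0 hαπ hv')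

/-- Points of the closed strip are limits of rz with r < 1, which lie in the open strip. It shows
that for w off the closed region the equation σ = w has no root in the closed strip. -/
lemma symbol_mem_closure_sigmaInterior {α : ℝ} (hα0 : 0 < α) (hαπ : α < Real.pi) {z : ℂ}
    (hz : |z.re| ≤ 1 / 2) : symbol α z ∈ closure (sigmaInterior 1 α) := by
  have h1 : symbol α '' strip (1 / 2) ⊆ closure (sigmaInterior 1 α) :=
    (dense_diff_sigmaCurve hα0 hαπ (isOpen_symbol_image hα0 hαπ)).trans
      (closure_mono (symbol_image_diff_subset_sigmaInterior hα0 hαπ))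
  have h2 : closure (symbol α '' strip (1 / 2)) ⊆ closure (sigmaInterior 1 α) :=
    closure_minimal h1 isClosed_closure
  apply h2
  have h3 : Tendsto (fun r : ℝ => symbol α ((r : ℂ) * z)) (𝓝[<] 1) (𝓝 (symbol α z)) := by
    have hc : ContinuousAt (symbol α) z := (differentiableOn_symbol α).continuousOn.continuousAt
      ((isOpen_strip 1).mem_nhds (show |z.re| < 1 by linarith))
    have hl : Tendsto (fun r : ℝ => (r : ℂ) * z) (𝓝[<] 1) (𝓝 z) := by
      have : ContinuousAt (fun r : ℝ => (r : ℂ) * z) 1 := by fun_prop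
      have := this.tendsto.mono_left (nhdsWithin_le_nhds (s := Iio 1))
      simpa using this
    exact hc.tendsto.comp hl
  refine mem_closure_of_tendsto h3 ?_
  filter_upwards [Ioo_mem_nhdsLT (show (0 : ℝ) < 1 by norm_num)] with r hr
  refine ⟨_, ?_, rfl⟩
  show |((r : ℂ) * z).re| < 1 / 2
  rw [Complex.re_ofReal_mul, abs_mul, abs_of_pos hr.1]
  nlinarith [abs_nonneg z.re, hr.1, hr.2]

lemma zero_mem_closure_sigmaInterior {α : ℝ} (hα0 : 0 < α) (hαπ : α < Real.pi) :
    (0 : ℂ) ∈ closure (sigmaInterior 1 α) := by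
  have h0 : (0 : ℂ) ∈ sigmaCurve 1 α := by
    rw [sigmaCurve_eq hα0 hαπ]
    exact mem_insert _ _
  refine closure_minimal ?_ isClosed_closure h0
  rintro _ ⟨z, hz, rfl⟩
  exact symbol_mem_closure_sigmaInterior hα0 hαπ (abs_re_of_mem_leftLine hz).le

/-! ### Roots of the characteristic equation -/

/-- A preimage in the strip is not real, because the symbol is real on the real axis; by evenness it
can be reflected into the lower half-strip. -/
lemma muInv_spec {α : ℝ} (hα0 : 0 < α) (hαπ : α < Real.pi) {w : ℂ}
    (hw : w ∈ sigmaInterior 1 α) (hw' : w.im ≠ 0) :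
    muInv α w ∈ halfStrip ∧ symbol α (muInv α w) = w := by
  have h : ∃ z ∈ halfStrip, symbol α z = w := by
    obtain ⟨z, hz, rfl⟩ := sigmaInterior_subset_symbol_image hα0 hαπ hw
    rcases lt_trichotomy z.im 0 with h | h | h
    · exact ⟨z, ⟨hz, h⟩, rfl⟩
    · exact absurd (symbol_im_of_im_eq_zero α h) hw'
    · exact ⟨-z, ⟨by rw [Complex.neg_re, abs_neg]; exact hz, by simpa⟩, symbol_neg α z⟩
  exact ⟨Function.invFunOn_mem h, Function.invFunOn_eq h⟩

lemma eq_or_eq_neg_muInv {α : ℝ} (hα0 : 0 < α) (hαπ : α < Real.pi) {w : ℂ}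
    (hw : w ∈ sigmaInterior 1 α) (hw' : w.im ≠ 0) {z : ℂ} (hz : |z.re| ≤ 1 / 2)
    (hzw : symbol α z = w) : z = muInv α w ∨ z = -muInv α w := by
  obtain ⟨hm, hs⟩ := muInv_spec hα0 hαπ hw hw'
  have hz' : |z.re| < 1 / 2 := by
    refine lt_of_le_of_ne hz fun h => hw.1 ?_
    rw [← hzw]
    exact symbol_mem_sigmaCurve h
  rcases lt_trichotomy z.im 0 with h | h | h
  · exact Or.inl (injOn_symbol hα0 hαπ ⟨hz', h⟩ hm (hzw.trans hs.symm))
  · rw [← hzw] at hw'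
    exact absurd (symbol_im_of_im_eq_zero α h) hw'
  · right
    rw [← neg_eq_iff_eq_neg]
    exact injOn_symbol hα0 hαπ ⟨by simpa using hz', by simpa⟩ hm
      (((symbol_neg α z).trans hzw).trans hs.symm)

/-- On the half-strip Im σ(z) and Re z have opposite signs. Consequently the exponent in the
singular term of the theorem has positive real part. -/
lemma sign_mul_muInv_re_neg {α : ℝ} (hα0 : 0 < α) (hαπ : α < Real.pi) {w : ℂ}
    (hw : w ∈ sigmaInterior 1 α) (hw' : w.im ≠ 0) :
    Real.sign w.im * (muInv α w).re < 0 := by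
  obtain ⟨hm, hs⟩ := muInv_spec hα0 hαπ hw hw'
  have h1 := abs_lt.1 hm.1
  rcases lt_trichotomy (muInv α w).re 0 with h | h | h
  · have := symbol_im_pos hα0 hαπ h h1.1 hm.2
    rw [hs] at this
    rw [Real.sign_of_pos this]
    linarith
  · have := (symbol_pos_of_re_eq_zero hαπ h hm.2.ne).2
    rw [hs] at this
    exact absurd this hw'
  · have := symbol_im_neg hα0 hαπ h h1.2 hm.2
    rw [hs] at this
    rw [Real.sign_of_neg this]
    linarith

/-! ### Shifting lines of integration -/

lemma integrable_of_norm_le_inv_one_add_sq {h : ℝ → ℂ} (hc : Continuous h) {C : ℝ}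
    (hb : ∀ y, ‖h y‖ ≤ C / (1 + y ^ 2)) : Integrable h := by
  refine Integrable.mono' ((integrable_inv_one_add_sq).const_mul C) hc.aestronglyMeasurable ?_
  exact Eventually.of_forall fun y => by simpa [div_eq_mul_inv] using hb y

lemma continuous_vertical {g : ℂ → ℂ} {a b : ℝ} (hg : ContinuousOn g {z | z.re ∈ Icc a b})
    {σ : ℝ} (hσ : σ ∈ Icc a b) : Continuous fun y : ℝ => g (σ + y * Complex.I) := by
  refine hg.comp_continuous (by fun_prop) fun y => ?_
  simpa using hσ

/-- Cauchy's theorem on the rectangles of height 2T: the horizontal sides are O(T⁻²), and the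
vertical ones converge by integrability. -/
lemma integral_vertical_eq {g : ℂ → ℂ} {a b : ℝ} (hab : a ≤ b)
    (hg : DifferentiableOn ℂ g {z | z.re ∈ Icc a b}) {C : ℝ}
    (hb : ∀ z : ℂ, z.re ∈ Icc a b → ‖g z‖ ≤ C / (1 + z.im ^ 2)) :
    ∫ y : ℝ, g (a + y * Complex.I) = ∫ y : ℝ, g (b + y * Complex.I) := by
  have hint : ∀ σ ∈ Icc a b, Integrable fun y : ℝ => g (σ + y * Complex.I) := fun σ hσ =>
    integrable_of_norm_le_inv_one_add_sq (continuous_vertical hg.continuousOn hσ) (C := C)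
      fun y => by simpa using hb (σ + y * Complex.I) (by simpa using hσ)
  have hlim : ∀ σ ∈ Icc a b, Tendsto (fun T : ℝ => ∫ y in (-T)..T, g (σ + y * Complex.I)) atTop
      (𝓝 (∫ y : ℝ, g (σ + y * Complex.I))) := fun σ hσ =>
    intervalIntegral_tendsto_integral (hint σ hσ) tendsto_neg_atTop_atBot tendsto_id
  have hrect : ∀ T : ℝ, (∫ x : ℝ in a..b, g (x + (-T : ℝ) * Complex.I)) -
      (∫ x : ℝ in a..b, g (x + T * Complex.I)) +
      Complex.I • (∫ y : ℝ in (-T)..T, g (b + y * Complex.I)) -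
      Complex.I • (∫ y : ℝ in (-T)..T, g (a + y * Complex.I)) = 0 := by
    intro T
    refine Complex.integral_boundary_rect_eq_zero_of_differentiableOn g ⟨a, -T⟩ ⟨b, T⟩
      (hg.mono ?_)
    intro z hz
    have := hz.1
    simpa [uIcc_of_le hab] using this
  have hC : Tendsto (fun T : ℝ => C / (1 + T ^ 2) * |b - a|) atTop (𝓝 0) := by
    rw [← zero_mul |b - a|]
    refine Tendsto.mul_const _ (Tendsto.div_atTop tendsto_const_nhds ?_)
    exact tendsto_atTop_add_const_left _ _ (tendsto_pow_atTop two_ne_zero)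
  have hh : ∀ s : ℝ → ℝ, (∀ T, s T ^ 2 = T ^ 2) →
      Tendsto (fun T : ℝ => ∫ x : ℝ in a..b, g (x + (s T : ℝ) * Complex.I)) atTop (𝓝 0) := by
    intro s hs
    refine squeeze_zero_norm (fun T => ?_) hC
    refine intervalIntegral.norm_integral_le_of_norm_le_const fun x hx => ?_
    rw [uIoc_of_le hab] at hx
    have := hb (x + (s T : ℝ) * Complex.I) (by simpa using ⟨hx.1.le, hx.2⟩)
    simpa [hs] using this
  have h1 := hh (fun T => -T) (fun T => by simp)
  have h2 := hh (fun T => T) (fun T => rfl)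
  have h3 := ((h1.sub h2).add ((hlim b (right_mem_Icc.2 hab)).const_smul Complex.I)).sub
    ((hlim a (left_mem_Icc.2 hab)).const_smul Complex.I)
  have h4 := tendsto_nhds_unique (tendsto_const_nhds.congr fun T => (hrect T).symm) h3
  have h5 : Complex.I * ((∫ y : ℝ, g (b + y * Complex.I)) - ∫ y : ℝ, g (a + y * Complex.I)) = 0 := by
    rw [mul_sub]
    simpa using h4.symm
  have h6 := (mul_eq_zero.1 h5).resolve_left Complex.I_ne_zero
  exact (sub_eq_zero.1 h6).symm

lemma integral_horizontal_eq {g : ℂ → ℂ} {a b : ℝ} (hab : a ≤ b)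
    (hg : DifferentiableOn ℂ g {z | z.im ∈ Icc a b}) {C : ℝ}
    (hb : ∀ z : ℂ, z.im ∈ Icc a b → ‖g z‖ ≤ C / (1 + z.re ^ 2)) :
    ∫ x : ℝ, g (x + a * Complex.I) = ∫ x : ℝ, g (x + b * Complex.I) := by
  have h := integral_vertical_eq (g := fun w => g (Complex.I * w)) hab
    (hg.comp (by fun_prop) fun z hz => by simpa using hz) (C := C)
    (fun z hz => by simpa using hb (Complex.I * z) (by simpa using hz))
  have key : ∀ c : ℝ, ∫ y : ℝ, g (Complex.I * (c + y * Complex.I)) =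
      ∫ x : ℝ, g (x + c * Complex.I) := fun c => by
    rw [← integral_neg_eq_self (fun x : ℝ => g (x + c * Complex.I))]
    congr 1
    ext y
    congr 1
    push_cast
    linear_combination (y : ℂ) * Complex.I_mul_I
  rw [key, key] at h
  exact h

/-- From e^u ≥ 1 + u²/2 for u ≥ 0. Exponential decay is put in the form C/(1 + x²) required by the
contour shifts. -/
lemma exp_neg_mul_abs_le {δ : ℝ} (hδ : 0 < δ) (x : ℝ) :
    Real.exp (-(δ * |x|)) ≤ (1 + 2 / δ ^ 2) / (1 + x ^ 2) := by
  have h := Real.quadratic_le_exp_of_nonneg (x := δ * |x|) (by positivity)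
  rw [Real.exp_neg, ← one_div, div_le_div_iff₀ (Real.exp_pos _) (by positivity), one_mul]
  have h2 : 1 + (δ * |x|) ^ 2 / 2 ≤ Real.exp (δ * |x|) := by nlinarith [abs_nonneg x]
  refine le_trans ?_ (mul_le_mul_of_nonneg_left h2 (by positivity))
  rw [mul_pow, sq_abs]
  have : (1 + 2 / δ ^ 2) * (1 + δ ^ 2 * x ^ 2 / 2) = 1 + x ^ 2 + 2 / δ ^ 2 + δ ^ 2 * x ^ 2 / 2 := by
    field_simp
    ring
  rw [this]
  have : 0 ≤ 2 / δ ^ 2 + δ ^ 2 * x ^ 2 / 2 := by positivity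
  linarith

lemma exp_div_one_add_exp_le {σ δ : ℝ} (h1 : δ ≤ σ) (h2 : δ ≤ 1 - σ) (x : ℝ) :
    Real.exp (σ * x) / (1 + Real.exp x) ≤ Real.exp (-(δ * |x|)) := by
  rw [div_le_iff₀ (by positivity)]
  rcases le_total 0 x with hx | hx
  · rw [abs_of_nonneg hx]
    calc Real.exp (σ * x) ≤ Real.exp (-(δ * x)) * Real.exp x := by
          rw [← Real.exp_add]
          apply Real.exp_le_exp.2
          nlinarith
      _ ≤ _ := by
          have := Real.exp_pos (-(δ * x))
          nlinarith
  · rw [abs_of_nonpos hx]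
    calc Real.exp (σ * x) ≤ Real.exp (-(δ * -x)) * 1 := by
          rw [mul_one]
          apply Real.exp_le_exp.2
          nlinarith
      _ ≤ _ := by
          have := Real.exp_pos x
          have := Real.exp_pos (-(δ * -x))
          nlinarith

/-! ### The Mellin transform of the kernel -/

/-- Substituting the sigmoid gives the Beta integral B(z, 1 - z), which the reflection formula for Γ
evaluates. -/
lemma integral_exp_div_one_add_exp {z : ℂ} (h0 : 0 < z.re) (h1 : z.re < 1) :
    ∫ x : ℝ, Complex.exp (z * x) / (1 + Complex.exp x) =
      Real.pi / Complex.sin (Real.pi * z) := by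
  have hb : Complex.betaIntegral z (1 - z) = Real.pi / Complex.sin (Real.pi * z) := by
    rw [Complex.betaIntegral_eq_Gamma_mul_div _ _ h0 (by simpa using h1),
      Complex.Gamma_mul_Gamma_one_sub]
    simp
  rw [← hb, Complex.betaIntegral, intervalIntegral.integral_of_le zero_le_one,
    integral_Ioc_eq_integral_Ioo, ← Real.range_sigmoid, ← image_univ,
    integral_image_eq_integral_abs_deriv_smul MeasurableSet.univ
      (fun x _ => (Real.hasDerivAt_sigmoid x).hasDerivWithinAt) Real.sigmoid_injective.injOn]
  rw [setIntegral_univ]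
  congr 1
  ext x
  have hs := Real.sigmoid_pos x
  have hs' : 0 < 1 - Real.sigmoid x := sub_pos.2 (Real.sigmoid_lt_one x)
  have hE := Real.exp_pos x
  have e1 : Real.sigmoid x = Real.exp x / (1 + Real.exp x) := by
    rw [Real.sigmoid_def, Real.exp_neg]
    field_simp
    ring
  have e2 : 1 - Real.sigmoid x = (1 + Real.exp x)⁻¹ := by
    rw [e1]; field_simp; ring
  rw [abs_of_pos (mul_pos hs hs'), Complex.real_smul]
  have hne : (Real.sigmoid x : ℂ) ≠ 0 := by exact_mod_cast hs.ne'
  have hne' : (1 - Real.sigmoid x : ℂ) ≠ 0 := by exact_mod_cast hs'.ne'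
  have hlog : Complex.log (Real.sigmoid x) = x - Real.log (1 + Real.exp x) := by
    rw [← Complex.ofReal_log hs.le, e1, Real.log_div hE.ne' (by positivity), Real.log_exp]
    push_cast
    rfl
  have hlog' : Complex.log (1 - Real.sigmoid x) = -Real.log (1 + Real.exp x) := by
    rw [← Complex.ofReal_one, ← Complex.ofReal_sub, ← Complex.ofReal_log hs'.le, e2, Real.log_inv]
    push_cast
    rfl
  have e4 : ((Real.sigmoid x * (1 - Real.sigmoid x) : ℝ) : ℂ) *
      ((Real.sigmoid x : ℂ) ^ (z - 1) * (1 - (Real.sigmoid x : ℂ)) ^ (1 - z - 1)) =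
      (Real.sigmoid x : ℂ) ^ z * (1 - (Real.sigmoid x : ℂ)) ^ (1 - z) := by
    rw [Complex.cpow_sub _ _ hne, Complex.cpow_sub _ _ hne', Complex.cpow_one, Complex.cpow_one]
    push_cast
    field_simp
  rw [e4, Complex.cpow_def_of_ne_zero hne, Complex.cpow_def_of_ne_zero hne', ← Complex.exp_add,
    hlog, hlog']
  have e5 : (1 + Complex.exp x) = Complex.exp (Real.log (1 + Real.exp x)) := by
    rw [← Complex.ofReal_exp (Real.log _), Real.exp_log (by positivity)]
    push_cast
    rfl
  rw [e5, ← Complex.exp_sub]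
  congr 1
  ring

/-- With E = e^(Re w), |e^w - 1|² is at least E² - 2E cos α + 1, and this exceeds (1 - cos α)/2 · (1
+ E)² by (1 + cos α)/2 · (E - 1)². -/
lemma norm_exp_sub_one_ge {α : ℝ} {w : ℂ} (hw : Real.cos w.im ≤ Real.cos α) :
    √((1 - Real.cos α) / 2) * (1 + Real.exp w.re) ≤ ‖Complex.exp w - 1‖ := by
  have h0 : 0 ≤ (1 - Real.cos α) / 2 := by linarith [Real.cos_le_one α]
  refine abs_le_of_sq_le_sq' ?_ (norm_nonneg _) |>.2
  rw [mul_pow, Real.sq_sqrt h0, Complex.sq_norm, Complex.normSq_apply]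
  simp only [Complex.sub_re, Complex.sub_im, Complex.exp_re, Complex.exp_im, Complex.one_re,
    Complex.one_im]
  have h1 := Real.sin_sq_add_cos_sq w.im
  have h2 := Real.neg_one_le_cos α
  have hE := Real.exp_pos w.re
  have e : (Real.exp w.re * Real.cos w.im - 1) * (Real.exp w.re * Real.cos w.im - 1) +
      (Real.exp w.re * Real.sin w.im - 0) * (Real.exp w.re * Real.sin w.im - 0) =
      Real.exp w.re ^ 2 - 2 * Real.exp w.re * Real.cos w.im + 1 := by
    linear_combination Real.exp w.re ^ 2 * h1
  rw [e]
  nlinarith [mul_nonneg (by linarith : 0 ≤ (1 + Real.cos α) / 2) (sq_nonneg (Real.exp w.re - 1))]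

lemma cos_le_cos_of_mem {α θ : ℝ} (hα0 : 0 < α)
    (hθ : θ ∈ Icc α (2 * Real.pi - α)) : Real.cos θ ≤ Real.cos α := by
  rcases le_total θ Real.pi with h | h
  · exact Real.cos_le_cos_of_nonneg_of_le_pi hα0.le h hθ.1
  · rw [← Real.cos_two_pi_sub θ]
    exact Real.cos_le_cos_of_nonneg_of_le_pi hα0.le (by linarith) (by linarith [hθ.2])

/-- The integrand e^(zw)/(e^w - 1) has its poles at multiples of 2πi, so its line of integration can
be moved from height θ to height π, where e^w = -e^x and the preceding integral applies. -/
lemma integral_exp_div_exp_sub_one {α : ℝ} (hα0 : 0 < α) (hαπ : α < Real.pi) {z : ℂ}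
    (h0 : 0 < z.re) (h1 : z.re < 1) {θ : ℝ} (hθ : θ ∈ Icc α (2 * Real.pi - α)) :
    Integrable (fun x : ℝ => Complex.exp (z * x) / (Complex.exp (x + θ * Complex.I) - 1)) ∧
    ∫ x : ℝ, Complex.exp (z * x) / (Complex.exp (x + θ * Complex.I) - 1) =
      -Complex.exp (z * ((Real.pi - θ : ℝ) * Complex.I)) *
        (Real.pi / Complex.sin (Real.pi * z)) := by
  set g : ℂ → ℂ := fun w => Complex.exp (z * w) / (Complex.exp w - 1) with hg
  have hc : 0 < √((1 - Real.cos α) / 2) := by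
    apply Real.sqrt_pos.2
    have : Real.cos α < 1 := by
      rw [← Real.cos_zero]
      exact Real.cos_lt_cos_of_nonneg_of_le_pi le_rfl hαπ.le hα0
    linarith
  set c := √((1 - Real.cos α) / 2) with hcdef
  have hne : ∀ w : ℂ, w.im ∈ Icc α (2 * Real.pi - α) → Complex.exp w - 1 ≠ 0 := fun w hw => by
    have := norm_exp_sub_one_ge (cos_le_cos_of_mem hα0 hw)
    rw [← norm_pos_iff]
    exact lt_of_lt_of_le (by positivity) this
  have hdiff : DifferentiableOn ℂ g {w | w.im ∈ Icc α (2 * Real.pi - α)} := by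
    refine DifferentiableOn.div (by fun_prop) (by fun_prop) hne
  -- The decay rate of e^(x Re z)/(1 + e^x) at both ends.
  set δ := min z.re (1 - z.re) with hδ
  have hδ0 : 0 < δ := lt_min h0 (by linarith)
  have hbound : ∀ w : ℂ, w.im ∈ Icc α (2 * Real.pi - α) →
      ‖g w‖ ≤ (Real.exp (2 * Real.pi * |z.im|) / c * (1 + 2 / δ ^ 2)) / (1 + w.re ^ 2) := by
    intro w hw
    rw [hg]
    simp only [norm_div, Complex.norm_exp]
    have hb := norm_exp_sub_one_ge (cos_le_cos_of_mem hα0 hw)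
    have hre : (z * w).re ≤ z.re * w.re + 2 * Real.pi * |z.im| := by
      rw [Complex.mul_re]
      have : -(z.im * w.im) ≤ |z.im| * (2 * Real.pi) := by
        calc -(z.im * w.im) ≤ |z.im * w.im| := neg_le_abs _
          _ = |z.im| * |w.im| := abs_mul _ _
          _ ≤ _ := by
            apply mul_le_mul_of_nonneg_left _ (abs_nonneg _)
            rw [abs_of_pos (lt_of_lt_of_le hα0 hw.1)]
            linarith [hw.2]
      linarith
    calc Real.exp (z * w).re / ‖Complex.exp w - 1‖
        ≤ Real.exp (z.re * w.re + 2 * Real.pi * |z.im|) / (c * (1 + Real.exp w.re)) :=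
          div_le_div₀ (Real.exp_pos _).le (Real.exp_le_exp.2 hre) (by positivity) hb
      _ = Real.exp (2 * Real.pi * |z.im|) / c * (Real.exp (z.re * w.re) / (1 + Real.exp w.re)) := by
          rw [Real.exp_add]; field_simp
      _ ≤ Real.exp (2 * Real.pi * |z.im|) / c * ((1 + 2 / δ ^ 2) / (1 + w.re ^ 2)) := by
          refine mul_le_mul_of_nonneg_left ?_ (by positivity)
          exact (exp_div_one_add_exp_le (min_le_left _ _) (min_le_right _ _) _).trans
            (exp_neg_mul_abs_le hδ0 _)
      _ = _ := by ring
  have hπ : Real.pi ∈ Icc α (2 * Real.pi - α) := ⟨hαπ.le, by linarith⟩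
  have hshift : ∫ x : ℝ, g (x + θ * Complex.I) = ∫ x : ℝ, g (x + Real.pi * Complex.I) := by
    rcases le_total θ Real.pi with h | h
    · exact integral_horizontal_eq h (hdiff.mono fun w hw => ⟨hθ.1.trans hw.1, hw.2.trans hπ.2⟩)
        fun w hw => hbound w ⟨hθ.1.trans hw.1, hw.2.trans hπ.2⟩
    · exact (integral_horizontal_eq h
        (hdiff.mono fun w hw => ⟨hπ.1.trans hw.1, hw.2.trans hθ.2⟩)
        fun w hw => hbound w ⟨hπ.1.trans hw.1, hw.2.trans hθ.2⟩).symm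
  have hgθ : ∀ x : ℝ, Complex.exp (z * x) / (Complex.exp (x + θ * Complex.I) - 1) =
      Complex.exp (-(z * (θ * Complex.I))) * g (x + θ * Complex.I) := fun x => by
    rw [hg]
    simp only
    rw [← mul_div_assoc, ← Complex.exp_add]
    congr 2
    ring
  have hgπ : ∀ x : ℝ, g (x + Real.pi * Complex.I) = -Complex.exp (z * (Real.pi * Complex.I)) *
      (Complex.exp (z * x) / (1 + Complex.exp x)) := fun x => by
    rw [hg]
    simp only
    have h4 : (1 + Complex.exp x) ≠ 0 := by
      rw [← Complex.ofReal_exp]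
      have : 1 + Real.exp x ≠ 0 := by positivity
      exact_mod_cast this
    have h5 : -Complex.exp x - 1 ≠ 0 := by
      intro h
      apply h4
      linear_combination -h
    rw [Complex.exp_add, Complex.exp_pi_mul_I, mul_add, Complex.exp_add, mul_neg_one]
    field_simp
    ring
  constructor
  · simp_rw [hgθ]
    refine Integrable.const_mul ?_ _
    have hcont : Continuous fun x : ℝ => g (x + θ * Complex.I) :=
      hdiff.continuousOn.comp_continuous (by fun_prop) fun x => by simpa using hθ
    refine integrable_of_norm_le_inv_one_add_sq hcont
      (C := Real.exp (2 * Real.pi * |z.im|) / c * (1 + 2 / δ ^ 2)) fun x => ?_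
    exact le_of_le_of_eq (hbound (x + θ * Complex.I) (by simpa using hθ)) (by simp)
  · simp_rw [hgθ]
    rw [integral_const_mul, hshift]
    simp_rw [hgπ]
    rw [integral_const_mul, integral_exp_div_one_add_exp h0 h1, ← mul_assoc, mul_neg,
      ← Complex.exp_add]
    congr 3
    push_cast
    ring

/-- The kernel on the section `s = 1`. -/
noncomputable def kap (α τ : ℝ) : ℝ :=
  Real.sin α / Real.pi / (τ ^ 2 - 2 * τ * Real.cos α + 1)

lemma quad_pos {α : ℝ} (hα0 : 0 < α) (hαπ : α < Real.pi) (τ : ℝ) :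
    0 < τ ^ 2 - 2 * τ * Real.cos α + 1 := by
  have hs := Real.sin_pos_of_pos_of_lt_pi hα0 hαπ
  nlinarith [Real.sin_sq_add_cos_sq α, sq_nonneg (τ - Real.cos α)]

lemma kernel_eq_kap {α : ℝ} (hα0 : 0 < α) (hαπ : α < Real.pi) {s : ℝ} (hs : 0 < s) (t : ℝ) :
    kernel α s t = s⁻¹ * kap α (t / s) := by
  have hq := quad_pos hα0 hαπ (t / s)
  have hE : Complex.exp (Complex.I * α) = Real.cos α + Real.sin α * Complex.I := by
    rw [mul_comm, Complex.exp_mul_I, Complex.ofReal_cos, Complex.ofReal_sin]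
  have h1 := Real.sin_sq_add_cos_sq α
  rw [kernel, kap, hE, Complex.div_im, Complex.normSq_apply]
  simp only [Complex.add_im, Complex.ofReal_im, Complex.mul_im, Complex.ofReal_re, Complex.I_im,
    Complex.I_re, Complex.sub_re, Complex.mul_re, Complex.add_re, Complex.sub_im, mul_one, mul_zero,
    zero_mul, sub_zero, add_zero, zero_add]
  have e : (t * Real.cos α - s) * (t * Real.cos α - s) +
      t * Real.sin α * (t * Real.sin α) = s ^ 2 * ((t / s) ^ 2 - 2 * (t / s) * Real.cos α + 1) := by
    field_simp
    linear_combination t ^ 2 * h1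
  rw [e]
  have := Real.pi_pos
  generalize hQ : (t / s) ^ 2 - 2 * (t / s) * Real.cos α + 1 = Q at *
  field_simp
  ring

lemma kap_exp_mul_exp {α : ℝ} (hα0 : 0 < α) (hαπ : α < Real.pi) (u : ℝ) :
    kap α (Real.exp u) * Real.exp u =
      Real.sin α / (2 * Real.pi) / (Real.cosh u - Real.cos α) := by
  have hq := quad_pos hα0 hαπ (Real.exp u)
  have hE := Real.exp_pos u
  have h : Real.cosh u - Real.cos α =
      (Real.exp u ^ 2 - 2 * Real.exp u * Real.cos α + 1) / (2 * Real.exp u) := by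
    rw [Real.cosh_eq, Real.exp_neg]
    field_simp
    ring
  rw [h, kap]
  have := Real.pi_pos
  generalize Real.exp u ^ 2 - 2 * Real.exp u * Real.cos α + 1 = Q at *
  field_simp

lemma kap_nonneg {α : ℝ} (hα0 : 0 < α) (hαπ : α < Real.pi) (τ : ℝ) : 0 ≤ kap α τ := by
  have hs := Real.sin_pos_of_pos_of_lt_pi hα0 hαπ
  have := quad_pos hα0 hαπ τ
  have := Real.pi_pos
  rw [kap]
  positivity

lemma continuous_kap {α : ℝ} (hα0 : 0 < α) (hαπ : α < Real.pi) : Continuous (kap α) := by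
  unfold kap
  exact Continuous.div (by fun_prop) (by fun_prop) fun τ => (quad_pos hα0 hαπ τ).ne'

lemma exists_kap_exp_le {α : ℝ} (hα0 : 0 < α) (hαπ : α < Real.pi) :
    ∃ C, 0 < C ∧ ∀ u, kap α (Real.exp u) * Real.exp u ≤ C * Real.exp (-|u|) := by
  have hcos : Real.cos α < 1 := by
    rw [← Real.cos_zero]
    exact Real.cos_lt_cos_of_nonneg_of_le_pi le_rfl hαπ.le hα0
  have hs := Real.sin_pos_of_pos_of_lt_pi hα0 hαπ
  have hpi := Real.pi_pos
  have hd : 0 < (1 - Real.cos α) / 2 := by linarith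
  refine ⟨Real.sin α / (2 * Real.pi) / ((1 - Real.cos α) / 2 / 2), by positivity, fun u => ?_⟩
  rw [kap_exp_mul_exp hα0 hαπ]
  have h1 : (1 - Real.cos α) / 2 * Real.cosh u ≤ Real.cosh u - Real.cos α := by
    have := Real.one_le_cosh u
    have := Real.neg_one_le_cos α
    nlinarith
  have h2 : Real.exp |u| / 2 ≤ Real.cosh u := by
    rw [← Real.cosh_abs, Real.cosh_eq]
    have := Real.exp_pos (-|u|)
    linarith
  calc Real.sin α / (2 * Real.pi) / (Real.cosh u - Real.cos α)
      ≤ Real.sin α / (2 * Real.pi) / ((1 - Real.cos α) / 2 * (Real.exp |u| / 2)) := by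
        refine div_le_div_of_nonneg_left (by positivity) (by positivity) ?_
        exact (mul_le_mul_of_nonneg_left h2 hd.le).trans h1
    _ = _ := by
        rw [Real.exp_neg]
        field_simp

lemma exp_image_univ : Real.exp '' univ = Ioi 0 := by rw [image_univ, Real.range_exp]

lemma integral_Ioi_eq_integral_exp (f : ℝ → ℂ) :
    ∫ τ in Ioi (0 : ℝ), f τ = ∫ u : ℝ, (Real.exp u : ℂ) * f (Real.exp u) := by
  rw [← exp_image_univ, integral_image_eq_integral_abs_deriv_smul MeasurableSet.univ
    (fun x _ => (Real.hasDerivAt_exp x).hasDerivWithinAt) Real.exp_injective.injOn, setIntegral_univ]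
  simp

lemma integrableOn_Ioi_iff_exp (f : ℝ → ℂ) :
    IntegrableOn f (Ioi 0) ↔ Integrable fun u : ℝ => (Real.exp u : ℂ) * f (Real.exp u) := by
  rw [← exp_image_univ, integrableOn_image_iff_integrableOn_abs_deriv_smul MeasurableSet.univ
    (fun x _ => (Real.hasDerivAt_exp x).hasDerivWithinAt) Real.exp_injective.injOn,
    integrableOn_univ]
  simp

lemma exp_ofReal_cpow (u : ℝ) (p : ℂ) : ((Real.exp u : ℝ) : ℂ) ^ p = Complex.exp (p * u) := by
  rw [Complex.cpow_def_of_ne_zero (by exact_mod_cast (Real.exp_pos u).ne'),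
    ← Complex.ofReal_log (Real.exp_pos u).le, Real.log_exp, mul_comm]

lemma integrable_exp_neg_mul_abs {δ : ℝ} (hδ : 0 < δ) :
    Integrable fun x : ℝ => Real.exp (-(δ * |x|)) := by
  refine Integrable.mono' ((integrable_inv_one_add_sq).const_mul (1 + 2 / δ ^ 2))
    (by fun_prop) ?_
  exact Eventually.of_forall fun y => by
    rw [Real.norm_of_nonneg (Real.exp_pos _).le, ← div_eq_mul_inv]
    exact exp_neg_mul_abs_le hδ y

lemma norm_exp_mul_kap_le {α C : ℝ} (hα0 : 0 < α) (hαπ : α < Real.pi)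
    (hC : ∀ u, kap α (Real.exp u) * Real.exp u ≤ C * Real.exp (-|u|)) {p : ℂ} {r : ℝ}
    (hp : |p.re| ≤ r) (u : ℝ) :
    ‖Complex.exp (p * u) * ((kap α (Real.exp u) * Real.exp u : ℝ) : ℂ)‖ ≤
      C * Real.exp (-((1 - r) * |u|)) := by
  have h0 : 0 ≤ kap α (Real.exp u) * Real.exp u :=
    mul_nonneg (kap_nonneg hα0 hαπ _) (Real.exp_pos _).le
  rw [norm_mul, Complex.norm_exp, Complex.norm_real, Real.norm_of_nonneg h0]
  have h1 : Real.exp (p * u).re ≤ Real.exp (r * |u|) := by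
    apply Real.exp_le_exp.2
    rw [Complex.re_mul_ofReal]
    calc p.re * u ≤ |p.re * u| := le_abs_self _
      _ = |p.re| * |u| := abs_mul _ _
      _ ≤ _ := mul_le_mul_of_nonneg_right hp (abs_nonneg _)
  calc _ ≤ Real.exp (r * |u|) * (C * Real.exp (-|u|)) :=
        mul_le_mul h1 (hC u) h0 (Real.exp_pos _).le
    _ = _ := by
        rw [mul_left_comm, ← Real.exp_add]
        congr 2
        ring

lemma continuous_exp_mul_kap {α : ℝ} (hα0 : 0 < α) (hαπ : α < Real.pi) (p : ℂ) :
    Continuous fun u : ℝ => Complex.exp (p * u) * ((kap α (Real.exp u) * Real.exp u : ℝ) : ℂ) := by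
  have := continuous_kap hα0 hαπ
  fun_prop

lemma integrable_exp_mul_kap {α : ℝ} (hα0 : 0 < α) (hαπ : α < Real.pi) {p : ℂ} (hp : p ∈ strip 1) :
    Integrable fun u : ℝ => Complex.exp (p * u) * ((kap α (Real.exp u) * Real.exp u : ℝ) : ℂ) := by
  obtain ⟨C, hC0, hC⟩ := exists_kap_exp_le hα0 hαπ
  have hp' : |p.re| < 1 := hp
  refine Integrable.mono' ((integrable_exp_neg_mul_abs (δ := 1 - |p.re|) (by linarith)).const_mul C)
    (continuous_exp_mul_kap hα0 hαπ p).aestronglyMeasurable ?_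
  exact Eventually.of_forall fun u => norm_exp_mul_kap_le hα0 hαπ hC le_rfl u

/-- Partial fractions: the quadratic denominator of the kernel splits into e^u e^(iα) - 1 and e^u
e^(-iα) - 1, and each term is the integral above, at the heights α and 2π - α. The two exponentials
combine to sin((π - α)p). -/
lemma integral_exp_mul_kap_of_pos {α : ℝ} (hα0 : 0 < α) (hαπ : α < Real.pi) {p : ℂ}
    (h0 : 0 < p.re) (h1 : p.re < 1) :
    ∫ u : ℝ, Complex.exp (p * u) * ((kap α (Real.exp u) * Real.exp u : ℝ) : ℂ) = symbol α p := by
  obtain ⟨i1, v1⟩ := integral_exp_div_exp_sub_one hα0 hαπ h0 h1 (θ := α) ⟨le_rfl, by linarith⟩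
  obtain ⟨i2, v2⟩ := integral_exp_div_exp_sub_one hα0 hαπ h0 h1 (θ := 2 * Real.pi - α)
    ⟨by linarith, le_rfl⟩
  have hp0 : p ≠ 0 := by rintro rfl; simp at h0
  have hpt : ∀ u : ℝ, Complex.exp (p * u) * ((kap α (Real.exp u) * Real.exp u : ℝ) : ℂ) =
      (2 * Real.pi * Complex.I)⁻¹ *
      (Complex.exp (p * u) / (Complex.exp (u + (2 * Real.pi - α : ℝ) * Complex.I) - 1) -
        Complex.exp (p * u) / (Complex.exp (u + α * Complex.I) - 1)) := by
    intro u
    have hpi : (Real.pi : ℂ) ≠ 0 := by exact_mod_cast Real.pi_ne_zero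
    have e1 : Complex.exp (u + α * Complex.I) =
        Real.exp u * (Real.cos α + Real.sin α * Complex.I) := by
      rw [Complex.exp_add, Complex.exp_mul_I, Complex.ofReal_exp, Complex.ofReal_cos,
        Complex.ofReal_sin]
    have e2 : Complex.exp (u + (2 * Real.pi - α : ℝ) * Complex.I) =
        Real.exp u * (Real.cos α - Real.sin α * Complex.I) := by
      rw [Complex.exp_add, Complex.exp_mul_I, Complex.ofReal_exp, ← Complex.ofReal_cos,
        ← Complex.ofReal_sin, Real.cos_two_pi_sub, Real.sin_two_pi_sub]
      push_cast
      ring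
    have hq := quad_pos hα0 hαπ (Real.exp u)
    have hn : ∀ c : ℝ, c ^ 2 = Real.sin α ^ 2 →
        ((Real.exp u : ℂ) * (Real.cos α + c * Complex.I) - 1) *
        ((Real.exp u : ℂ) * (Real.cos α - c * Complex.I) - 1) =
        ((Real.exp u ^ 2 - 2 * Real.exp u * Real.cos α + 1 : ℝ) : ℂ) := by
      intro c hc
      have hc' : (c : ℂ) ^ 2 + (Real.cos α : ℂ) ^ 2 = 1 := by
        exact_mod_cast hc ▸ Real.sin_sq_add_cos_sq α
      push_cast
      push_cast at hc'
      linear_combination (Complex.exp u ^ 2) * hc' - (Complex.exp u ^ 2 * c ^ 2) * Complex.I_sq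
    have h4 := hn (Real.sin α) rfl
    rw [e1, e2, kap]
    have hq' : ((Real.exp u ^ 2 - 2 * Real.exp u * Real.cos α + 1 : ℝ) : ℂ) ≠ 0 := by
      exact_mod_cast hq.ne'
    have hA : (Real.exp u : ℂ) * (Real.cos α + Real.sin α * Complex.I) - 1 ≠ 0 := by
      intro h; rw [h, zero_mul] at h4; exact hq' h4.symm
    have hB : (Real.exp u : ℂ) * (Real.cos α - Real.sin α * Complex.I) - 1 ≠ 0 := by
      intro h; rw [h, mul_zero] at h4; exact hq' h4.symm
    rw [div_sub_div _ _ hB hA, mul_comm (_ - 1) (_ - 1), h4, Complex.ofReal_mul, Complex.ofReal_div]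
    push_cast at hq' ⊢
    have hI := Complex.I_ne_zero
    generalize Complex.exp (u : ℂ) ^ 2 - 2 * Complex.exp (u : ℂ) * Complex.cos α + 1 = Q at *
    field_simp
    ring
  simp_rw [hpt]
  rw [integral_const_mul, integral_sub i2 i1, v1, v2, symbol_of_ne _ hp0]
  have hs : Complex.sin (Real.pi * p) ≠ 0 :=
    sin_mul_ne_zero Real.pi_pos le_rfl (by rw [abs_of_pos h0]; exact h1) hp0
  have hpi : (Real.pi : ℂ) ≠ 0 := by exact_mod_cast Real.pi_ne_zero
  have hI := Complex.I_ne_zero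
  have hsin : Complex.sin ((Real.pi - α : ℝ) * p) =
      (Complex.exp (p * ((Real.pi - α : ℝ) * Complex.I)) -
        Complex.exp (p * ((Real.pi - (2 * Real.pi - α) : ℝ) * Complex.I))) / (2 * Complex.I) := by
    rw [Complex.sin]
    rw [show -((Real.pi - α : ℝ) * p) * Complex.I =
      p * ((Real.pi - (2 * Real.pi - α) : ℝ) * Complex.I) by push_cast; ring,
      show ((Real.pi - α : ℝ) * p) * Complex.I = p * ((Real.pi - α : ℝ) * Complex.I) by ring]
    field_simp
    rw [Complex.I_sq]
    ring
  rw [hsin]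
  generalize Complex.exp (p * ((Real.pi - α : ℝ) * Complex.I)) = A
  generalize Complex.exp (p * ((Real.pi - (2 * Real.pi - α) : ℝ) * Complex.I)) = B
  generalize Complex.sin (Real.pi * p) = S at hs
  field_simp
  ring

/-- In logarithmic coordinates the kernel is even, which gives Re p < 0; the line Re p = 0 is
reached from the right by dominated convergence. -/
lemma integral_exp_mul_kap {α : ℝ} (hα0 : 0 < α) (hαπ : α < Real.pi) {p : ℂ} (hp : p ∈ strip 1) :
    ∫ u : ℝ, Complex.exp (p * u) * ((kap α (Real.exp u) * Real.exp u : ℝ) : ℂ) = symbol α p := by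
  have hp' := abs_lt.1 (show |p.re| < 1 from hp)
  rcases lt_trichotomy p.re 0 with h | h | h
  · rw [← symbol_neg, ← integral_exp_mul_kap_of_pos hα0 hαπ (p := -p) (by simpa) (by simp; linarith),
      ← integral_neg_eq_self]
    congr 1
    ext u
    rw [kap_exp_mul_exp hα0 hαπ, kap_exp_mul_exp hα0 hαπ, Real.cosh_neg]
    push_cast
    rw [neg_mul, mul_neg]
  · obtain ⟨C, hC0, hC⟩ := exists_kap_exp_le hα0 hαπ
    -- The extra factor 1/2 keeps the shifted real parts in (0, 1/2], so that a multiple of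
    -- e^(-|u|/2) dominates all integrands.
    have hε : Tendsto (fun n : ℕ => p + ((1 / ((n : ℝ) + 1) / 2 : ℝ) : ℂ)) atTop (𝓝 p) := by
      have h1 : Tendsto (fun n : ℕ => (1 / ((n : ℝ) + 1) / 2 : ℝ)) atTop (𝓝 0) := by
        simpa using (tendsto_one_div_add_atTop_nhds_zero_nat (𝕜 := ℝ)).div_const 2
      have h2 := (Complex.continuous_ofReal.tendsto 0).comp h1
      simpa using h2.const_add p
    have hre : ∀ n : ℕ, 0 < (p + ((1 / ((n : ℝ) + 1) / 2 : ℝ) : ℂ)).re ∧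
        (p + ((1 / ((n : ℝ) + 1) / 2 : ℝ) : ℂ)).re ≤ 1 / 2 := fun n => by
      rw [Complex.add_re, h, zero_add, Complex.ofReal_re]
      refine ⟨by positivity, ?_⟩
      have : 1 / ((n : ℝ) + 1) ≤ 1 := by
        rw [div_le_one (by positivity)]
        linarith [(Nat.cast_nonneg n : (0 : ℝ) ≤ n)]
      linarith
    have hl := tendsto_integral_of_dominated_convergence (μ := volume)
      (F := fun (n : ℕ) (u : ℝ) => Complex.exp ((p + ((1 / ((n : ℝ) + 1) / 2 : ℝ) : ℂ)) * u) *
        ((kap α (Real.exp u) * Real.exp u : ℝ) : ℂ))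
      (f := fun u : ℝ => Complex.exp (p * u) * ((kap α (Real.exp u) * Real.exp u : ℝ) : ℂ))
      (fun u => C * Real.exp (-((1 - 1 / 2) * |u|)))
      (fun n => (continuous_exp_mul_kap hα0 hαπ _).aestronglyMeasurable)
      ((integrable_exp_neg_mul_abs (by norm_num)).const_mul C)
      (fun n => Eventually.of_forall fun u => norm_exp_mul_kap_le hα0 hαπ hC
        (by rw [abs_of_pos (hre n).1]; exact (hre n).2) u)
      (Eventually.of_forall fun u => by
        refine Tendsto.mul_const _ ?_
        exact (Complex.continuous_exp.tendsto _).comp (hε.mul_const _))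
    have hsy : Tendsto (fun n : ℕ => symbol α (p + ((1 / ((n : ℝ) + 1) / 2 : ℝ) : ℂ))) atTop
        (𝓝 (symbol α p)) :=
      ((differentiableOn_symbol α).continuousOn.continuousAt
        ((isOpen_strip 1).mem_nhds hp)).tendsto.comp hε
    refine tendsto_nhds_unique hl (hsy.congr fun n => ?_)
    exact (integral_exp_mul_kap_of_pos hα0 hαπ (hre n).1 (by linarith [(hre n).2])).symm
  · exact integral_exp_mul_kap_of_pos hα0 hαπ h hp'.2

lemma integral_kap_cpow {α : ℝ} (hα0 : 0 < α) (hαπ : α < Real.pi) {p : ℂ} (hp : p ∈ strip 1) :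
    IntegrableOn (fun τ : ℝ => (kap α τ : ℂ) * (τ : ℂ) ^ p) (Ioi 0) ∧
    ∫ τ in Ioi (0 : ℝ), (kap α τ : ℂ) * (τ : ℂ) ^ p = symbol α p := by
  have e : ∀ u : ℝ, (Real.exp u : ℂ) * ((kap α (Real.exp u) : ℂ) * ((Real.exp u : ℝ) : ℂ) ^ p) =
      Complex.exp (p * u) * ((kap α (Real.exp u) * Real.exp u : ℝ) : ℂ) := fun u => by
    rw [exp_ofReal_cpow, Complex.ofReal_mul]
    ring
  rw [integrableOn_Ioi_iff_exp, integral_Ioi_eq_integral_exp]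
  simp_rw [e]
  exact ⟨integrable_exp_mul_kap hα0 hαπ hp, integral_exp_mul_kap hα0 hαπ hp⟩

/-! ### The resolvent symbol -/

lemma isCompact_box (r Y : ℝ) : IsCompact {z : ℂ | |z.re| ≤ r ∧ |z.im| ≤ Y} := by
  have : {z : ℂ | |z.re| ≤ r ∧ |z.im| ≤ Y} = Icc (-r) r ×ℂ Icc (-Y) Y := by
    ext z
    simp [Complex.mem_reProdIm, abs_le]
  rw [this]
  exact isCompact_Icc.reProdIm isCompact_Icc

lemma exists_bound_of_decay_on {R : ℂ → ℂ} {A : Set ℂ} {r Y C₀ : ℝ} (hA : IsClosed A)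
    (hAr : ∀ z ∈ A, |z.re| ≤ r) (hR : ContinuousOn R A)
    (hb : ∀ z ∈ A, Y ≤ |z.im| → ‖R z‖ ≤ C₀ / z.im ^ 2) :
    ∃ C, ∀ z ∈ A, ‖R z‖ ≤ C / (1 + z.im ^ 2) := by
  set Z := max Y 1 with hZ
  obtain ⟨M, hM⟩ := ((isCompact_box r Z).inter_left hA).exists_bound_of_continuousOn
    (hR.mono inter_subset_left)
  refine ⟨max (M * (1 + Z ^ 2)) (2 * C₀), fun z hz => ?_⟩
  rw [le_div_iff₀ (by positivity)]
  rcases le_total |z.im| Z with h | h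
  · have h1 := hM z ⟨hz, hAr z hz, h⟩
    have h2 : z.im ^ 2 ≤ Z ^ 2 := by
      rw [← sq_abs z.im]
      exact pow_le_pow_left₀ (abs_nonneg _) h 2
    refine le_trans ?_ (le_max_left _ _)
    exact mul_le_mul h1 (by linarith) (by positivity) ((norm_nonneg _).trans h1)
  · have h1 := hb z hz ((le_max_left _ _).trans h)
    have h2 : 1 ≤ z.im ^ 2 := by
      rw [← sq_abs z.im]
      exact one_le_pow₀ ((le_max_right _ _).trans h)
    rw [le_div_iff₀ (by linarith)] at h1
    refine le_trans ?_ (le_max_right _ _)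
    nlinarith [norm_nonneg (R z)]

lemma exists_bound_of_decay {R : ℂ → ℂ} {r Y C₀ : ℝ}
    (hR : ContinuousOn R {z | |z.re| ≤ r})
    (hb : ∀ z : ℂ, |z.re| ≤ r → Y ≤ |z.im| → ‖R z‖ ≤ C₀ / z.im ^ 2) :
    ∃ C, ∀ z : ℂ, |z.re| ≤ r → ‖R z‖ ≤ C / (1 + z.im ^ 2) :=
  exists_bound_of_decay_on (isClosed_le Complex.continuous_re.abs continuous_const)
    (fun _ hz => hz) hR hb

lemma exists_norm_symbol_le_half {α : ℝ} (hα0 : 0 < α) (hαπ : α < Real.pi) {w : ℂ} (hw : w ≠ 0) :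
    ∃ Y, 1 ≤ Y ∧ ∀ z : ℂ, Y ≤ |z.im| → ‖symbol α z‖ ≤ ‖w‖ / 2 := by
  have hw' : 0 < ‖w‖ := norm_pos_iff.2 hw
  -- For |y| at least this large, y² ≥ |y| ≥ 16/(α²‖w‖), so the bound 8/(α²y²) is at most ‖w‖/2.
  refine ⟨1 + 16 / α ^ 2 / ‖w‖, by simp; positivity, fun z hz => ?_⟩
  have hE : 0 < 16 / α ^ 2 / ‖w‖ := by positivity
  have h1 : 1 ≤ |z.im| := by linarith
  refine (norm_symbol_le_inv_sq hα0 hαπ h1).trans ?_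
  have h2 : 16 / α ^ 2 / ‖w‖ ≤ z.im ^ 2 := by
    rw [← sq_abs z.im]
    nlinarith
  rw [div_le_iff₀ (by linarith)]
  rw [div_le_iff₀ hw'] at h2
  have : 8 / α ^ 2 = 16 / α ^ 2 / 2 := by ring
  rw [this]
  linarith

/-- Roots with 1/2 ≤ |Re z| ≤ 3/4 form a compact set, since σ is small compared with w at large
height. As none lies on |Re z| = 1/2, the minimum of |Re z| over this set exceeds 1/2. The margin ε
gives room to move contours past both lines. -/
lemma exists_strip_zero_free {α : ℝ} (hα0 : 0 < α) (hαπ : α < Real.pi) {w : ℂ} (hw : w ≠ 0)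
    (h : ∀ z : ℂ, |z.re| = 1 / 2 → symbol α z ≠ w) :
    ∃ ε, 0 < ε ∧ ε ≤ 1 / 8 ∧ ∀ z : ℂ, |z.re| < 1 / 2 + ε → symbol α z = w → |z.re| ≤ 1 / 2 := by
  obtain ⟨Y, hY1, hY⟩ := exists_norm_symbol_le_half hα0 hαπ hw
  have hw' : 0 < ‖w‖ := norm_pos_iff.2 hw
  set Z : Set ℂ := {z | |z.re| ≤ 3 / 4 ∧ |z.im| ≤ Y} ∩ ({z | 1 / 2 ≤ |z.re|} ∩
    {z | |z.re| ≤ 3 / 4 ∧ |z.im| ≤ Y} ∩ symbol α ⁻¹' {w}) with hZ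
  have hcont : ContinuousOn (symbol α) {z : ℂ | |z.re| ≤ 3 / 4 ∧ |z.im| ≤ Y} :=
    (differentiableOn_symbol α).continuousOn.mono fun z hz =>
      show |z.re| < 1 from lt_of_le_of_lt hz.1 (by norm_num)
  have hcl : IsClosed ({z : ℂ | 1 / 2 ≤ |z.re|} ∩ {z | |z.re| ≤ 3 / 4 ∧ |z.im| ≤ Y} ∩
      symbol α ⁻¹' {w}) := by
    rw [inter_assoc]
    exact (isClosed_le continuous_const Complex.continuous_re.abs).inter
      (hcont.preimage_isClosed_of_isClosed (isCompact_box _ _).isClosed isClosed_singleton)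
  have hZc : IsCompact Z := (isCompact_box _ _).inter_right hcl
  have hmem : ∀ z : ℂ, |z.re| ≤ 3 / 4 → 1 / 2 ≤ |z.re| → symbol α z = w → z ∈ Z := by
    intro z h1 h2 h3
    have h4 : |z.im| ≤ Y := by
      by_contra h5
      have := hY z (not_le.1 h5).le
      rw [h3] at this
      linarith
    exact ⟨⟨h1, h4⟩, ⟨h2, h1, h4⟩, h3⟩
  rcases Z.eq_empty_or_nonempty with he | hne
  · refine ⟨1 / 8, by norm_num, le_rfl, fun z hz hzw => ?_⟩
    by_contra hcon
    have := hmem z (by linarith) (not_le.1 hcon).le hzw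
    rw [he] at this
    exact this
  · obtain ⟨z₁, hz₁, hmin⟩ := hZc.exists_isMinOn hne
      (f := fun z : ℂ => |z.re|) (Complex.continuous_re.abs).continuousOn
    have hgt : 1 / 2 < |z₁.re| := lt_of_le_of_ne hz₁.2.1.1 fun heq => h z₁ heq.symm hz₁.2.2
    refine ⟨(|z₁.re| - 1 / 2) / 2, by linarith, by linarith [hz₁.1.1], fun z hz hzw => ?_⟩
    by_contra hcon
    have h1 := hmin (hmem z (by linarith [hz₁.1.1]) (not_le.1 hcon).le hzw)
    have h2 : |z₁.re| ≤ |z.re| := h1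
    linarith

/-- Two successive divided differences, at z₀ and then at -z₀. The derivative identities turn
simplicity of the zeros into Q(±z₀) ≠ 0. -/
lemma exists_eq_sq_sub_sq_mul {F : ℂ → ℂ} {V : Set ℂ} (hV : IsOpen V) (hF : DifferentiableOn ℂ F V)
    {z₀ : ℂ} (hz₀ : z₀ ∈ V) (hz₀' : -z₀ ∈ V) (hne : z₀ ≠ 0) (h1 : F z₀ = 0) (h2 : F (-z₀) = 0) :
    ∃ Q : ℂ → ℂ, DifferentiableOn ℂ Q V ∧ (∀ p, F p = (p ^ 2 - z₀ ^ 2) * Q p) ∧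
      2 * z₀ * Q z₀ = deriv F z₀ ∧ -2 * z₀ * Q (-z₀) = deriv F (-z₀) := by
  have hneg : -z₀ ≠ z₀ := by
    intro h
    apply hne
    have : 2 * z₀ = 0 := by linear_combination -h
    simpa using this
  set G := dslope F z₀ with hG
  set Q := dslope G (-z₀) with hQ
  have hGd : DifferentiableOn ℂ G V := (Complex.differentiableOn_dslope (hV.mem_nhds hz₀)).2 hF
  have hQd : DifferentiableOn ℂ Q V := (Complex.differentiableOn_dslope (hV.mem_nhds hz₀')).2 hGd
  have hFG : ∀ p, F p = (p - z₀) * G p := fun p => by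
    have := sub_smul_dslope F z₀ p
    rw [h1, sub_zero, smul_eq_mul] at this
    exact this.symm
  have hG0 : G (-z₀) = 0 := by
    have := hFG (-z₀)
    rw [h2] at this
    exact (mul_eq_zero.1 this.symm).resolve_left (sub_ne_zero.2 hneg)
  have hGQ : ∀ p, G p = (p + z₀) * Q p := fun p => by
    have := sub_smul_dslope G (-z₀) p
    rw [hG0, sub_zero, smul_eq_mul, sub_neg_eq_add] at this
    exact this.symm
  refine ⟨Q, hQd, fun p => ?_, ?_, ?_⟩
  · rw [hFG, hGQ]; ring
  · have := hGQ z₀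
    rw [hG, dslope_same] at this
    rw [this]; ring
  · have hQz : Q (-z₀) = deriv G (-z₀) := dslope_same G (-z₀)
    have hGat : DifferentiableAt ℂ G (-z₀) := hGd.differentiableAt (hV.mem_nhds hz₀')
    have hder : HasDerivAt (fun p => (p - z₀) * G p)
        (1 * G (-z₀) + (-z₀ - z₀) * deriv G (-z₀)) (-z₀) :=
      ((hasDerivAt_id _).sub_const z₀).mul hGat.hasDerivAt
    have hFe : F = fun p => (p - z₀) * G p := funext hFG
    rw [hQz, hFe, hder.deriv, hG0]
    ring

/-- The symbol of the regular part of the resolvent, together with the coefficient of its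
singular part. -/
structure IsResolventSymbol (α : ℝ) (w z₀ b : ℂ) (ε C : ℝ) (R : ℂ → ℂ) : Prop where
  eps_pos : 0 < ε
  eps_le : ε ≤ 1 / 8
  diff : DifferentiableOn ℂ R {z | |z.re| ≤ 1 / 2 + ε}
  bound : ∀ z : ℂ, |z.re| ≤ 1 / 2 + ε → ‖R z‖ ≤ C / (1 + z.im ^ 2)
  ne : ∀ z : ℂ, |z.re| = 1 / 2 → symbol α z ≠ w
  eq : ∀ z : ℂ, |z.re| = 1 / 2 →
    R z + b / (z ^ 2 - z₀ ^ 2) = symbol α z / (w * (symbol α z - w))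

lemma norm_symbol_div_le {α : ℝ} (hα0 : 0 < α) (hαπ : α < Real.pi) {w z : ℂ} (hw : w ≠ 0)
    (h1 : 1 ≤ |z.im|) (h : ‖symbol α z‖ ≤ ‖w‖ / 2) :
    ‖symbol α z / (w * (symbol α z - w))‖ ≤ 16 / α ^ 2 / ‖w‖ ^ 2 / z.im ^ 2 := by
  have hw' : 0 < ‖w‖ := norm_pos_iff.2 hw
  have h2 : ‖w‖ / 2 ≤ ‖symbol α z - w‖ := by
    have := norm_sub_norm_le w (symbol α z)
    rw [norm_sub_rev] at this
    linarith
  rw [norm_div, norm_mul]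
  have h3 := norm_symbol_le_inv_sq hα0 hαπ h1
  calc ‖symbol α z‖ / (‖w‖ * ‖symbol α z - w‖)
      ≤ 8 / α ^ 2 / z.im ^ 2 / (‖w‖ * (‖w‖ / 2)) := by gcongr
    _ = _ := by field_simp; norm_num

lemma exists_resolventSymbol_of_ne {α : ℝ} (hα0 : 0 < α) (hαπ : α < Real.pi) {w : ℂ}
    (hw : w ≠ 0) (z₀ : ℂ) (h : ∀ z : ℂ, |z.re| ≤ 1 / 2 → symbol α z ≠ w) :
    ∃ ε C R, IsResolventSymbol α w z₀ 0 ε C R := by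
  obtain ⟨ε, hε, hε', hzf⟩ := exists_strip_zero_free hα0 hαπ hw fun z hz => h z hz.le
  obtain ⟨Y, hY1, hY⟩ := exists_norm_symbol_le_half hα0 hαπ hw
  have hsub : {z : ℂ | |z.re| ≤ 1 / 2 + ε / 2} ⊆ strip 1 := fun z hz =>
    show |z.re| < 1 by have : |z.re| ≤ 1 / 2 + ε / 2 := hz; linarith
  have hd : DifferentiableOn ℂ (fun z => symbol α z / (w * (symbol α z - w)))
      {z : ℂ | |z.re| ≤ 1 / 2 + ε / 2} := by
    have hs := (differentiableOn_symbol α).mono hsub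
    refine hs.div ((hs.sub_const w).const_mul w) fun z hz => mul_ne_zero hw (sub_ne_zero.2 ?_)
    intro hzw
    have hz' : |z.re| ≤ 1 / 2 + ε / 2 := hz
    exact h z (hzf z (by linarith) hzw) hzw
  obtain ⟨C, hC⟩ := exists_bound_of_decay (Y := Y) hd.continuousOn fun z _ hz' =>
    norm_symbol_div_le hα0 hαπ hw (hY1.trans hz') (hY z hz')
  exact ⟨ε / 2, C, _, by linarith, by linarith, hd, hC, fun z hz => h z hz.le,
    fun z _ => by simp⟩

lemma norm_div_sq_sub_sq_le (b : ℂ) {z z₀ : ℂ} (h : 1 + 2 * |z₀.im| ≤ |z.im|) :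
    ‖b / (z ^ 2 - z₀ ^ 2)‖ ≤ 4 * ‖b‖ / z.im ^ 2 := by
  have hz : 0 < |z.im| := by linarith [abs_nonneg z₀.im]
  have h1 : |z.im| / 2 ≤ ‖z - z₀‖ := by
    have h2 := Complex.abs_im_le_norm (z - z₀)
    rw [Complex.sub_im] at h2
    have h3 := abs_sub_abs_le_abs_sub z.im z₀.im
    linarith
  have h1' : |z.im| / 2 ≤ ‖z + z₀‖ := by
    have h2 := Complex.abs_im_le_norm (z + z₀)
    rw [Complex.add_im] at h2
    have h3 := abs_sub_abs_le_abs_sub z.im (-z₀.im)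
    rw [abs_neg, sub_neg_eq_add] at h3
    linarith
  rw [norm_div, show z ^ 2 - z₀ ^ 2 = (z - z₀) * (z + z₀) by ring, norm_mul]
  calc ‖b‖ / (‖z - z₀‖ * ‖z + z₀‖) ≤ ‖b‖ / ((|z.im| / 2) * (|z.im| / 2)) := by gcongr
    _ = _ := by rw [← sq_abs z.im]; field_simp; norm_num

/-- With σ - w = (z² - z₀²)Q and Q zero-free, the resolvent symbol is B/(z² - z₀²) for B = σ/(wQ).
Since B takes the same value b at ±z₀, the single term b/(z² - z₀²) removes both poles. -/
lemma exists_resolventSymbol_of_simple {α : ℝ} (hα0 : 0 < α) (hαπ : α < Real.pi) {w : ℂ}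
    (hw : w ≠ 0) {z₀ : ℂ} (hz₀ : |z₀.re| < 1 / 2) (hne : z₀ ≠ 0) (hs : symbol α z₀ = w)
    (hd : deriv (symbol α) z₀ ≠ 0)
    (h : ∀ z : ℂ, |z.re| ≤ 1 / 2 → symbol α z = w → z = z₀ ∨ z = -z₀) :
    ∃ b ε C R, IsResolventSymbol α w z₀ b ε C R := by
  have hbd : ∀ z : ℂ, |z.re| = 1 / 2 → symbol α z ≠ w := fun z hz hzw => by
    rcases h z hz.le hzw with rfl | rfl
    · linarith
    · rw [Complex.neg_re, abs_neg] at hz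
      linarith
  obtain ⟨ε, hε, hε', hzf⟩ := exists_strip_zero_free hα0 hαπ hw hbd
  obtain ⟨Y, hY1, hY⟩ := exists_norm_symbol_le_half hα0 hαπ hw
  set V := strip (1 / 2 + ε) with hV
  have hVo : IsOpen V := isOpen_strip _
  have hVs : V ⊆ strip 1 := fun z (hz : |z.re| < 1 / 2 + ε) =>
    show |z.re| < 1 by linarith
  have hzV : z₀ ∈ V := show |z₀.re| < 1 / 2 + ε by linarith
  have hzV' : -z₀ ∈ V := show |(-z₀).re| < 1 / 2 + ε by
    rw [Complex.neg_re, abs_neg]; linarith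
  have hdiff := (differentiableOn_symbol α).mono hVs
  obtain ⟨Q, hQd, hQ, hQ1, hQ2⟩ := exists_eq_sq_sub_sq_mul hVo (hdiff.sub_const w) hzV hzV' hne
    (by rw [hs, sub_self]) (by rw [symbol_neg, hs, sub_self])
  rw [deriv_sub_const] at hQ1 hQ2
  -- The derivative of an even function is odd; hence Q takes equal values at ±z₀.
  have hdneg : deriv (symbol α) (-z₀) = -deriv (symbol α) z₀ := by
    have h1 := deriv_comp_neg (symbol α) z₀
    have h2 : (fun z => symbol α (-z)) = symbol α := funext (symbol_neg α)
    rw [h2] at h1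
    rw [h1, neg_neg]
  have hQz : Q (-z₀) = Q z₀ := by
    rw [hdneg, ← hQ1] at hQ2
    have : (2 * z₀) * (Q (-z₀) - Q z₀) = 0 := by linear_combination -hQ2
    exact sub_eq_zero.1 ((mul_eq_zero.1 this).resolve_left (by simpa using hne))
  have hQ0 : ∀ z ∈ V, Q z ≠ 0 := by
    intro z hz h0
    have hzw : symbol α z = w := by
      have := hQ z
      rw [h0, mul_zero] at this
      exact sub_eq_zero.1 this
    rcases h z (hzf z hz hzw) hzw with rfl | rfl
    · rw [h0, mul_zero] at hQ1
      exact hd hQ1.symm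
    · rw [hQz] at h0
      rw [h0, mul_zero] at hQ1
      exact hd hQ1.symm
  set B : ℂ → ℂ := fun z => symbol α z / (w * Q z) with hB
  have hBd : DifferentiableOn ℂ B V :=
    hdiff.div (hQd.const_mul w) fun z hz => mul_ne_zero hw (hQ0 z hz)
  obtain ⟨R, hRd, hR, -, -⟩ := exists_eq_sq_sub_sq_mul hVo (hBd.sub_const (B z₀)) hzV hzV' hne
    (sub_self _) (by simp only [hB]; rw [symbol_neg, hQz, sub_self])
  have key : ∀ z ∈ V, z ^ 2 - z₀ ^ 2 ≠ 0 →
      R z + B z₀ / (z ^ 2 - z₀ ^ 2) = symbol α z / (w * (symbol α z - w)) := by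
    intro z hz hz2
    have h1 := hR z
    rw [hQ z]
    have h2 := hQ0 z hz
    have h3 : R z = (B z - B z₀) / (z ^ 2 - z₀ ^ 2) := by
      rw [eq_div_iff hz2, h1]; ring
    rw [h3, ← add_div, sub_add_cancel]
    simp only [hB]
    field_simp
  have hsub : {z : ℂ | |z.re| ≤ 1 / 2 + ε / 2} ⊆ V := fun z hz =>
    show |z.re| < 1 / 2 + ε by have : |z.re| ≤ 1 / 2 + ε / 2 := hz; linarith
  have hne2 : ∀ z : ℂ, z ≠ z₀ → z ≠ -z₀ → z ^ 2 - z₀ ^ 2 ≠ 0 := fun z h1 h2 => by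
    rw [show z ^ 2 - z₀ ^ 2 = (z - z₀) * (z - -z₀) by ring]
    exact mul_ne_zero (sub_ne_zero.2 h1) (sub_ne_zero.2 h2)
  obtain ⟨C, hC⟩ := exists_bound_of_decay (R := R) (r := 1 / 2 + ε / 2)
    (Y := max Y (1 + 2 * |z₀.im|)) (C₀ := 16 / α ^ 2 / ‖w‖ ^ 2 + 4 * ‖B z₀‖)
    (hRd.mono hsub).continuousOn fun z hz hz' => by
      have h1 := (le_max_left _ _).trans hz'
      have h2 := (le_max_right _ _).trans hz'
      have h3 : z ^ 2 - z₀ ^ 2 ≠ 0 := by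
        have := abs_nonneg z₀.im
        apply hne2
        · rintro rfl; linarith
        · rintro rfl; rw [Complex.neg_im, abs_neg] at h2; linarith
      have h4 : R z = symbol α z / (w * (symbol α z - w)) - B z₀ / (z ^ 2 - z₀ ^ 2) := by
        rw [← key z (hsub hz) h3]; ring
      rw [h4, add_div]
      exact (norm_sub_le _ _).trans (add_le_add
        (norm_symbol_div_le hα0 hαπ hw (hY1.trans h1) (hY z h1)) (norm_div_sq_sub_sq_le _ h2))
  refine ⟨B z₀, ε / 2, C, R, by linarith, by linarith, hRd.mono hsub, hC, hbd, fun z hz => ?_⟩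
  refine key z (hsub (show |z.re| ≤ 1 / 2 + ε / 2 by linarith)) (hne2 z ?_ ?_)
  · rintro rfl; linarith
  · rintro rfl; rw [Complex.neg_re, abs_neg] at hz; linarith

/-! ### Kernels of the resolvent -/

/-- The point `-1/2 + i y`. -/
noncomputable def leftPt (y : ℝ) : ℂ := ((-(1 / 2) : ℝ) : ℂ) + y * Complex.I

lemma leftPt_re (y : ℝ) : (leftPt y).re = -(1 / 2) := by simp [leftPt]

lemma leftPt_im (y : ℝ) : (leftPt y).im = y := by simp [leftPt]

lemma abs_leftPt_re (y : ℝ) : |(leftPt y).re| = 1 / 2 := by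
  rw [leftPt_re, abs_neg, abs_of_pos (by norm_num)]

lemma leftPt_mem_leftLine (y : ℝ) : leftPt y ∈ leftLine := by
  show (leftPt y).re = 1 / 2 - 1
  rw [leftPt_re]; norm_num

lemma leftPt_mem_strip (y : ℝ) : leftPt y ∈ strip 1 := by
  show |(leftPt y).re| < 1
  rw [abs_leftPt_re]; norm_num

lemma continuous_leftPt : Continuous leftPt := by unfold leftPt; fun_prop

lemma integrable_comp_leftPt {R : ℂ → ℂ} {Y C₀ : ℝ} (hR : ContinuousOn R leftLine)
    (hb : ∀ z ∈ leftLine, Y ≤ |z.im| → ‖R z‖ ≤ C₀ / z.im ^ 2) :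
    Integrable fun y => R (leftPt y) := by
  obtain ⟨C, hC⟩ := exists_bound_of_decay_on isClosed_leftLine
    (fun z hz => (abs_re_of_mem_leftLine hz).le) hR hb
  refine integrable_of_norm_le_inv_one_add_sq
    (hR.comp_continuous continuous_leftPt leftPt_mem_leftLine) (C := C) fun y => ?_
  have := hC _ (leftPt_mem_leftLine y)
  rwa [leftPt_im] at this

/-- Here transforms are taken with τ^p, while `mellin` uses τ^(s-1); with s = p + 1 the line Re p =
-1/2 becomes Re s = 1/2. -/
lemma mellin_line_inversion {f : ℝ → ℂ} {F : ℂ → ℂ}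
    (hf : ∀ y : ℝ, IntegrableOn (fun τ : ℝ => f τ * (τ : ℂ) ^ leftPt y) (Ioi 0) ∧
      ∫ τ in Ioi (0 : ℝ), f τ * (τ : ℂ) ^ leftPt y = F (leftPt y))
    (hF : Integrable fun y => F (leftPt y)) {τ : ℝ} (hτ : 0 < τ) (hc : ContinuousAt f τ) :
    (1 / (2 * Real.pi) : ℝ) • ∫ y : ℝ, F (leftPt y) * (τ : ℂ) ^ (-leftPt y - 1) = f τ := by
  have hp : ∀ y : ℝ, (((1 / 2 : ℝ) : ℂ) + y * Complex.I) - 1 = leftPt y := fun y => by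
    rw [leftPt]; push_cast; ring
  have hm : ∀ y : ℝ, mellin f (((1 / 2 : ℝ) : ℂ) + y * Complex.I) = F (leftPt y) := fun y => by
    rw [mellin, hp, ← (hf y).2]
    simp_rw [smul_eq_mul, mul_comm]
  have h := mellinInv_mellin_eq (1 / 2) f hτ ?_ ?_ hc
  · rw [← h, mellinInv]
    congr 2
    ext y
    rw [hm, smul_eq_mul, mul_comm]
    congr 2
    rw [← hp]; ring
  · have := (hf 0).1
    rw [MellinConvergent]
    refine this.congr_fun (fun t _ => ?_) measurableSet_Ioi
    rw [smul_eq_mul, mul_comm, ← hp]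
    simp
  · rw [Complex.VerticalIntegrable]
    simp_rw [hm]
    exact hF

lemma kap_line_inversion {α : ℝ} (hα0 : 0 < α) (hαπ : α < Real.pi) {τ : ℝ} (hτ : 0 < τ) :
    (1 / (2 * Real.pi) : ℝ) • ∫ y : ℝ, symbol α (leftPt y) * (τ : ℂ) ^ (-leftPt y - 1) =
      (kap α τ : ℂ) := by
  refine mellin_line_inversion (f := fun τ => (kap α τ : ℂ)) (F := symbol α)
    (fun y => integral_kap_cpow hα0 hαπ (leftPt_mem_strip y)) ?_ hτ ?_
  · refine integrable_comp_leftPt (Y := 1) ?_ fun z _ h => norm_symbol_le_inv_sq hα0 hαπ h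
    refine (differentiableOn_symbol α).continuousOn.mono fun z hz => ?_
    show |z.re| < 1
    rw [abs_re_of_mem_leftLine hz]; norm_num
  · exact (Complex.continuous_ofReal.comp (continuous_kap hα0 hαπ)).continuousAt

/-- The homogeneous kernel `τ ^ (z - 1) - τ ^ (-z - 1)`. -/
noncomputable def homKernel (z : ℂ) (τ : ℝ) : ℂ := (τ : ℂ) ^ (z - 1) - (τ : ℂ) ^ (-z - 1)

/-- The part of the homogeneous kernel on `τ > 1`. -/
noncomputable def cutKernel (z : ℂ) (τ : ℝ) : ℂ := homKernel z (max τ 1)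

lemma continuousOn_homKernel (z : ℂ) : ContinuousOn (homKernel z) (Ioi 0) := by
  intro τ hτ
  have hτ' : (τ : ℂ) ∈ Complex.slitPlane := Complex.ofReal_mem_slitPlane.2 hτ
  unfold homKernel
  refine ContinuousAt.continuousWithinAt ?_
  exact ((Complex.continuous_ofReal.continuousAt).cpow continuousAt_const hτ').sub
    ((Complex.continuous_ofReal.continuousAt).cpow continuousAt_const hτ')

lemma continuous_cutKernel (z : ℂ) : Continuous (cutKernel z) :=
  (continuousOn_homKernel z).comp_continuous (by fun_prop) fun τ => by simp

/-- Both powers equal 1 at τ = 1, so cutting there leaves no jump; Mellin inversion requires this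
continuity. -/
lemma cutKernel_of_le (z : ℂ) {τ : ℝ} (h : τ ≤ 1) : cutKernel z τ = 0 := by
  rw [cutKernel, max_eq_right h, homKernel]
  simp

lemma cutKernel_of_ge (z : ℂ) {τ : ℝ} (h : 1 ≤ τ) : cutKernel z τ = homKernel z τ := by
  rw [cutKernel, max_eq_left h]

lemma norm_homKernel_le {z : ℂ} {τ : ℝ} (hτ : 0 < τ) :
    ‖homKernel z τ‖ ≤ τ ^ (z.re - 1) + τ ^ (-z.re - 1) := by
  rw [homKernel]
  refine (norm_sub_le _ _).trans ?_
  rw [Complex.norm_cpow_eq_rpow_re_of_pos hτ, Complex.norm_cpow_eq_rpow_re_of_pos hτ]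
  simp

/-- The integral over (1, ∞) is 1/(p - z) - 1/(p + z). This identifies the inverse transform of the
pole part of the resolvent symbol to the left of both poles. -/
lemma integral_cutKernel_cpow {z p : ℂ} (hz : 0 < z.re) (hp : p.re < -z.re) :
    IntegrableOn (fun τ : ℝ => cutKernel z τ * (τ : ℂ) ^ p) (Ioi 0) ∧
      ∫ τ in Ioi (0 : ℝ), cutKernel z τ * (τ : ℂ) ^ p = 2 * z / (p ^ 2 - z ^ 2) := by
  have hpt : EqOn (fun τ : ℝ => cutKernel z τ * (τ : ℂ) ^ p)
      (fun τ : ℝ => (τ : ℂ) ^ (p + z - 1) - (τ : ℂ) ^ (p - z - 1)) (Ioi 1) := by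
    intro τ hτ
    have hτ' : (1 : ℝ) < τ := hτ
    have hne : (τ : ℂ) ≠ 0 := by
      have : τ ≠ 0 := by linarith
      exact_mod_cast this
    simp only
    rw [cutKernel_of_ge z hτ'.le, homKernel, sub_mul, ← Complex.cpow_add _ _ hne,
      ← Complex.cpow_add _ _ hne]
    ring_nf
  have r1 : (p + z - 1).re < -1 := by simp; linarith
  have r2 : (p - z - 1).re < -1 := by simp; linarith
  have i1 := integrableOn_Ioi_cpow_of_lt r1 zero_lt_one
  have i2 := integrableOn_Ioi_cpow_of_lt r2 zero_lt_one
  have hsub : Ioi (1 : ℝ) ⊆ Ioi 0 := Ioi_subset_Ioi zero_le_one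
  have hI : IntegrableOn (fun τ : ℝ => cutKernel z τ * (τ : ℂ) ^ p) (Ioi 1) :=
    (i1.sub i2).congr_fun hpt.symm measurableSet_Ioi
  have hzero : ∀ τ ∈ Ioi (0 : ℝ) \ Ioi 1, cutKernel z τ * (τ : ℂ) ^ p = 0 := fun τ hτ => by
    rw [cutKernel_of_le z (not_lt.1 hτ.2), zero_mul]
  constructor
  · exact hI.of_forall_sdiff_eq_zero measurableSet_Ioi hzero
  · rw [setIntegral_eq_of_subset_of_forall_sdiff_eq_zero measurableSet_Ioi hsub hzero,
      setIntegral_congr_fun measurableSet_Ioi hpt, integral_sub i1 i2,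
      integral_Ioi_cpow_of_lt r1 zero_lt_one, integral_Ioi_cpow_of_lt r2 zero_lt_one]
    have h1 : p + z ≠ 0 := fun h => by
      have := congrArg Complex.re h
      simp at this
      linarith
    have h2 : p - z ≠ 0 := fun h => by
      have := congrArg Complex.re h
      simp at this
      linarith
    have h3 : p ^ 2 - z ^ 2 ≠ 0 := by
      rw [show p ^ 2 - z ^ 2 = (p + z) * (p - z) by ring]
      exact mul_ne_zero h1 h2
    simp only [Complex.ofReal_one, Complex.one_cpow, sub_add_cancel]
    rw [neg_div, neg_div, neg_sub_neg, div_sub_div _ _ h2 h1, div_eq_div_iff (mul_ne_zero h2 h1) h3]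
    ring

lemma sq_sub_sq_ne_zero_of_mem_leftLine {z₀ p : ℂ} (hz : |z₀.re| < 1 / 2) (hp : p ∈ leftLine) :
    p ^ 2 - z₀ ^ 2 ≠ 0 := by
  have h := abs_re_of_mem_leftLine hp
  rw [show p ^ 2 - z₀ ^ 2 = (p - z₀) * (p - -z₀) by ring]
  refine mul_ne_zero (sub_ne_zero.2 ?_) (sub_ne_zero.2 ?_)
  · rintro rfl; linarith
  · rintro rfl; rw [Complex.neg_re, abs_neg] at h; linarith

lemma integrable_div_sq_sub_sq {z₀ : ℂ} (hz : |z₀.re| < 1 / 2) (b : ℂ) :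
    Integrable fun y => b / (leftPt y ^ 2 - z₀ ^ 2) := by
  refine integrable_comp_leftPt (R := fun p => b / (p ^ 2 - z₀ ^ 2)) ?_
    fun z _ h => norm_div_sq_sub_sq_le b h
  exact ContinuousOn.div (by fun_prop) (by fun_prop)
    fun p hp => sq_sub_sq_ne_zero_of_mem_leftLine hz hp

lemma cutKernel_line_inversion {z₀ : ℂ} (h0 : 0 < z₀.re) (h1 : z₀.re < 1 / 2) {τ : ℝ}
    (hτ : 0 < τ) :
    (1 / (2 * Real.pi) : ℝ) • ∫ y : ℝ, 2 * z₀ / (leftPt y ^ 2 - z₀ ^ 2) *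
      (τ : ℂ) ^ (-leftPt y - 1) = cutKernel z₀ τ := by
  refine mellin_line_inversion (F := fun p => 2 * z₀ / (p ^ 2 - z₀ ^ 2))
    (fun y => integral_cutKernel_cpow h0 (by rw [leftPt_re]; linarith)) ?_ hτ
    (continuous_cutKernel z₀).continuousAt
  exact integrable_div_sq_sub_sq (by rw [abs_of_pos h0]; exact h1) _

/-- The inverse Mellin transform of the regular part of the resolvent symbol. -/
noncomputable def regKernel (R : ℂ → ℂ) (τ : ℝ) : ℂ :=
  (1 / (2 * Real.pi) : ℝ) • ∫ y : ℝ, R (leftPt y) * (τ : ℂ) ^ (-leftPt y - 1)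

lemma regKernel_eq {α ε C : ℝ} {w z₀ b : ℂ} {R : ℂ → ℂ} (hR : IsResolventSymbol α w z₀ b ε C R)
    {τ : ℝ} (hτ : 0 < τ) {σ : ℝ} (hσ : |σ| ≤ 1 / 2 + ε) :
    regKernel R τ = (1 / (2 * Real.pi) : ℝ) • ∫ y : ℝ, R (σ + y * Complex.I) *
      (τ : ℂ) ^ (-(σ + y * Complex.I) - 1) := by
  have hne : (τ : ℂ) ≠ 0 := by exact_mod_cast hτ.ne'
  have hsub : {z : ℂ | z.re ∈ Icc (-(1 / 2 + ε)) (1 / 2 + ε)} = {z | |z.re| ≤ 1 / 2 + ε} := by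
    ext z; simp [abs_le]
  have hε := hR.eps_pos
  have hε' := hR.eps_le
  have hd : DifferentiableOn ℂ (fun z => R z * (τ : ℂ) ^ (-z - 1))
      {z : ℂ | |z.re| ≤ 1 / 2 + ε} := by
    refine hR.diff.mul ?_
    refine DifferentiableOn.const_cpow (by fun_prop) (Or.inl hne)
  have hb : ∀ z : ℂ, |z.re| ≤ 1 / 2 + ε → ‖R z * (τ : ℂ) ^ (-z - 1)‖ ≤
      (C * Real.exp (2 * |Real.log τ|)) / (1 + z.im ^ 2) := by
    intro z hz
    rw [norm_mul, Complex.norm_cpow_eq_rpow_re_of_pos hτ, mul_div_right_comm]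
    have h1 := hR.bound z hz
    refine mul_le_mul h1 ?_ (by positivity) ((norm_nonneg _).trans h1)
    rw [Real.rpow_def_of_pos hτ]
    apply Real.exp_le_exp.2
    have h2 : |(-z - 1).re| ≤ 2 := by
      have := abs_le.1 hz
      rw [Complex.sub_re, Complex.neg_re, Complex.one_re, abs_le]
      constructor <;> linarith
    calc Real.log τ * (-z - 1).re ≤ |Real.log τ * (-z - 1).re| := le_abs_self _
      _ = |Real.log τ| * |(-z - 1).re| := abs_mul _ _
      _ ≤ _ := by nlinarith [abs_nonneg (Real.log τ)]
  have hmono : ∀ c : ℝ, |c| ≤ 1 / 2 + ε → ∫ y : ℝ, R (((-(1 / 2 + ε) : ℝ) : ℂ) + y * Complex.I) *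
      (τ : ℂ) ^ (-(((-(1 / 2 + ε) : ℝ) : ℂ) + y * Complex.I) - 1) =
      ∫ y : ℝ, R (c + y * Complex.I) * (τ : ℂ) ^ (-(c + y * Complex.I) - 1) := by
    intro c hc
    have hc' := abs_le.1 hc
    have hi : ∀ z : ℂ, z.re ∈ Icc (-(1 / 2 + ε)) c → |z.re| ≤ 1 / 2 + ε := fun z hz =>
      abs_le.2 ⟨hz.1, hz.2.trans hc'.2⟩
    exact integral_vertical_eq (g := fun z => R z * (τ : ℂ) ^ (-z - 1)) hc'.1
      (hd.mono fun z hz => hi z hz) fun z hz => hb z (hi z hz)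
  rw [regKernel, ← hmono σ hσ, hmono (-(1 / 2)) (by rw [abs_neg, abs_of_pos] <;> linarith)]
  rfl

/-- The regular part has no poles, so its contour may be any line |σ| ≤ 1/2 + ε: a negative σ gives
the bound near 0 and a positive one the bound near ∞. The integral of 1/(1 + y²) is π, whence C/2.
-/
lemma norm_regKernel_le {α ε C : ℝ} {w z₀ b : ℂ} {R : ℂ → ℂ}
    (hR : IsResolventSymbol α w z₀ b ε C R)
    {τ : ℝ} (hτ : 0 < τ) {σ : ℝ} (hσ : |σ| ≤ 1 / 2 + ε) :
    ‖regKernel R τ‖ ≤ C / 2 * τ ^ (-σ - 1) := by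
  rw [regKernel_eq hR hτ hσ, norm_smul]
  have h1 : ‖∫ y : ℝ, R (σ + y * Complex.I) * (τ : ℂ) ^ (-(σ + y * Complex.I) - 1)‖ ≤
      ∫ y : ℝ, C * τ ^ (-σ - 1) * (1 + y ^ 2)⁻¹ := by
    refine norm_integral_le_of_norm_le (integrable_inv_one_add_sq.const_mul _)
      (Eventually.of_forall fun y => ?_)
    rw [norm_mul, Complex.norm_cpow_eq_rpow_re_of_pos hτ]
    have h2 := hR.bound (σ + y * Complex.I) (by simpa using hσ)
    have h3 : (-((σ : ℂ) + y * Complex.I) - 1).re = -σ - 1 := by simp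
    rw [h3]
    calc _ ≤ C / (1 + (σ + y * Complex.I : ℂ).im ^ 2) * τ ^ (-σ - 1) :=
          mul_le_mul_of_nonneg_right h2 (by positivity)
      _ = _ := by simp; ring
  rw [integral_const_mul, integral_univ_inv_one_add_sq] at h1
  have hpi := Real.pi_pos
  rw [Real.norm_of_nonneg (by positivity)]
  calc _ ≤ 1 / (2 * Real.pi) * (C * τ ^ (-σ - 1) * Real.pi) :=
        mul_le_mul_of_nonneg_left h1 (by positivity)
    _ = _ := by field_simp

lemma measurable_regKernel {R : ℂ → ℂ} (hR : Continuous fun y => R (leftPt y)) :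
    Measurable (regKernel R) := by
  have hm : Measurable fun q : ℝ × ℝ => R (leftPt q.2) * (q.1 : ℂ) ^ (-leftPt q.2 - 1) := by
    have h1 : Measurable fun q : ℝ × ℝ => R (leftPt q.2) := hR.measurable.comp measurable_snd
    have h2 : Measurable fun q : ℝ × ℝ => -leftPt q.2 - 1 :=
      ((continuous_leftPt.measurable.comp measurable_snd).neg).sub_const 1
    exact h1.mul ((Complex.measurable_ofReal.comp measurable_fst).pow h2)
  exact (hm.stronglyMeasurable.integral_prod_right (ν := volume)).measurable.const_smul
    (1 / (2 * Real.pi) : ℝ)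

/-- The Schur bound of the operator with kernel `m` on `L²(0, ∞)`. -/
noncomputable def schurNorm (m : ℝ → ℂ) : ℝ≥0∞ :=
  ∫⁻ τ in Ioi (0 : ℝ), ‖m τ‖ₑ * ENNReal.ofReal (τ ^ (-(1 / 2) : ℝ))

lemma schurNorm_ne_top {m : ℝ → ℂ} {C δ : ℝ} (hδ : 0 < δ)
    (h1 : ∀ τ, 0 < τ → τ ≤ 1 → ‖m τ‖ ≤ C * τ ^ (δ - 1 / 2))
    (h2 : ∀ τ, 1 < τ → ‖m τ‖ ≤ C * τ ^ (-δ - 1 / 2)) : schurNorm m ≠ ⊤ := by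
  have key : ∀ τ e : ℝ, 0 < τ → ‖m τ‖ ≤ C * τ ^ (e - 1 / 2) →
      ‖m τ‖ₑ * ENNReal.ofReal (τ ^ (-(1 / 2) : ℝ)) ≤ ENNReal.ofReal (C * τ ^ (e - 1)) := by
    intro τ e hτ h
    rw [← ofReal_norm, ← ENNReal.ofReal_mul (norm_nonneg _)]
    apply ENNReal.ofReal_le_ofReal
    calc ‖m τ‖ * τ ^ (-(1 / 2) : ℝ) ≤ C * τ ^ (e - 1 / 2) * τ ^ (-(1 / 2) : ℝ) :=
          mul_le_mul_of_nonneg_right h (by positivity)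
      _ = _ := by
          rw [mul_assoc, ← Real.rpow_add hτ]
          ring_nf
  have hsplit : Ioi (0 : ℝ) = Ioc 0 1 ∪ Ioi 1 := (Ioc_union_Ioi_eq_Ioi zero_le_one).symm
  have hi1 : IntegrableOn (fun τ : ℝ => C * τ ^ (δ - 1)) (Ioc 0 1) := by
    have := (intervalIntegral.intervalIntegrable_rpow' (a := 0) (b := 1) (r := δ - 1)
      (by linarith)).const_mul C
    rwa [intervalIntegrable_iff_integrableOn_Ioc_of_le zero_le_one] at this
  have hi2 : IntegrableOn (fun τ : ℝ => C * τ ^ (-δ - 1)) (Ioi 1) :=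
    (integrableOn_Ioi_rpow_of_lt (by linarith) zero_lt_one).const_mul C
  rw [schurNorm, hsplit]
  refine ne_top_of_le_ne_top ?_ (lintegral_union_le _ _ _)
  refine ENNReal.add_ne_top.2 ⟨?_, ?_⟩
  · refine ne_top_of_le_ne_top hi1.lintegral_lt_top.ne
      (setLIntegral_mono' measurableSet_Ioc fun τ hτ => key τ δ hτ.1 (h1 τ hτ.1 hτ.2))
  · refine ne_top_of_le_ne_top hi2.lintegral_lt_top.ne
      (setLIntegral_mono' measurableSet_Ioi fun τ hτ =>
        key τ (-δ) (lt_trans zero_lt_one hτ) (h2 τ hτ))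

/-- This Schur bound is the absolutely convergent Mellin integral of the kernel at the real exponent
r - 1/2. -/
lemma schurNorm_kap_cpow {α : ℝ} (hα0 : 0 < α) (hαπ : α < Real.pi) {r : ℝ} (hr : |r - 1 / 2| < 1) :
    schurNorm (fun τ => ((τ ^ r : ℝ) : ℂ) * kap α τ) ≠ ⊤ := by
  have h := (integral_kap_cpow hα0 hαπ (p := ((r - 1 / 2 : ℝ) : ℂ)) (by simpa [strip] using hr)).1
  have h2 : ∫⁻ τ in Ioi (0 : ℝ), ‖(kap α τ : ℂ) * (τ : ℂ) ^ ((r - 1 / 2 : ℝ) : ℂ)‖ₑ < ⊤ := h.2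
  refine ne_of_lt (lt_of_eq_of_lt (setLIntegral_congr_fun measurableSet_Ioi fun τ hτ => ?_) h2)
  have hτ' : (0 : ℝ) < τ := hτ
  simp only
  rw [← ofReal_norm, ← ofReal_norm, ← ENNReal.ofReal_mul (norm_nonneg _), norm_mul, norm_mul,
    Complex.norm_cpow_eq_rpow_re_of_pos hτ', Complex.ofReal_re, Complex.norm_real,
    Real.norm_of_nonneg (by positivity), Real.rpow_sub hτ', Real.rpow_neg hτ'.le]
  congr 1
  ring

/-- Multiplicative convolution with the kernel acts on power functions of a Mellin integral by
multiplication with the symbol. -/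
lemma integral_kap_mul_mellin {α : ℝ} (hα0 : 0 < α) (hαπ : α < Real.pi) {S : ℝ → ℂ}
    (hS : Integrable S) (hSc : Continuous S) {θ : ℝ} (hθ : 0 < θ) :
    ∫ ρ in Ioi (0 : ℝ), (kap α ρ : ℂ) * (ρ : ℂ)⁻¹ *
      (∫ y : ℝ, S y * ((θ / ρ : ℝ) : ℂ) ^ (-leftPt y - 1)) =
      ∫ y : ℝ, S y * symbol α (leftPt y) * (θ : ℂ) ^ (-leftPt y - 1) := by
  have hk : IntegrableOn (fun τ : ℝ => (kap α τ : ℂ) * (τ : ℂ) ^ leftPt 0) (Ioi 0) :=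
    (integral_kap_cpow hα0 hαπ (leftPt_mem_strip 0)).1
  have hpt : ∀ ρ ∈ Ioi (0 : ℝ), (kap α ρ : ℂ) * (ρ : ℂ)⁻¹ *
      (∫ y : ℝ, S y * ((θ / ρ : ℝ) : ℂ) ^ (-leftPt y - 1)) =
      ∫ y : ℝ, (S y * (θ : ℂ) ^ (-leftPt y - 1)) * ((kap α ρ : ℂ) * (ρ : ℂ) ^ leftPt y) := by
    intro ρ hρ
    have hρ' : (0 : ℝ) < ρ := hρ
    have hne : (ρ : ℂ) ≠ 0 := by exact_mod_cast hρ'.ne'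
    rw [← integral_const_mul]
    congr 1
    ext y
    have e1 : ((θ / ρ : ℝ) : ℂ) ^ (-leftPt y - 1) =
        (θ : ℂ) ^ (-leftPt y - 1) * ((ρ : ℂ) ^ leftPt y * ρ) := by
      rw [div_eq_mul_inv, Complex.ofReal_mul, Complex.mul_cpow_ofReal_nonneg hθ.le (by positivity),
        Complex.ofReal_inv, Complex.inv_cpow _ _ (by
          rw [Complex.arg_ofReal_of_nonneg hρ'.le]; exact Real.pi_pos.ne),
        ← Complex.cpow_neg, neg_sub, sub_neg_eq_add, add_comm, Complex.cpow_add _ _ hne,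
        Complex.cpow_one]
    rw [e1]
    field_simp
  rw [setIntegral_congr_fun measurableSet_Ioi hpt, integral_integral_swap]
  · congr 1
    ext y
    rw [integral_const_mul, (integral_kap_cpow hα0 hαπ (leftPt_mem_strip y)).2]
    ring
  · have hb : Integrable (fun q : ℝ × ℝ => (‖(kap α q.1 : ℂ) * (q.1 : ℂ) ^ leftPt 0‖) *
        (‖S q.2‖ * θ ^ (-(1 / 2) : ℝ))) ((volume.restrict (Ioi 0)).prod volume) :=
      (Integrable.norm hk).mul_prod (hS.norm.mul_const _)
    refine hb.mono ?_ ?_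
    · refine Measurable.aestronglyMeasurable ?_
      have m1 : Measurable fun q : ℝ × ℝ => leftPt q.2 :=
        continuous_leftPt.measurable.comp measurable_snd
      have m2 : Measurable fun q : ℝ × ℝ => (q.1 : ℂ) :=
        Complex.measurable_ofReal.comp measurable_fst
      have m3 : Measurable fun q : ℝ × ℝ => (kap α q.1 : ℂ) :=
        Complex.measurable_ofReal.comp ((continuous_kap hα0 hαπ).measurable.comp measurable_fst)
      exact ((hSc.measurable.comp measurable_snd).mul (measurable_const.pow (m1.neg.sub_const 1))).mul
        (m3.mul (m2.pow m1))
    · have hmem : ∀ᵐ q ∂((volume.restrict (Ioi (0 : ℝ))).prod (volume : Measure ℝ)),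
          q.1 ∈ Ioi (0 : ℝ) :=
        Measure.quasiMeasurePreserving_fst.ae (ae_restrict_mem measurableSet_Ioi)
      filter_upwards [hmem] with q hq
      have hq' : 0 < q.1 := hq
      simp only [Function.uncurry]
      simp only [norm_mul, norm_norm]
      rw [Complex.norm_cpow_eq_rpow_re_of_pos hθ, Complex.norm_cpow_eq_rpow_re_of_pos hq',
        Complex.norm_cpow_eq_rpow_re_of_pos hq', leftPt_re, Complex.sub_re, Complex.neg_re,
        leftPt_re, leftPt_re, Complex.one_re, Real.norm_of_nonneg (by positivity)]
      apply le_of_eq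
      norm_num
      ring

lemma norm_homKernel_le_of_ge {z : ℂ} {τ : ℝ} (hz : 0 < z.re) (h : 1 ≤ τ) :
    ‖homKernel z τ‖ ≤ 2 * τ ^ (z.re - 1) := by
  refine (norm_homKernel_le (by linarith)).trans ?_
  have : τ ^ (-z.re - 1) ≤ τ ^ (z.re - 1) := Real.rpow_le_rpow_of_exponent_le h (by linarith)
  linarith

lemma norm_homKernel_le_of_le {z : ℂ} {τ : ℝ} (hz : 0 < z.re) (h0 : 0 < τ) (h : τ ≤ 1) :
    ‖homKernel z τ‖ ≤ 2 * τ ^ (-z.re - 1) := by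
  refine (norm_homKernel_le h0).trans ?_
  have : τ ^ (z.re - 1) ≤ τ ^ (-z.re - 1) :=
    Real.rpow_le_rpow_of_exponent_ge h0 h (by linarith)
  linarith

lemma measurable_homKernel (z : ℂ) : Measurable (homKernel z) :=
  (Complex.measurable_ofReal.pow measurable_const).sub
    (Complex.measurable_ofReal.pow measurable_const)

/-- Kernels of the resolvent on `L²` and on `W¹₀`, and the homogeneous solution by which they
differ. -/
structure IsResolventKernel (α : ℝ) (w z₀ c : ℂ) (mL mR : ℝ → ℂ) : Prop where
  measurable_left : Measurable mL
  measurable_right : Measurable mR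
  schur_left : schurNorm mL ≠ ⊤
  schur_right : schurNorm (fun τ => (τ : ℂ) * mR τ) ≠ ⊤
  sub_eq : ∀ τ, 0 < τ → mL τ = mR τ + c * homKernel z₀ τ
  conv_eq : ∀ θ : ℝ, 0 < θ → ∫ ρ in Ioi (0 : ℝ), (kap α ρ : ℂ) * (ρ : ℂ)⁻¹ * mL (θ / ρ) =
    w * mL θ + kap α θ / w

/-- Both kernels share the regular part; they differ in how the pole part b/(p² - z₀²) is inverted.
Left of the poles it gives c times the homogeneous kernel on τ > 1, right of them -c times that
kernel on τ < 1. The coefficient is b/(2z₀) because the cut kernel has transform 2z₀/(p² - z₀²). -/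
lemma IsResolventSymbol.exists_kernel {α ε C : ℝ} {w z₀ b : ℂ} {R : ℂ → ℂ}
    (hα0 : 0 < α) (hαπ : α < Real.pi) (hw : w ≠ 0)
    (hR : IsResolventSymbol α w z₀ b ε C R) (h0 : 0 < z₀.re) (h1 : z₀.re < 1 / 2) :
    ∃ mL mR, IsResolventKernel α w z₀ (b / (2 * z₀)) mL mR := by
  have hz₀ : z₀ ≠ 0 := by rintro rfl; simp at h0
  have hzre : |z₀.re| < 1 / 2 := by rwa [abs_of_pos h0]
  have hε := hR.eps_pos
  have hε' := hR.eps_le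
  have hmem : ∀ y, leftPt y ∈ {z : ℂ | |z.re| ≤ 1 / 2 + ε} := fun y => by
    show |(leftPt y).re| ≤ 1 / 2 + ε
    rw [abs_leftPt_re]; linarith
  have hRc : Continuous fun y => R (leftPt y) :=
    hR.diff.continuousOn.comp_continuous continuous_leftPt hmem
  have hRi : Integrable fun y => R (leftPt y) :=
    integrable_of_norm_le_inv_one_add_sq hRc (C := C) fun y => by
      have := hR.bound _ (hmem y)
      rwa [leftPt_im] at this
  set c := b / (2 * z₀) with hc
  set S : ℝ → ℂ := fun y => R (leftPt y) + b / (leftPt y ^ 2 - z₀ ^ 2) with hS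
  have hS2i := integrable_div_sq_sub_sq hzre b
  have hSi : Integrable S := hRi.add hS2i
  have hS2c : Continuous fun y => b / (leftPt y ^ 2 - z₀ ^ 2) :=
    continuous_const.div ((continuous_leftPt.pow 2).sub continuous_const)
      fun y => sq_sub_sq_ne_zero_of_mem_leftLine hzre (leftPt_mem_leftLine y)
  have hSc : Continuous S := hRc.add hS2c
  have hpow : ∀ {θ : ℝ}, 0 < θ → ∀ {f : ℝ → ℂ}, Integrable f →
      Integrable fun y => f y * (θ : ℂ) ^ (-leftPt y - 1) := by
    intro θ hθ f hf
    have hne : (θ : ℂ) ≠ 0 := by exact_mod_cast hθ.ne'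
    refine hf.mul_bdd (c := θ ^ (-(1 / 2) : ℝ)) ?_ (Eventually.of_forall fun y => ?_)
    · refine Continuous.aestronglyMeasurable ?_
      refine Continuous.const_cpow ?_ (Or.inl hne)
      exact continuous_leftPt.neg.sub continuous_const
    · rw [Complex.norm_cpow_eq_rpow_re_of_pos hθ, Complex.sub_re, Complex.neg_re, leftPt_re]
      norm_num
  set mL : ℝ → ℂ := fun τ => regKernel R τ + c * cutKernel z₀ τ with hmL
  have hmLS : ∀ θ : ℝ, 0 < θ →
      mL θ = (1 / (2 * Real.pi) : ℝ) • ∫ y : ℝ, S y * (θ : ℂ) ^ (-leftPt y - 1) := by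
    intro θ hθ
    have e : ∀ y : ℝ, S y * (θ : ℂ) ^ (-leftPt y - 1) = R (leftPt y) * (θ : ℂ) ^ (-leftPt y - 1) +
        c * (2 * z₀ / (leftPt y ^ 2 - z₀ ^ 2) * (θ : ℂ) ^ (-leftPt y - 1)) := fun y => by
      simp only [hS, hc]
      field_simp
    simp_rw [e]
    rw [integral_add (hpow hθ hRi)
      ((hpow hθ (integrable_div_sq_sub_sq hzre (2 * z₀))).const_mul c), integral_const_mul,
      smul_add, ← mul_smul_comm _ c, cutKernel_line_inversion h0 h1 hθ]
    rfl
  have hmeas := measurable_regKernel hRc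
  have hC : 0 ≤ C := by
    have := (norm_nonneg _).trans (hR.bound _ (hmem 0))
    rw [leftPt_im] at this
    simpa using this
  -- One margin for the regular part, limited by ε, and for the powers τ^(±z₀-1), limited by the
  -- distance of z₀ from Re z = 1/2.
  set δ := min ε (1 / 2 - z₀.re) with hδ
  have hδ0 : 0 < δ := lt_min hε (by linarith)
  have hδ1 : δ ≤ ε := min_le_left _ _
  have hδ2 : δ ≤ 1 / 2 - z₀.re := min_le_right _ _
  refine ⟨mL, fun τ => mL τ - c * homKernel z₀ τ, ?_, ?_, ?_, ?_, ?_, ?_⟩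
  · exact hmeas.add ((continuous_cutKernel z₀).measurable.const_mul c)
  · exact (hmeas.add ((continuous_cutKernel z₀).measurable.const_mul c)).sub
      ((measurable_homKernel z₀).const_mul c)
  · refine schurNorm_ne_top (C := C / 2 + ‖c‖ * 2) hδ0 (fun τ hτ hτ1 => ?_) fun τ hτ1 => ?_
    · simp only [hmL]
      rw [cutKernel_of_le z₀ hτ1, mul_zero, add_zero]
      have h := norm_regKernel_le hR hτ (σ := -(1 / 2 + ε))
        (by rw [abs_neg, abs_of_pos (by linarith)])
      refine h.trans (mul_le_mul ?_ ?_ (by positivity) (by positivity))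
      · have := norm_nonneg c; linarith
      · exact Real.rpow_le_rpow_of_exponent_ge hτ hτ1 (by linarith)
    · have hτ : 0 < τ := by linarith
      simp only [hmL]
      rw [cutKernel_of_ge z₀ hτ1.le, add_mul]
      have h := norm_regKernel_le hR hτ (σ := 1 / 2 + ε) (by rw [abs_of_pos (by linarith)])
      refine (norm_add_le _ _).trans (add_le_add (h.trans ?_) ?_)
      · refine mul_le_mul_of_nonneg_left ?_ (by positivity)
        exact Real.rpow_le_rpow_of_exponent_le hτ1.le (by linarith)
      · rw [norm_mul, mul_assoc]
        refine mul_le_mul_of_nonneg_left ?_ (norm_nonneg _)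
        refine (norm_homKernel_le_of_ge h0 hτ1.le).trans ?_
        refine mul_le_mul_of_nonneg_left ?_ zero_le_two
        exact Real.rpow_le_rpow_of_exponent_le hτ1.le (by linarith)
  · have hτm : ∀ {τ : ℝ} (e : ℝ), 0 < τ → τ * τ ^ e = τ ^ (e + 1) := fun {τ} e hτ => by
      rw [Real.rpow_add_one hτ.ne', mul_comm]
    refine schurNorm_ne_top (C := C / 2 + ‖c‖ * 2) hδ0 (fun τ hτ hτ1 => ?_) fun τ hτ1 => ?_
    · simp only [hmL]
      rw [cutKernel_of_le z₀ hτ1, mul_zero, add_zero, norm_mul, Complex.norm_real,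
        Real.norm_of_nonneg hτ.le]
      have h := norm_regKernel_le hR hτ (σ := -(1 / 2 + ε))
        (by rw [abs_neg, abs_of_pos (by linarith)])
      calc τ * ‖regKernel R τ - c * homKernel z₀ τ‖
          ≤ τ * (C / 2 * τ ^ (-(-(1 / 2 + ε)) - 1) + ‖c‖ * (2 * τ ^ (-z₀.re - 1))) := by
            refine mul_le_mul_of_nonneg_left ((norm_sub_le _ _).trans (add_le_add h ?_)) hτ.le
            rw [norm_mul]
            exact mul_le_mul_of_nonneg_left (norm_homKernel_le_of_le h0 hτ hτ1) (norm_nonneg _)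
        _ = C / 2 * τ ^ (-(-(1 / 2 + ε)) - 1 + 1) + ‖c‖ * 2 * τ ^ (-z₀.re - 1 + 1) := by
            rw [← hτm _ hτ, ← hτm _ hτ]; ring
        _ ≤ C / 2 * τ ^ (δ - 1 / 2) + ‖c‖ * 2 * τ ^ (δ - 1 / 2) := by
            refine add_le_add (mul_le_mul_of_nonneg_left ?_ (by positivity))
              (mul_le_mul_of_nonneg_left ?_ (by positivity))
            · exact Real.rpow_le_rpow_of_exponent_ge hτ hτ1 (by linarith)
            · exact Real.rpow_le_rpow_of_exponent_ge hτ hτ1 (by linarith)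
        _ = _ := by ring
    · have hτ : 0 < τ := by linarith
      simp only [hmL]
      rw [cutKernel_of_ge z₀ hτ1.le, add_sub_cancel_right, norm_mul, Complex.norm_real,
        Real.norm_of_nonneg hτ.le]
      have h := norm_regKernel_le hR hτ (σ := 1 / 2 + ε) (by rw [abs_of_pos (by linarith)])
      calc τ * ‖regKernel R τ‖ ≤ τ * (C / 2 * τ ^ (-(1 / 2 + ε) - 1)) :=
            mul_le_mul_of_nonneg_left h hτ.le
        _ = C / 2 * τ ^ (-(1 / 2 + ε) - 1 + 1) := by rw [← hτm _ hτ]; ring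
        _ ≤ (C / 2 + ‖c‖ * 2) * τ ^ (-δ - 1 / 2) := by
            refine mul_le_mul ?_ ?_ (by positivity) (by positivity)
            · have := norm_nonneg c; linarith
            · exact Real.rpow_le_rpow_of_exponent_le hτ1.le (by linarith)
  · intro τ _
    ring
  · intro θ hθ
    have e1 : ∀ ρ ∈ Ioi (0 : ℝ), (kap α ρ : ℂ) * (ρ : ℂ)⁻¹ * mL (θ / ρ) =
        (1 / (2 * Real.pi) : ℝ) • ((kap α ρ : ℂ) * (ρ : ℂ)⁻¹ *
          ∫ y : ℝ, S y * ((θ / ρ : ℝ) : ℂ) ^ (-leftPt y - 1)) := fun ρ hρ => by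
      rw [hmLS _ (div_pos hθ hρ), mul_smul_comm]
    rw [setIntegral_congr_fun measurableSet_Ioi e1, integral_smul,
      integral_kap_mul_mellin hα0 hαπ hSi hSc hθ]
    -- On the transform side the convolution identity is the algebra σS = wS + σ/w for S = σ/(w(σ -
    -- w)).
    have e2 : ∀ y : ℝ, S y * symbol α (leftPt y) * (θ : ℂ) ^ (-leftPt y - 1) =
        w * (S y * (θ : ℂ) ^ (-leftPt y - 1)) +
        w⁻¹ * (symbol α (leftPt y) * (θ : ℂ) ^ (-leftPt y - 1)) := fun y => by
      have h2 := hR.eq _ (abs_leftPt_re y)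
      have h3 := sub_ne_zero.2 (hR.ne _ (abs_leftPt_re y))
      have h4 : S y = symbol α (leftPt y) / (w * (symbol α (leftPt y) - w)) := h2
      have h5 : S y * symbol α (leftPt y) = w * S y + w⁻¹ * symbol α (leftPt y) := by
        rw [h4]; field_simp; ring
      rw [h5]; ring
    have hsi : Integrable fun y => symbol α (leftPt y) := by
      refine integrable_comp_leftPt (Y := 1) ?_ fun z _ h => norm_symbol_le_inv_sq hα0 hαπ h
      refine (differentiableOn_symbol α).continuousOn.mono fun z hz => ?_
      show |z.re| < 1
      rw [abs_re_of_mem_leftLine hz]; norm_num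
    simp_rw [e2]
    rw [integral_add ((hpow hθ hSi).const_mul w) ((hpow hθ hsi).const_mul w⁻¹), integral_const_mul,
      integral_const_mul, smul_add, ← mul_smul_comm _ w, ← hmLS θ hθ,
      ← mul_smul_comm _ w⁻¹, kap_line_inversion hα0 hαπ hθ, div_eq_inv_mul]

/-- The value 1/4 is a placeholder in (0, 1/2): without roots the coefficient is 0 and the exponent
plays no role. -/
lemma exists_resolventKernel_of_ne {α : ℝ} (hα0 : 0 < α) (hαπ : α < Real.pi) {w : ℂ}
    (hw : w ≠ 0) (h : ∀ z : ℂ, |z.re| ≤ 1 / 2 → symbol α z ≠ w) :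
    ∃ mL mR, IsResolventKernel α w (1 / 4) 0 mL mR := by
  obtain ⟨ε, C, R, hR⟩ := exists_resolventSymbol_of_ne hα0 hαπ hw (1 / 4) h
  have := hR.exists_kernel hα0 hαπ hw (by norm_num) (by norm_num)
  rwa [zero_div] at this

lemma exists_resolventKernel_of_simple {α : ℝ} (hα0 : 0 < α) (hαπ : α < Real.pi) {w : ℂ}
    (hw : w ≠ 0) {z₀ : ℂ} (h0 : 0 < z₀.re) (h1 : z₀.re < 1 / 2) (hs : symbol α z₀ = w)
    (hd : deriv (symbol α) z₀ ≠ 0)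
    (h : ∀ z : ℂ, |z.re| ≤ 1 / 2 → symbol α z = w → z = z₀ ∨ z = -z₀) :
    ∃ c mL mR, IsResolventKernel α w z₀ c mL mR := by
  obtain ⟨b, ε, C, R, hR⟩ := exists_resolventSymbol_of_simple hα0 hαπ hw
    (by rwa [abs_of_pos h0]) (by rintro rfl; simp at h0) hs hd h
  exact ⟨_, hR.exists_kernel hα0 hαπ hw h0 h1⟩

/-! ### Averages of dilations -/

/-- The average `∫_0^∞ m(τ) f(τ x) dτ` of dilations of `f`. -/
noncomputable def dilAvg (m f : ℝ → ℂ) (x : ℝ) : ℂ := ∫ τ in Ioi (0 : ℝ), m τ * f (τ * x)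

/-- The corresponding average of absolute values. -/
noncomputable def absDilAvg (m f : ℝ → ℂ) (x : ℝ) : ℝ≥0∞ :=
  ∫⁻ τ in Ioi (0 : ℝ), ‖m τ‖ₑ * ‖f (τ * x)‖ₑ

lemma l2Sq_eq (f : ℝ → ℂ) : l2Sq f = ∫⁻ s in Ioi (0 : ℝ), ‖f s‖ₑ ^ 2 := rfl

lemma image_mul_Ioi {x : ℝ} (hx : 0 < x) : (fun t => x * t) '' Ioi 0 = Ioi 0 := by
  ext s
  constructor
  · rintro ⟨t, ht, rfl⟩
    exact mul_pos hx ht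
  · intro hs
    exact ⟨s / x, div_pos hs hx, by field_simp⟩

lemma lintegral_Ioi_comp_mul {x : ℝ} (hx : 0 < x) (G : ℝ → ℝ≥0∞) :
    ∫⁻ t in Ioi (0 : ℝ), G t = ENNReal.ofReal x * ∫⁻ t in Ioi (0 : ℝ), G (x * t) := by
  have h := lintegral_image_eq_lintegral_abs_deriv_mul (s := Ioi 0) (f := fun t => x * t)
    (f' := fun _ => x) measurableSet_Ioi
    (fun t _ => by simpa using ((hasDerivAt_id t).const_mul x).hasDerivWithinAt)
    (fun a _ b _ h => mul_left_cancel₀ hx.ne' h) G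
  rw [image_mul_Ioi hx] at h
  rw [h, abs_of_pos hx, lintegral_const_mul' _ _ ENNReal.ofReal_ne_top]

lemma lintegral_Ioi_comp_mul_eq {x : ℝ} (hx : 0 < x) (G : ℝ → ℝ≥0∞) :
    ∫⁻ t in Ioi (0 : ℝ), G (x * t) = ENNReal.ofReal x⁻¹ * ∫⁻ t in Ioi (0 : ℝ), G t := by
  have h := lintegral_Ioi_comp_mul hx G
  rw [h, ← mul_assoc, ← ENNReal.ofReal_mul (by positivity),
    inv_mul_cancel₀ hx.ne', ENNReal.ofReal_one, one_mul]

lemma lintegral_mul_sq_le {ι : Type*} [MeasurableSpace ι] {μ : Measure ι} {k g : ι → ℝ≥0∞}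
    (hk : AEMeasurable k μ) (hg : AEMeasurable g μ) :
    (∫⁻ t, k t * g t ∂μ) ^ 2 ≤ (∫⁻ t, k t ∂μ) * ∫⁻ t, k t * g t ^ 2 ∂μ := by
  have h := ENNReal.lintegral_mul_le_Lp_mul_Lq μ (p := 2) (q := 2)
    Real.HolderConjugate.two_two (f := fun t => k t ^ (1 / 2 : ℝ))
    (g := fun t => k t ^ (1 / 2 : ℝ) * g t) (hk.pow_const _) ((hk.pow_const _).mul hg)
  have hsq : ∀ t : ι, k t ^ (1 / 2 : ℝ) * k t ^ (1 / 2 : ℝ) = k t := fun t => by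
    rw [← ENNReal.rpow_add_of_nonneg _ _ (by norm_num) (by norm_num)]
    norm_num
  have e1 : ∀ t, (k t ^ (1 / 2 : ℝ)) ^ (2 : ℝ) = k t := fun t => by
    rw [← ENNReal.rpow_mul]; norm_num
  have e2 : ∀ t, (k t ^ (1 / 2 : ℝ) * g t) ^ (2 : ℝ) = k t * g t ^ 2 := fun t => by
    rw [ENNReal.mul_rpow_of_nonneg _ _ zero_le_two, e1]
    norm_num
  have e3 : ∀ t, (k t ^ (1 / 2 : ℝ)) * (k t ^ (1 / 2 : ℝ) * g t) = k t * g t := fun t => by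
    rw [← mul_assoc, hsq]
  simp only [Pi.mul_apply, e1, e2, e3] at h
  calc (∫⁻ t, k t * g t ∂μ) ^ 2
      ≤ ((∫⁻ t, k t ∂μ) ^ (1 / 2 : ℝ) * (∫⁻ t, k t * g t ^ 2 ∂μ) ^ (1 / 2 : ℝ)) ^ 2 := by gcongr
    _ = _ := by
      rw [mul_pow, ← ENNReal.rpow_natCast, ← ENNReal.rpow_natCast, ← ENNReal.rpow_mul,
        ← ENNReal.rpow_mul]
      norm_num

lemma measurable_absDilAvg {m f : ℝ → ℂ} (hm : Measurable m) (hf : Measurable f) :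
    Measurable (absDilAvg m f) := by
  unfold absDilAvg
  refine Measurable.lintegral_prod_right' (f := fun q : ℝ × ℝ => ‖m q.2‖ₑ * ‖f (q.2 * q.1)‖ₑ) ?_
  fun_prop

/-- Schur test. Cauchy–Schwarz with the weights τ^(∓1/2) leaves ∫ |m| τ^(1/2) |f(τx)|² dτ, and
integrating in x yields a factor τ⁻¹, which restores the weight τ^(-1/2). -/
lemma lintegral_absDilAvg_sq_le {m f : ℝ → ℂ} (hm : Measurable m) (hf : Measurable f) :
    ∫⁻ x in Ioi (0 : ℝ), absDilAvg m f x ^ 2 ≤ schurNorm m ^ 2 * l2Sq f := by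
  have hpt : ∀ x, absDilAvg m f x ^ 2 ≤ schurNorm m * ∫⁻ τ in Ioi (0 : ℝ),
      ‖m τ‖ₑ * ENNReal.ofReal (τ ^ (1 / 2 : ℝ)) * ‖f (τ * x)‖ₑ ^ 2 := by
    intro x
    have h := lintegral_mul_sq_le (μ := volume.restrict (Ioi (0 : ℝ)))
      (k := fun τ => ‖m τ‖ₑ * ENNReal.ofReal (τ ^ (-(1 / 2) : ℝ)))
      (g := fun τ => ENNReal.ofReal (τ ^ (1 / 2 : ℝ)) * ‖f (τ * x)‖ₑ)
      (by fun_prop) (by fun_prop)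
    have e1 : ∀ τ ∈ Ioi (0 : ℝ), ‖m τ‖ₑ * ENNReal.ofReal (τ ^ (-(1 / 2) : ℝ)) *
        (ENNReal.ofReal (τ ^ (1 / 2 : ℝ)) * ‖f (τ * x)‖ₑ) = ‖m τ‖ₑ * ‖f (τ * x)‖ₑ := by
      intro τ hτ
      have hτ' : (0 : ℝ) < τ := hτ
      rw [mul_assoc, ← mul_assoc (ENNReal.ofReal _), ← ENNReal.ofReal_mul (by positivity),
        ← Real.rpow_add hτ']
      norm_num
    have e2 : ∀ τ ∈ Ioi (0 : ℝ), ‖m τ‖ₑ * ENNReal.ofReal (τ ^ (-(1 / 2) : ℝ)) *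
        (ENNReal.ofReal (τ ^ (1 / 2 : ℝ)) * ‖f (τ * x)‖ₑ) ^ 2 =
        ‖m τ‖ₑ * ENNReal.ofReal (τ ^ (1 / 2 : ℝ)) * ‖f (τ * x)‖ₑ ^ 2 := by
      intro τ hτ
      have hτ' : (0 : ℝ) < τ := hτ
      rw [mul_pow, ← mul_assoc, mul_assoc ‖m τ‖ₑ, ← ENNReal.ofReal_pow (by positivity),
        ← ENNReal.ofReal_mul (by positivity), ← Real.rpow_natCast, ← Real.rpow_mul hτ'.le,
        ← Real.rpow_add hτ']
      norm_num
    rw [setLIntegral_congr_fun measurableSet_Ioi e1, setLIntegral_congr_fun measurableSet_Ioi e2] at h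
    exact h
  calc ∫⁻ x in Ioi (0 : ℝ), absDilAvg m f x ^ 2
      ≤ ∫⁻ x in Ioi (0 : ℝ), schurNorm m * ∫⁻ τ in Ioi (0 : ℝ),
          ‖m τ‖ₑ * ENNReal.ofReal (τ ^ (1 / 2 : ℝ)) * ‖f (τ * x)‖ₑ ^ 2 :=
        lintegral_mono hpt
    _ = schurNorm m * ∫⁻ τ in Ioi (0 : ℝ), ∫⁻ x in Ioi (0 : ℝ),
          ‖m τ‖ₑ * ENNReal.ofReal (τ ^ (1 / 2 : ℝ)) * ‖f (τ * x)‖ₑ ^ 2 := by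
        rw [lintegral_const_mul _ (Measurable.lintegral_prod_right'
          (f := fun q : ℝ × ℝ => ‖m q.2‖ₑ * ENNReal.ofReal (q.2 ^ (1 / 2 : ℝ)) *
            ‖f (q.2 * q.1)‖ₑ ^ 2) (by fun_prop)), lintegral_lintegral_swap]
        fun_prop
    _ = schurNorm m * ∫⁻ τ in Ioi (0 : ℝ),
          ‖m τ‖ₑ * ENNReal.ofReal (τ ^ (-(1 / 2) : ℝ)) * l2Sq f := by
        congr 1
        refine setLIntegral_congr_fun measurableSet_Ioi fun τ hτ => ?_
        have hτ' : (0 : ℝ) < τ := hτ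
        rw [lintegral_const_mul _ (by fun_prop),
          lintegral_Ioi_comp_mul_eq hτ' (fun t => ‖f t‖ₑ ^ 2), ← l2Sq_eq, ← mul_assoc,
          mul_assoc ‖m τ‖ₑ, ← ENNReal.ofReal_mul (by positivity), ← Real.rpow_neg_one,
          ← Real.rpow_add hτ']
        norm_num
    _ = _ := by
        rw [lintegral_mul_const _ (by fun_prop), ← schurNorm, sq, mul_assoc]

lemma enorm_dilAvg_le (m f : ℝ → ℂ) (x : ℝ) : ‖dilAvg m f x‖ₑ ≤ absDilAvg m f x := by
  rw [dilAvg, absDilAvg]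
  refine (enorm_integral_le_lintegral_enorm _).trans (le_of_eq ?_)
  simp_rw [enorm_mul]

lemma measurable_dilAvg {m f : ℝ → ℂ} (hm : Measurable m) (hf : Measurable f) :
    Measurable (dilAvg m f) := by
  have h : Measurable fun q : ℝ × ℝ => m q.2 * f (q.2 * q.1) := by fun_prop
  exact (h.stronglyMeasurable.integral_prod_right (ν := volume.restrict (Ioi 0))).measurable

lemma l2Sq_dilAvg_le {m f : ℝ → ℂ} (hm : Measurable m) (hf : Measurable f) :
    l2Sq (dilAvg m f) ≤ schurNorm m ^ 2 * l2Sq f := by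
  refine le_trans ?_ (lintegral_absDilAvg_sq_le hm hf)
  rw [l2Sq_eq]
  exact lintegral_mono fun x => pow_le_pow_left₀ (zero_le) (enorm_dilAvg_le m f x) 2

lemma ae_absDilAvg_lt_top {m f : ℝ → ℂ} (hm : Measurable m) (hf : Measurable f)
    (hs : schurNorm m ≠ ⊤) (h2 : l2Sq f ≠ ⊤) :
    ∀ᵐ x ∂halfLine, absDilAvg m f x < ⊤ := by
  have h : ∫⁻ x in Ioi (0 : ℝ), absDilAvg m f x ^ 2 ≠ ⊤ :=
    ne_top_of_le_ne_top (ENNReal.mul_ne_top (ENNReal.pow_ne_top hs) h2)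
      (lintegral_absDilAvg_sq_le hm hf)
  filter_upwards [ae_lt_top ((measurable_absDilAvg hm hf).pow_const 2) h] with x hx
  exact lt_top_iff_ne_top.2 fun h' => by simp [h'] at hx

lemma integrableOn_of_absDilAvg_lt_top {m f : ℝ → ℂ} (hm : Measurable m) (hf : Measurable f) {x : ℝ}
    (h : absDilAvg m f x < ⊤) : IntegrableOn (fun τ => m τ * f (τ * x)) (Ioi 0) := by
  refine ⟨Measurable.aestronglyMeasurable (by fun_prop), ?_⟩
  rw [HasFiniteIntegral]
  simp_rw [enorm_mul]
  exact h

lemma ae_halfLine_iff {P : ℝ → Prop} : (∀ᵐ s ∂halfLine, P s) ↔ ∀ᵐ s : ℝ, 0 < s → P s := by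
  rw [halfLine, ae_restrict_iff' measurableSet_Ioi]
  rfl

lemma ae_halfLine_comp_mul {P : ℝ → Prop} (h : ∀ᵐ s ∂halfLine, P s) {x : ℝ} (hx : 0 < x) :
    ∀ᵐ τ ∂halfLine, P (τ * x) := by
  rw [ae_halfLine_iff] at h ⊢
  have h2 : ∀ᵐ τ : ℝ, (0 < τ * x → P (τ * x)) := by
    rw [ae_iff] at h ⊢
    have := Real.volume_preimage_mul_right hx.ne' {a | ¬(0 < a → P a)}
    rw [h, mul_zero] at this
    exact this
  filter_upwards [h2] with τ hτ h0
  exact hτ (mul_pos h0 hx)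

lemma dilAvg_congr {m f g : ℝ → ℂ} (h : f =ᵐ[halfLine] g) {x : ℝ} (hx : 0 < x) :
    dilAvg m f x = dilAvg m g x := by
  refine integral_congr_ae ?_
  filter_upwards [ae_halfLine_comp_mul h hx] with τ hτ
  rw [hτ]

lemma opK_eq_dilAvg {α : ℝ} (hα0 : 0 < α) (hαπ : α < Real.pi) (f : ℝ → ℂ) {s : ℝ} (hs : 0 < s) :
    opK α f s = dilAvg (fun τ => (kap α τ : ℂ)) f s := by
  have h := integral_comp_mul_left_Ioi (fun t => (kernel α s t : ℂ) * f t) 0 hs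
  rw [mul_zero] at h
  have h2 : opK α f s = s • ∫ τ in Ioi (0 : ℝ), (kernel α s (s * τ) : ℂ) * f (s * τ) := by
    rw [h, smul_smul, mul_inv_cancel₀ hs.ne', one_smul]
    rfl
  rw [h2, dilAvg, ← integral_smul]
  refine setIntegral_congr_fun measurableSet_Ioi fun τ _ => ?_
  rw [kernel_eq_kap hα0 hαπ hs, mul_div_cancel_left₀ _ hs.ne', mul_comm s τ, Complex.real_smul]
  push_cast
  have : (s : ℂ) ≠ 0 := by exact_mod_cast hs.ne'
  field_simp

/-! ### Composition -/

/-- Fubini and the substitution θ = ρτ: averages of dilations compose by multiplicative convolution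
of their kernels. -/
lemma dilAvg_dilAvg {m k f : ℝ → ℂ} (hm : Measurable m) (hk : Measurable k) (hf : Measurable f)
    {x : ℝ} (h : ∫⁻ τ in Ioi (0 : ℝ), ‖m τ‖ₑ * absDilAvg k f (τ * x) ≠ ⊤) :
    dilAvg m (dilAvg k f) x =
      ∫ θ in Ioi (0 : ℝ), (∫ ρ in Ioi (0 : ℝ), k ρ * (ρ : ℂ)⁻¹ * m (θ / ρ)) * f (θ * x) := by
  have hprod : ∫⁻ τ in Ioi (0 : ℝ), ∫⁻ ρ in Ioi (0 : ℝ), ‖m τ * (k ρ * f (ρ * (τ * x)))‖ₑ ≠ ⊤ := by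
    refine ne_of_eq_of_ne (lintegral_congr fun τ => ?_) h
    simp_rw [enorm_mul]
    rw [lintegral_const_mul _ (by fun_prop)]
    rfl
  have hi1 : Integrable (Function.uncurry fun τ ρ => m τ * (k ρ * f (ρ * (τ * x))))
      ((volume.restrict (Ioi (0 : ℝ))).prod (volume.restrict (Ioi (0 : ℝ)))) := by
    refine ⟨Measurable.aestronglyMeasurable (by unfold Function.uncurry; fun_prop), ?_⟩
    rw [HasFiniteIntegral, lintegral_prod _ (by unfold Function.uncurry; fun_prop)]
    exact lt_top_iff_ne_top.2 hprod
  have hsub : ∀ ρ ∈ Ioi (0 : ℝ), ∫ τ in Ioi (0 : ℝ), m τ * (k ρ * f (ρ * (τ * x))) =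
      ∫ θ in Ioi (0 : ℝ), k ρ * (ρ : ℂ)⁻¹ * m (θ / ρ) * f (θ * x) := by
    intro ρ hρ
    have hρ' : (0 : ℝ) < ρ := hρ
    have h := integral_comp_mul_left_Ioi
      (fun θ => k ρ * (ρ : ℂ)⁻¹ * m (θ / ρ) * f (θ * x)) 0 hρ'
    rw [mul_zero] at h
    have h2 := congrArg (fun z => ρ • z) h
    simp only [smul_smul, mul_inv_cancel₀ hρ'.ne', one_smul] at h2
    rw [← h2, ← integral_smul]
    refine setIntegral_congr_fun measurableSet_Ioi fun τ _ => ?_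
    rw [mul_div_cancel_left₀ _ hρ'.ne', Complex.real_smul, mul_assoc ρ τ x]
    have : (ρ : ℂ) ≠ 0 := by exact_mod_cast hρ'.ne'
    field_simp
  have hsubE : ∀ ρ ∈ Ioi (0 : ℝ), ∫⁻ τ in Ioi (0 : ℝ), ‖m τ * (k ρ * f (ρ * (τ * x)))‖ₑ =
      ∫⁻ θ in Ioi (0 : ℝ), ‖k ρ * (ρ : ℂ)⁻¹ * m (θ / ρ) * f (θ * x)‖ₑ := by
    intro ρ hρ
    have hρ' : (0 : ℝ) < ρ := hρ
    rw [lintegral_Ioi_comp_mul hρ' (fun θ => ‖k ρ * (ρ : ℂ)⁻¹ * m (θ / ρ) * f (θ * x)‖ₑ),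
      ← lintegral_const_mul' _ _ ENNReal.ofReal_ne_top]
    refine setLIntegral_congr_fun measurableSet_Ioi fun τ _ => ?_
    rw [mul_div_cancel_left₀ _ hρ'.ne', mul_assoc ρ τ x]
    simp only [enorm_mul]
    have : ENNReal.ofReal ρ * ‖(ρ : ℂ)⁻¹‖ₑ = 1 := by
      rw [← ofReal_norm, norm_inv, Complex.norm_real, Real.norm_of_nonneg hρ'.le,
        ← ENNReal.ofReal_mul hρ'.le, mul_inv_cancel₀ hρ'.ne', ENNReal.ofReal_one]
    calc _ = 1 * (‖m τ‖ₑ * (‖k ρ‖ₑ * ‖f (ρ * (τ * x))‖ₑ)) := by rw [one_mul]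
      _ = _ := by rw [← this]; ring
  have hi2 : Integrable (Function.uncurry fun ρ θ => k ρ * (ρ : ℂ)⁻¹ * m (θ / ρ) * f (θ * x))
      ((volume.restrict (Ioi (0 : ℝ))).prod (volume.restrict (Ioi (0 : ℝ)))) := by
    refine ⟨Measurable.aestronglyMeasurable (by unfold Function.uncurry; fun_prop), ?_⟩
    rw [HasFiniteIntegral, lintegral_prod _ (by unfold Function.uncurry; fun_prop)]
    simp only [Function.uncurry]
    rw [← setLIntegral_congr_fun measurableSet_Ioi hsubE, lintegral_lintegral_swap (by fun_prop)]
    exact lt_top_iff_ne_top.2 hprod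
  calc dilAvg m (dilAvg k f) x
      = ∫ τ in Ioi (0 : ℝ), ∫ ρ in Ioi (0 : ℝ), m τ * (k ρ * f (ρ * (τ * x))) := by
        simp_rw [dilAvg, integral_const_mul]
    _ = ∫ ρ in Ioi (0 : ℝ), ∫ τ in Ioi (0 : ℝ), m τ * (k ρ * f (ρ * (τ * x))) :=
        integral_integral_swap hi1
    _ = ∫ ρ in Ioi (0 : ℝ), ∫ θ in Ioi (0 : ℝ), k ρ * (ρ : ℂ)⁻¹ * m (θ / ρ) * f (θ * x) :=
        setIntegral_congr_fun measurableSet_Ioi hsub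
    _ = ∫ θ in Ioi (0 : ℝ), ∫ ρ in Ioi (0 : ℝ), k ρ * (ρ : ℂ)⁻¹ * m (θ / ρ) * f (θ * x) :=
        integral_integral_swap hi2
    _ = _ := by
        simp_rw [integral_mul_const]

lemma l2Sq_enorm_ne_top_absDilAvg {k f : ℝ → ℂ} (hk : Measurable k) (hf : Measurable f)
    (hs : schurNorm k ≠ ⊤) (h2 : l2Sq f ≠ ⊤) :
    l2Sq (fun x => ((absDilAvg k f x).toReal : ℂ)) ≠ ⊤ := by
  refine ne_top_of_le_ne_top (ENNReal.mul_ne_top (ENNReal.pow_ne_top hs) h2)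
    (le_trans ?_ (lintegral_absDilAvg_sq_le hk hf))
  rw [l2Sq_eq]
  refine lintegral_mono fun x => pow_le_pow_left₀ zero_le ?_ 2
  rw [← ofReal_norm, Complex.norm_real, Real.norm_of_nonneg ENNReal.toReal_nonneg]
  exact ENNReal.ofReal_toReal_le

/-- The average of |f| against |k| is again square integrable, so the Schur test applies once more.
This is the absolute convergence behind the composition formula. -/
lemma ae_lintegral_absDilAvg_ne_top {m k f : ℝ → ℂ} (hm : Measurable m) (hk : Measurable k)
    (hf : Measurable f) (hsm : schurNorm m ≠ ⊤) (hsk : schurNorm k ≠ ⊤) (h2 : l2Sq f ≠ ⊤) :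
    ∀ᵐ x ∂halfLine, ∫⁻ τ in Ioi (0 : ℝ), ‖m τ‖ₑ * absDilAvg k f (τ * x) ≠ ⊤ := by
  have h := ae_absDilAvg_lt_top hm (f := fun x => ((absDilAvg k f x).toReal : ℂ))
    (Complex.measurable_ofReal.comp (measurable_absDilAvg hk hf).ennreal_toReal) hsm
    (l2Sq_enorm_ne_top_absDilAvg hk hf hsk h2)
  have hfin := ae_absDilAvg_lt_top hk hf hsk h2
  filter_upwards [h, ae_restrict_mem measurableSet_Ioi] with x hx hx0
  refine ne_of_eq_of_ne (lintegral_congr_ae ?_) hx.ne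
  filter_upwards [ae_halfLine_comp_mul hfin hx0] with τ hτ
  rw [← ofReal_norm (_ : ℂ), ← ofReal_norm (_ : ℂ), Complex.norm_real,
    Real.norm_of_nonneg ENNReal.toReal_nonneg, ENNReal.ofReal_toReal hτ.ne]

lemma measurable_ofReal_kap {α : ℝ} (hα0 : 0 < α) (hαπ : α < Real.pi) :
    Measurable fun τ => (kap α τ : ℂ) :=
  Complex.measurable_ofReal.comp (continuous_kap hα0 hαπ).measurable

lemma schurNorm_kap {α : ℝ} (hα0 : 0 < α) (hαπ : α < Real.pi) :
    schurNorm (fun τ => (kap α τ : ℂ)) ≠ ⊤ := by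
  simpa using schurNorm_kap_cpow hα0 hαπ (r := 0) (by norm_num [abs_lt])

/-- Inversion of `K - w` on `L²` by the left resolvent kernel. -/
lemma IsResolventKernel.eq_of_solves {α : ℝ} {w z₀ c : ℂ} {mL mR : ℝ → ℂ} (hα0 : 0 < α)
    (hαπ : α < Real.pi) (hw : w ≠ 0) (hk : IsResolventKernel α w z₀ c mL mR)
    {f G : ℝ → ℂ} (hf : Measurable f) (hf2 : l2Sq f ≠ ⊤)
    (h : ∀ᵐ s ∂halfLine, dilAvg (fun τ => (kap α τ : ℂ)) f s - w * f s = G s) :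
    ∀ᵐ s ∂halfLine, f s = dilAvg mL G s - w⁻¹ * G s := by
  have hκ := measurable_ofReal_kap hα0 hαπ
  have hκs := schurNorm_kap hα0 hαπ
  have hKf := measurable_dilAvg hκ hf
  have hKf2 : l2Sq (dilAvg (fun τ => (kap α τ : ℂ)) f) ≠ ⊤ :=
    ne_top_of_le_ne_top (ENNReal.mul_ne_top (ENNReal.pow_ne_top hκs) hf2) (l2Sq_dilAvg_le hκ hf)
  filter_upwards [h, ae_restrict_mem measurableSet_Ioi,
    ae_absDilAvg_lt_top hk.measurable_left hf hk.schur_left hf2,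
    ae_absDilAvg_lt_top hκ hf hκs hf2,
    ae_absDilAvg_lt_top hk.measurable_left hKf hk.schur_left hKf2,
    ae_lintegral_absDilAvg_ne_top hk.measurable_left hκ hf hk.schur_left hκs hf2]
    with s hs hs0 h1 h2 h3 h4
  have i1 := integrableOn_of_absDilAvg_lt_top hk.measurable_left hf h1
  have i2 := integrableOn_of_absDilAvg_lt_top hκ hf h2
  have i3 := integrableOn_of_absDilAvg_lt_top hk.measurable_left hKf h3
  have e1 : dilAvg mL G s =
      dilAvg mL (dilAvg (fun τ => (kap α τ : ℂ)) f) s - w * dilAvg mL f s := by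
    rw [← dilAvg_congr h hs0]
    simp only [dilAvg] at i3 ⊢
    rw [← integral_const_mul, ← integral_sub i3 (i1.const_mul w)]
    congr 1
    ext τ
    ring
  -- By the convolution identity of the kernel; the terms w · `dilAvg mL f s` then cancel against
  -- those in `e1`.
  have e2 : dilAvg mL (dilAvg (fun τ => (kap α τ : ℂ)) f) s =
      w * dilAvg mL f s + w⁻¹ * dilAvg (fun τ => (kap α τ : ℂ)) f s := by
    rw [dilAvg_dilAvg hk.measurable_left hκ hf h4]
    have e3 : ∀ θ ∈ Ioi (0 : ℝ), (∫ ρ in Ioi (0 : ℝ), (kap α ρ : ℂ) * (ρ : ℂ)⁻¹ * mL (θ / ρ)) *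
        f (θ * s) = w * (mL θ * f (θ * s)) + w⁻¹ * ((kap α θ : ℂ) * f (θ * s)) := fun θ hθ => by
      rw [hk.conv_eq θ hθ]
      ring
    rw [setIntegral_congr_fun measurableSet_Ioi e3, integral_add (i1.const_mul w)
      (i2.const_mul w⁻¹), integral_const_mul, integral_const_mul]
    rfl
  rw [e1, e2, ← hs]
  field_simp
  ring

/-! ### Primitives -/

/-- The primitive vanishing at `0`. -/
noncomputable def prim (v : ℝ → ℂ) (s : ℝ) : ℂ := ∫ x in (0 : ℝ)..s, v x

lemma lintegral_Ioc_sq_le {g : ℝ → ℝ≥0∞} (hg : AEMeasurable g halfLine) {s : ℝ} :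
    (∫⁻ x in Ioc 0 s, g x) ^ 2 ≤ ENNReal.ofReal s * ∫⁻ x in Ioi (0 : ℝ), g x ^ 2 := by
  have hsub : Ioc 0 s ⊆ Ioi (0 : ℝ) := Ioc_subset_Ioi_self
  have h := lintegral_mul_sq_le (μ := volume.restrict (Ioc 0 s)) (k := fun _ => 1) (g := g)
    (by fun_prop) (hg.mono_measure (Measure.restrict_mono hsub le_rfl))
  simp only [one_mul, lintegral_one, Measure.restrict_apply_univ, Real.volume_Ioc, sub_zero] at h
  exact h.trans (mul_le_mul_right (lintegral_mono_set hsub) _)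

lemma integrableOn_Ioc_of_l2Sq {v : ℝ → ℂ} (hv : AEStronglyMeasurable v halfLine)
    (h2 : l2Sq v ≠ ⊤) (s : ℝ) : IntegrableOn v (Ioc 0 s) := by
  have hsub : Ioc 0 s ⊆ Ioi (0 : ℝ) := Ioc_subset_Ioi_self
  refine ⟨hv.mono_measure (Measure.restrict_mono hsub le_rfl), ?_⟩
  have h := lintegral_Ioc_sq_le (s := s) hv.enorm
  have h3 : (∫⁻ x in Ioc 0 s, ‖v x‖ₑ) ^ 2 ≠ ⊤ :=
    ne_top_of_le_ne_top (ENNReal.mul_ne_top ENNReal.ofReal_ne_top h2) h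
  exact lt_top_iff_ne_top.2 fun h' => by
    rw [h'] at h3
    simp at h3

lemma enorm_prim_sq_le {v : ℝ → ℂ} (hv : AEStronglyMeasurable v halfLine) {s : ℝ} (hs : 0 ≤ s) :
    ‖prim v s‖ₑ ^ 2 ≤ ENNReal.ofReal s * l2Sq v := by
  refine le_trans ?_ (lintegral_Ioc_sq_le hv.enorm)
  refine pow_le_pow_left₀ zero_le ?_ 2
  rw [prim, intervalIntegral.integral_of_le hs]
  exact enorm_integral_le_lintegral_enorm _

lemma continuousOn_prim {v : ℝ → ℂ} (hv : AEStronglyMeasurable v halfLine) (h2 : l2Sq v ≠ ⊤) :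
    ContinuousOn (prim v) (Ici 0) := by
  intro s hs
  have hs' : (0 : ℝ) ≤ s := hs
  have h1 : ContinuousOn (prim v) (Icc 0 (s + 1)) := by
    have := intervalIntegral.continuousOn_primitive_interval (a := 0) (b := s + 1) (f := v)
      (μ := volume) (by
        rw [uIcc_of_le (by linarith), integrableOn_Icc_iff_integrableOn_Ioc]
        exact integrableOn_Ioc_of_l2Sq hv h2 _)
    rwa [uIcc_of_le (by linarith)] at this
  refine (h1 s ⟨hs', by linarith⟩).mono_of_mem_nhdsWithin ?_
  exact mem_nhdsWithin.2 ⟨Iio (s + 1), isOpen_Iio, by simp, fun t ht => ⟨ht.2, le_of_lt ht.1⟩⟩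

/-- The primitive of v at τs is the integral over (0, s) of τ v(τx), and Fubini exchanges the
averages. Hence it is the Schur bound of τ m(τ), not of m, that controls the derivative. -/
lemma dilAvg_prim {m v : ℝ → ℂ} (hm : Measurable m) (hv : Measurable v)
    (hs : schurNorm (fun τ => (τ : ℂ) * m τ) ≠ ⊤) (h2 : l2Sq v ≠ ⊤) {s : ℝ} (hs0 : 0 < s) :
    dilAvg m (prim v) s = prim (dilAvg (fun τ => (τ : ℂ) * m τ) v) s ∧
      IntegrableOn (fun τ => m τ * prim v (τ * s)) (Ioi 0) := by
  have hm' : Measurable fun τ : ℝ => (τ : ℂ) * m τ := Complex.measurable_ofReal.mul hm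
  have e1 : ∀ τ ∈ Ioi (0 : ℝ), m τ * prim v (τ * s) =
      ∫ x in Ioc 0 s, (τ : ℂ) * m τ * v (τ * x) := by
    intro τ hτ
    have hτ' : (0 : ℝ) < τ := hτ
    have := intervalIntegral.smul_integral_comp_mul_left (a := 0) (b := s) v τ
    rw [mul_zero] at this
    rw [prim, ← this, intervalIntegral.integral_of_le hs0.le, Complex.real_smul, integral_const_mul]
    ring
  have hi : Integrable (Function.uncurry fun (x τ : ℝ) => (τ : ℂ) * m τ * v (τ * x))
      ((volume.restrict (Ioc 0 s)).prod (volume.restrict (Ioi (0 : ℝ)))) := by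
    have hmeas : Measurable (Function.uncurry fun (x τ : ℝ) => (τ : ℂ) * m τ * v (τ * x)) := by
      unfold Function.uncurry
      fun_prop
    refine ⟨hmeas.aestronglyMeasurable, ?_⟩
    rw [HasFiniteIntegral, lintegral_prod _ hmeas.enorm.aemeasurable]
    simp only [Function.uncurry]
    have h3 : ∀ x, ∫⁻ τ in Ioi (0 : ℝ), ‖(τ : ℂ) * m τ * v (τ * x)‖ₑ =
        absDilAvg (fun τ => (τ : ℂ) * m τ) v x := fun x => by
      simp_rw [enorm_mul, absDilAvg, enorm_mul]
    simp_rw [h3]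
    have h4 := lintegral_Ioc_sq_le (s := s) (measurable_absDilAvg hm' hv).aemeasurable
    have h5 : (∫⁻ x in Ioc 0 s, absDilAvg (fun τ => (τ : ℂ) * m τ) v x) ^ 2 ≠ ⊤ :=
      ne_top_of_le_ne_top (ENNReal.mul_ne_top ENNReal.ofReal_ne_top
        (ne_top_of_le_ne_top (ENNReal.mul_ne_top (ENNReal.pow_ne_top hs) h2)
          (lintegral_absDilAvg_sq_le hm' hv))) h4
    exact lt_top_iff_ne_top.2 fun h' => by
      rw [h'] at h5
      simp at h5
  constructor
  · rw [dilAvg, setIntegral_congr_fun measurableSet_Ioi e1, ← integral_integral_swap hi, prim,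
      intervalIntegral.integral_of_le hs0.le]
    rfl
  · exact (integrableOn_congr_fun e1 measurableSet_Ioi).2 hi.integral_prod_right

/-- Hardy's inequality. -/
lemma exists_hardy : ∃ C : ℝ≥0, ∀ v : ℝ → ℂ, Measurable v →
    l2Sq (fun s => prim v s / (s : ℂ)) ≤ C * l2Sq v := by
  -- The quotient of the primitive by s is the average of v(τs) over τ in (0, 1], so Hardy's
  -- inequality is a case of the Schur test.
  set m : ℝ → ℂ := indicator (Ioc 0 1) fun _ => 1 with hm
  have hmm : Measurable m := measurable_const.indicator measurableSet_Ioc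
  have hs : schurNorm m ≠ ⊤ := by
    refine schurNorm_ne_top (C := 1) (δ := 1 / 2) (by norm_num) (fun τ h0 h1 => ?_) fun τ h1 => ?_
    · simp [hm, h0, h1]
    · rw [hm, indicator_of_notMem (fun h => absurd h.2 (not_le.2 h1)), norm_zero]
      positivity
  refine ⟨(schurNorm m ^ 2).toNNReal, fun v hv => ?_⟩
  rw [ENNReal.coe_toNNReal (ENNReal.pow_ne_top hs)]
  refine le_of_eq_of_le ?_ (l2Sq_dilAvg_le hmm hv)
  rw [l2Sq_eq, l2Sq_eq]
  refine setLIntegral_congr_fun measurableSet_Ioi fun s h0 => ?_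
  have h0' : (0 : ℝ) < s := h0
  have hne : (s : ℂ) ≠ 0 := by exact_mod_cast h0'.ne'
  have h1 := intervalIntegral.smul_integral_comp_mul_right (a := 0) (b := 1) v s
  rw [zero_mul, one_mul] at h1
  have h2 : dilAvg m v s = ∫ τ in (0 : ℝ)..1, v (τ * s) := by
    rw [dilAvg, intervalIntegral.integral_of_le zero_le_one]
    have : (fun τ => m τ * v (τ * s)) = indicator (Ioc 0 1) fun τ => v (τ * s) := by
      ext τ
      by_cases h : τ ∈ Ioc (0 : ℝ) 1 <;> simp [hm, h]
    rw [this, setIntegral_indicator measurableSet_Ioc, inter_eq_right.2 Ioc_subset_Ioi_self]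
  rw [h2, prim, ← h1, Complex.real_smul, mul_div_cancel_left₀ _ hne]

/-! ### The space `W₀¹` -/

lemma l2Sq_eq_eLpNorm (f : ℝ → ℂ) : l2Sq f = eLpNorm f 2 halfLine ^ 2 := by
  rw [eLpNorm_eq_lintegral_rpow_enorm_toReal two_ne_zero ENNReal.ofNat_ne_top,
    ← ENNReal.rpow_natCast, ← ENNReal.rpow_mul, l2Sq]
  norm_num

lemma l2Sq_congr {f g : ℝ → ℂ} (h : f =ᵐ[halfLine] g) : l2Sq f = l2Sq g := by
  refine lintegral_congr_ae ?_
  filter_upwards [h] with s hs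
  rw [hs]

lemma l2Sq_mono {f g : ℝ → ℂ} (h : ∀ s, 0 < s → ‖f s‖ ≤ ‖g s‖) : l2Sq f ≤ l2Sq g := by
  refine setLIntegral_mono' measurableSet_Ioi fun s hs => ?_
  exact pow_le_pow_left₀ zero_le (enorm_le_iff_norm_le.2 (h s hs)) 2

lemma add_sq_le_two_mul (a b : ℝ≥0∞) : (a + b) ^ 2 ≤ 2 * (a ^ 2 + b ^ 2) := by
  have h := ENNReal.rpow_add_le_mul_rpow_add_rpow a b (p := 2) (by norm_num)
  norm_num at h
  exact h

lemma enorm_add_sq_le (a b : ℂ) : ‖a + b‖ₑ ^ 2 ≤ 2 * (‖a‖ₑ ^ 2 + ‖b‖ₑ ^ 2) :=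
  (pow_le_pow_left₀ zero_le (enorm_add_le a b) 2).trans (add_sq_le_two_mul _ _)

lemma l2Sq_add_le {f g : ℝ → ℂ} (hf : AEStronglyMeasurable f halfLine) :
    l2Sq (fun s => f s + g s) ≤ 2 * (l2Sq f + l2Sq g) := by
  rw [l2Sq, l2Sq, l2Sq, ← lintegral_add_left' (hf.enorm.pow_const 2), ← lintegral_const_mul' _ _ (by simp)]
  exact lintegral_mono fun s => enorm_add_sq_le _ _

lemma l2Sq_sub_le {f g : ℝ → ℂ} (hf : AEStronglyMeasurable f halfLine) :
    l2Sq (fun s => f s - g s) ≤ 2 * (l2Sq f + l2Sq g) := by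
  have h := l2Sq_add_le (f := f) (g := fun s => -g s) hf
  simpa [l2Sq, sub_eq_add_neg] using h

lemma l2Sq_const_mul (c : ℂ) (f : ℝ → ℂ) : l2Sq (fun s => c * f s) = ‖c‖ₑ ^ 2 * l2Sq f := by
  simp_rw [l2Sq, enorm_mul, mul_pow]
  rw [lintegral_const_mul' _ _ (by simp)]

lemma l2Sq_comp_div (f : ℝ → ℂ) {R : ℝ} (hR : 0 < R) :
    l2Sq (fun s => f (s / R)) = ENNReal.ofReal R * l2Sq f := by
  have h := lintegral_Ioi_comp_mul_eq (inv_pos.2 hR) (fun t => ‖f t‖ₑ ^ 2)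
  simp_rw [inv_inv] at h
  rw [l2Sq_eq, l2Sq_eq, ← h]
  simp_rw [div_eq_inv_mul]

lemma l2Sq_ne_top_of_continuous {f : ℝ → ℂ} (hf : Continuous f) (hc : HasCompactSupport f) :
    l2Sq f ≠ ⊤ := by
  rw [l2Sq_eq_eLpNorm]
  have : MemLp f 2 halfLine := (hf.memLp_of_hasCompactSupport (μ := volume) hc).mono_measure
    Measure.restrict_le_self
  exact ENNReal.pow_ne_top this.eLpNorm_ne_top

/-- Smooth functions supported in a compact subset of `(0, ∞)` are dense in `L²`. -/
lemma exists_smooth_l2Sq_sub_le {v : ℝ → ℂ} (hv : Measurable v) (h2 : l2Sq v ≠ ⊤) {ε : ℝ}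
    (hε : 0 < ε) : ∃ w : ℝ → ℂ, ContDiff ℝ ∞ w ∧
      (∃ a b : ℝ, 0 < a ∧ a < b ∧ ∀ s, s ∉ Icc a b → w s = 0) ∧
      l2Sq (fun s => w s - v s) ≤ ENNReal.ofReal ε := by
  -- truncation near the origin
  obtain ⟨η, hη, hηε⟩ : ∃ η : ℝ, 0 < η ∧ ∫⁻ s in Ioc 0 η, ‖v s‖ₑ ^ 2 ≤ ENNReal.ofReal (ε / 4) := by
    have h := tendsto_setLIntegral_zero (μ := halfLine) (f := fun s => ‖v s‖ₑ ^ 2) h2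
      (l := atTop) (s := fun n : ℕ => Ioc 0 (1 / ((n : ℝ) + 1))) (by
        have : ∀ n : ℕ, halfLine (Ioc 0 (1 / ((n : ℝ) + 1))) = ENNReal.ofReal (1 / ((n : ℝ) + 1)) := by
          intro n
          rw [halfLine, Measure.restrict_apply measurableSet_Ioc,
            inter_eq_left.2 Ioc_subset_Ioi_self, Real.volume_Ioc, sub_zero]
        simp only [Function.comp_def, this]
        rw [← ENNReal.ofReal_zero]
        exact ENNReal.tendsto_ofReal tendsto_one_div_add_atTop_nhds_zero_nat)
    have h' := (h.eventually (ge_mem_nhds (ENNReal.ofReal_pos.2 (by positivity : 0 < ε / 4)))).exists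
    obtain ⟨n, hn⟩ := h'
    refine ⟨1 / ((n : ℝ) + 1), by positivity, ?_⟩
    rwa [halfLine, Measure.restrict_restrict measurableSet_Ioc,
      inter_eq_left.2 Ioc_subset_Ioi_self] at hn
  set vη : ℝ → ℂ := indicator (Ioi η) v with hvη
  have hvηm : Measurable vη := hv.indicator measurableSet_Ioi
  have hmem : MemLp vη 2 volume := by
    refine ⟨hvηm.aestronglyMeasurable, ?_⟩
    rw [eLpNorm_eq_lintegral_rpow_enorm_toReal two_ne_zero ENNReal.ofNat_ne_top]
    refine ENNReal.rpow_lt_top_of_nonneg (by norm_num) (ne_top_of_le_ne_top h2 ?_)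
    rw [l2Sq_eq, ← lintegral_indicator measurableSet_Ioi]
    refine lintegral_mono fun s => ?_
    by_cases hs : s ∈ Ioi η
    · have hs' : s ∈ Ioi (0 : ℝ) := hη.trans hs
      simp [hvη, hs, hs']
    · simp [hvη, hs]
  obtain ⟨g, hg1, hg2, hg3⟩ := hmem.exist_eLpNorm_sub_le ENNReal.ofNat_ne_top one_le_two
    (ε := √(ε / 4)) (by positivity)
  have hg3' : l2Sq (fun s => g s - vη s) ≤ ENNReal.ofReal (ε / 4) := by
    have h4 : l2Sq (fun s => g s - vη s) = eLpNorm (vη - g) 2 halfLine ^ 2 := by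
      rw [l2Sq_eq_eLpNorm, ← eLpNorm_neg]
      congr 2
      ext s
      simp
    rw [h4]
    calc eLpNorm (vη - g) 2 halfLine ^ 2 ≤ eLpNorm (vη - g) 2 volume ^ 2 :=
          pow_le_pow_left₀ zero_le (eLpNorm_mono_measure _ Measure.restrict_le_self) 2
      _ ≤ ENNReal.ofReal (√(ε / 4)) ^ 2 := pow_le_pow_left₀ zero_le hg3 2
      _ = ENNReal.ofReal (ε / 4) := by
          rw [← ENNReal.ofReal_pow (by positivity), Real.sq_sqrt (by positivity)]
  obtain ⟨b, hb⟩ : ∃ b : ℝ, ∀ s, b < s → g s = 0 := by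
    obtain ⟨b, hb⟩ := hg1.isCompact.bddAbove
    exact ⟨b, fun s hs => image_eq_zero_of_notMem_tsupport fun h => absurd (hb h) (not_le.2 hs)⟩
  -- A smooth factor, 0 below η/2 and 1 above η. Where it differs from 1 the truncated function
  -- vanishes, so multiplying by it does not enlarge the error.
  set χ : ℝ → ℝ := fun s => Real.smoothTransition ((s - η / 2) / (η / 2)) with hχ
  have hχs : ContDiff ℝ ∞ χ := Real.smoothTransition.contDiff.comp (by fun_prop)
  have hχ0 : ∀ s, s ≤ η / 2 → χ s = 0 := fun s hs =>
    Real.smoothTransition.zero_of_nonpos (div_nonpos_of_nonpos_of_nonneg (by linarith) (by positivity))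
  have hχ1 : ∀ s, η ≤ s → χ s = 1 := fun s hs =>
    Real.smoothTransition.one_of_one_le (by rw [le_div_iff₀ (by positivity)]; linarith)
  refine ⟨fun s => (χ s : ℂ) * g s, ?_, ⟨η / 2, max b η, by positivity,
    lt_max_of_lt_right (by linarith), fun s hs => ?_⟩, ?_⟩
  · exact (Complex.ofRealCLM.contDiff.comp hχs).mul hg2
  · rw [mem_Icc, not_and_or, not_le, not_le] at hs
    rcases hs with hs | hs
    · simp [hχ0 s hs.le]
    · simp [hb s ((le_max_left _ _).trans_lt hs)]
  · have e1 : l2Sq (fun s => (χ s : ℂ) * g s - v s) ≤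
        2 * (l2Sq (fun s => (χ s : ℂ) * g s - vη s) + l2Sq (fun s => vη s - v s)) := by
      refine le_trans (le_of_eq ?_) (l2Sq_add_le ?_)
      · congr 1
        ext s
        ring
      · exact (((Complex.measurable_ofReal.comp hχs.continuous.measurable).mul
          hg2.continuous.measurable).sub hvηm).aestronglyMeasurable
    have e2 : l2Sq (fun s => (χ s : ℂ) * g s - vη s) ≤ l2Sq (fun s => g s - vη s) := by
      refine l2Sq_mono fun s _ => ?_
      by_cases hs : s ∈ Ioi η
      · rw [hχ1 s (le_of_lt hs)]
        simp
      · simp only [hvη, indicator_of_notMem hs, sub_zero, norm_mul, Complex.norm_real]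
        refine mul_le_of_le_one_left (norm_nonneg _) ?_
        rw [Real.norm_of_nonneg (Real.smoothTransition.nonneg _)]
        exact Real.smoothTransition.le_one _
    have e3 : l2Sq (fun s => vη s - v s) ≤ ENNReal.ofReal (ε / 4) := by
      refine le_trans (le_of_eq ?_) hηε
      rw [l2Sq_eq, ← lintegral_indicator measurableSet_Ioi, ← lintegral_indicator measurableSet_Ioc]
      congr 1
      ext s
      by_cases h0 : 0 < s
      · by_cases h1 : s ≤ η
        · simp [hvη, h0, h1]
        · simp [hvη, h0, h1, not_le.1 h1]
      · simp [h0]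
    calc _ ≤ 2 * (ENNReal.ofReal (ε / 4) + ENNReal.ofReal (ε / 4)) :=
          e1.trans (by gcongr; exact e2.trans hg3')
      _ = ENNReal.ofReal ε := by
          rw [← ENNReal.ofReal_add (by positivity) (by positivity), ← ENNReal.ofReal_ofNat,
            ← ENNReal.ofReal_mul (by positivity)]
          congr 1
          ring

/-- A smooth function with compact support in `(0, ∞)` and mean zero is the derivative of a test
function. -/
lemma isTestOpen_prim {w : ℝ → ℂ} (hw : ContDiff ℝ ∞ w) {a b : ℝ} (ha : 0 < a)
    (h0 : ∀ s, s ∉ Icc a b → w s = 0) (hI : prim w b = 0) :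
    IsTestOpen (prim w) ∧ deriv (prim w) = w := by
  have hd : ∀ s, HasDerivAt (prim w) (w s) s := fun s =>
    intervalIntegral.integral_hasDerivAt_right (hw.continuous.intervalIntegrable _ _)
      hw.continuous.stronglyMeasurable.stronglyMeasurableAtFilter hw.continuous.continuousAt
  have hd' : deriv (prim w) = w := funext fun s => (hd s).deriv
  have hz : ∀ s, s ∉ Icc a b → prim w s = 0 := by
    intro s hs
    rw [mem_Icc, not_and_or, not_le, not_le] at hs
    rcases hs with hs | hs
    · refine intervalIntegral.integral_zero_ae (Eventually.of_forall fun x hx => h0 x fun h => ?_)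
      have := hx.2
      rcases le_max_iff.1 this with h' | h'
      · linarith [h.1]
      · linarith [h.1]
    · have h3 := intervalIntegral.integral_add_adjacent_intervals
        (hw.continuous.intervalIntegrable (μ := volume) 0 b) (hw.continuous.intervalIntegrable b s)
      have h4 : ∫ x in b..s, w x = 0 := by
        refine intervalIntegral.integral_zero_ae (Eventually.of_forall fun x hx => h0 x fun h => ?_)
        rw [uIoc_of_le hs.le] at hx
        exact absurd h.2 (not_le.2 hx.1)
      rw [prim, ← h3, h4, add_zero]
      exact hI
  have hsupp : tsupport (prim w) ⊆ Icc a b :=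
    closure_minimal (fun s hs => by_contra fun h => hs (hz s h)) isClosed_Icc
  refine ⟨⟨?_, HasCompactSupport.of_support_subset_isCompact isCompact_Icc
    ((subset_tsupport _).trans hsupp), fun s hs => ha.trans_le (hsupp hs).1⟩, hd'⟩
  rw [contDiff_infty_iff_deriv, hd']
  exact ⟨fun s => (hd s).differentiableAt, hw⟩

lemma exists_bump : ∃ b : ℝ → ℂ, ContDiff ℝ ∞ b ∧ (∀ s, s ∉ Icc (1 : ℝ) 3 → b s = 0) ∧
    ∫ s in (0 : ℝ)..3, b s = 1 := by
  let B : ContDiffBump (2 : ℝ) := ⟨1 / 2, 1, by norm_num, by norm_num⟩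
  refine ⟨fun s => (B.normed volume s : ℂ), Complex.ofRealCLM.contDiff.comp B.contDiff_normed,
    fun s hs => ?_, ?_⟩
  · have : s ∉ tsupport (B.normed volume) := by
      rw [B.tsupport_normed_eq, Real.closedBall_eq_Icc]
      convert hs using 3
      all_goals simp only [B]; norm_num
    simp [image_eq_zero_of_notMem_tsupport this]
  · rw [intervalIntegral.integral_ofReal, intervalIntegral.integral_of_le (by norm_num),
      setIntegral_eq_integral_of_forall_compl_eq_zero, B.integral_normed, Complex.ofReal_one]
    intro s hs
    have : s ∉ Function.support (B.normed volume) := by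
      rw [B.support_normed_eq, Real.ball_eq_Ioo]
      intro h
      simp only [B] at h
      exact hs ⟨by linarith [h.1], by linarith [h.2]⟩
    exact Function.notMem_support.1 this

/-- Derivatives of test functions on `(0, ∞)` are dense in `L²`. -/
lemma exists_isTestOpen_l2Sq_deriv_sub_le {v : ℝ → ℂ} (hv : Measurable v) (h2 : l2Sq v ≠ ⊤) {ε : ℝ}
    (hε : 0 < ε) : ∃ w : ℝ → ℂ, Measurable w ∧ l2Sq w ≠ ⊤ ∧ IsTestOpen (prim w) ∧
      deriv (prim w) = w ∧ l2Sq (fun s => w s - v s) ≤ ENNReal.ofReal ε := by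
  obtain ⟨w, hw, ⟨a, b, ha, hab, h0⟩, hwε⟩ :=
    exists_smooth_l2Sq_sub_le hv h2 (ε := ε / 4) (by positivity)
  obtain ⟨β, hβ, hβ0, hβ1⟩ := exists_bump
  set I := prim w b with hI
  have hβc : HasCompactSupport β := HasCompactSupport.of_support_subset_isCompact
    (isCompact_Icc (a := 1) (b := 3)) fun s hs => by_contra fun h => hs (hβ0 s h)
  have hβ2 := l2Sq_ne_top_of_continuous hβ.continuous hβc
  obtain ⟨R, hR, hRb, hRε⟩ : ∃ R : ℝ, 1 ≤ R ∧ b ≤ R ∧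
      ‖I‖ₑ ^ 2 * (ENNReal.ofReal R⁻¹ * l2Sq β) ≤ ENNReal.ofReal (ε / 4) := by
    have h3 : Tendsto (fun R : ℝ => ‖I‖ₑ ^ 2 * (ENNReal.ofReal R⁻¹ * l2Sq β)) atTop (𝓝 0) := by
      have h4 : Tendsto (fun R : ℝ => ENNReal.ofReal R⁻¹) atTop (𝓝 0) := by
        rw [← ENNReal.ofReal_zero]
        exact ENNReal.tendsto_ofReal tendsto_inv_atTop_zero
      have h5 := ENNReal.Tendsto.const_mul (a := ‖I‖ₑ ^ 2)
        (ENNReal.Tendsto.mul_const h4 (Or.inr hβ2)) (Or.inr (by simp))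
      simpa using h5
    obtain ⟨R, h1, h2, h3⟩ := ((eventually_ge_atTop 1).and ((eventually_ge_atTop b).and
      (h3.eventually (ge_mem_nhds (ENNReal.ofReal_pos.2 (by positivity : 0 < ε / 4)))))).exists
    exact ⟨R, h1, h2, h3⟩
  have hR0 : 0 < R := by linarith
  -- The mean I of w is cancelled by a bump of integral 1 spread over scale R; its squared L² norm
  -- is of order 1/R, so the correction costs little.
  set W : ℝ → ℂ := fun s => w s - I * ((R : ℂ)⁻¹ * β (s / R)) with hW
  have hWs : ContDiff ℝ ∞ W := by
    have : ContDiff ℝ ∞ fun s => β (s / R) := hβ.comp (by fun_prop)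
    exact hw.sub (contDiff_const.mul (contDiff_const.mul this))
  have hW0 : ∀ s, s ∉ Icc (min a R) (3 * R) → W s = 0 := by
    intro s hs
    have h3 : s ∉ Icc a b := fun h => hs ⟨(min_le_left _ _).trans h.1, by linarith [h.2]⟩
    have h4 : s / R ∉ Icc (1 : ℝ) 3 := fun h => hs
      ⟨(min_le_right _ _).trans (by have := (le_div_iff₀ hR0).1 h.1; linarith),
        by have := (div_le_iff₀ hR0).1 h.2; linarith⟩
    simp [hW, h0 s h3, hβ0 _ h4]
  have hWI : prim W (3 * R) = 0 := by
    have h3 : ∫ s in (0 : ℝ)..3 * R, w s = I := by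
      rw [hI, prim, ← intervalIntegral.integral_add_adjacent_intervals
        (hw.continuous.intervalIntegrable 0 b) (hw.continuous.intervalIntegrable b (3 * R))]
      refine add_eq_left.2 (intervalIntegral.integral_zero_ae
        (Eventually.of_forall fun x hx => h0 x fun h => ?_))
      rw [uIoc_of_le (by linarith)] at hx
      exact absurd h.2 (not_le.2 hx.1)
    have h4 : ∫ s in (0 : ℝ)..3 * R, β (s / R) = R := by
      have := intervalIntegral.integral_comp_div (a := 0) (b := 3 * R) β hR0.ne'
      rw [this, zero_div, mul_div_cancel_right₀ _ hR0.ne', hβ1]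
      simp
    have hβi : Continuous fun s => β (s / R) := hβ.continuous.comp (by fun_prop)
    rw [prim, hW, intervalIntegral.integral_sub (hw.continuous.intervalIntegrable _ _)
      (Continuous.intervalIntegrable (by fun_prop) _ _), intervalIntegral.integral_const_mul,
      intervalIntegral.integral_const_mul, h3, h4]
    have : (R : ℂ) ≠ 0 := by exact_mod_cast hR0.ne'
    field_simp
    ring
  obtain ⟨h3, h4⟩ := isTestOpen_prim hWs (lt_min ha hR0) hW0 hWI
  refine ⟨W, hWs.continuous.measurable, l2Sq_ne_top_of_continuous hWs.continuous ?_, h3, h4, ?_⟩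
  · exact HasCompactSupport.of_support_subset_isCompact
      (isCompact_Icc (a := min a R) (b := 3 * R)) fun s hs => by_contra fun h => hs (hW0 s h)
  · have e1 : l2Sq (fun s => W s - v s) ≤ 2 * (l2Sq (fun s => w s - v s) +
        l2Sq (fun s => I * ((R : ℂ)⁻¹ * β (s / R)))) := by
      refine le_trans (le_of_eq ?_) (l2Sq_sub_le ?_)
      · congr 1
        ext s
        simp only [hW]
        ring
      · exact (hw.continuous.measurable.sub hv).aestronglyMeasurable
    have e2 : l2Sq (fun s => I * ((R : ℂ)⁻¹ * β (s / R))) ≤ ENNReal.ofReal (ε / 4) := by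
      rw [l2Sq_const_mul, l2Sq_const_mul, l2Sq_comp_div β hR0]
      refine le_of_eq_of_le ?_ hRε
      rw [← mul_assoc (‖(R : ℂ)⁻¹‖ₑ ^ 2)]
      congr 2
      rw [← ofReal_norm, norm_inv, Complex.norm_real, Real.norm_of_nonneg hR0.le,
        ← ENNReal.ofReal_pow (by positivity), ← ENNReal.ofReal_mul (by positivity)]
      congr 1
      field_simp
    calc _ ≤ 2 * (ENNReal.ofReal (ε / 4) + ENNReal.ofReal (ε / 4)) :=
          e1.trans (by gcongr)
      _ = ENNReal.ofReal ε := by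
          rw [← ENNReal.ofReal_add (by positivity) (by positivity), ← ENNReal.ofReal_ofNat,
            ← ENNReal.ofReal_mul (by positivity)]
          congr 1
          ring

lemma intervalIntegrable_of_l2Sq {v : ℝ → ℂ} (hv : AEStronglyMeasurable v halfLine)
    (h2 : l2Sq v ≠ ⊤) {s : ℝ} (hs : 0 ≤ s) : IntervalIntegrable v volume 0 s := by
  rw [intervalIntegrable_iff_integrableOn_Ioc_of_le hs]
  exact integrableOn_Ioc_of_l2Sq hv h2 s

lemma prim_sub {v w : ℝ → ℂ} (hv : AEStronglyMeasurable v halfLine)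
    (hv2 : l2Sq v ≠ ⊤) (hw : AEStronglyMeasurable w halfLine) (hw2 : l2Sq w ≠ ⊤) {s : ℝ}
    (hs : 0 ≤ s) : prim (fun x => v x - w x) s = prim v s - prim w s :=
  intervalIntegral.integral_sub (intervalIntegrable_of_l2Sq hv hv2 hs)
    (intervalIntegrable_of_l2Sq hw hw2 hs)

lemma prim_const_mul (c : ℂ) (v : ℝ → ℂ) (s : ℝ) : prim (fun x => c * v x) s = c * prim v s :=
  intervalIntegral.integral_const_mul _ _

/-- Derivatives of test functions approximate v in L², and Hardy's inequality makes their primitives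
converge in the weighted norm. -/
lemma isWZeroWith_of_eq_prim {h v : ℝ → ℂ} (hv : Measurable v) (h2 : l2Sq v ≠ ⊤)
    (hh : ∀ s, 0 < s → h s = prim v s) : IsWZeroWith h v := by
  obtain ⟨C, hC⟩ := exists_hardy
  have hpm : AEStronglyMeasurable (prim v) halfLine :=
    ((continuousOn_prim hv.aestronglyMeasurable h2).mono Ioi_subset_Ici_self).aestronglyMeasurable
      measurableSet_Ioi
  have hae : h =ᵐ[halfLine] prim v := by
    filter_upwards [ae_restrict_mem measurableSet_Ioi] with s hs using hh s hs
  refine ⟨hpm.congr hae.symm, hv.aestronglyMeasurable, ?_⟩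
  choose w hwm hw2 hwt hwd hwε using fun n : ℕ =>
    exists_isTestOpen_l2Sq_deriv_sub_le hv h2 (ε := 1 / ((n : ℝ) + 1)) (by positivity)
  refine ⟨fun n => prim (w n), hwt, ?_⟩
  have hlim : Tendsto (fun n : ℕ => ((C : ℝ≥0∞) + 1) * ENNReal.ofReal (1 / ((n : ℝ) + 1))) atTop
      (𝓝 0) := by
    have h3 : Tendsto (fun n : ℕ => ENNReal.ofReal (1 / ((n : ℝ) + 1))) atTop (𝓝 0) := by
      rw [← ENNReal.ofReal_zero]
      exact ENNReal.tendsto_ofReal tendsto_one_div_add_atTop_nhds_zero_nat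
    have h4 := ENNReal.Tendsto.const_mul (a := (C : ℝ≥0∞) + 1) h3 (Or.inr (by finiteness))
    simpa using h4
  refine tendsto_of_tendsto_of_tendsto_of_le_of_le tendsto_const_nhds hlim (fun _ => zero_le)
    fun n => ?_
  have e1 : l2Sq (fun s => (prim (w n) s - h s) / (s : ℂ)) =
      l2Sq (fun s => prim (fun x => w n x - v x) s / (s : ℂ)) := by
    refine l2Sq_congr ?_
    filter_upwards [ae_restrict_mem measurableSet_Ioi] with s hs
    rw [prim_sub (hwm n).aestronglyMeasurable (hw2 n) hv.aestronglyMeasurable h2 (le_of_lt hs),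
      hh s hs]
  rw [e1, hwd, add_mul, one_mul]
  gcongr
  · exact (hC _ ((hwm n).sub hv)).trans (by gcongr; exact hwε n)
  · exact hwε n

lemma exists_wZeroNormSq_le : ∃ C : ℝ≥0, ∀ h v : ℝ → ℂ, Measurable v → l2Sq v ≠ ⊤ →
    (∀ s, 0 < s → h s = prim v s) → MemWZero h ∧ wZeroNormSq h ≤ C * l2Sq v := by
  obtain ⟨C, hC⟩ := exists_hardy
  refine ⟨C + 1, fun h v hv h2 hh => ?_⟩
  have hw := isWZeroWith_of_eq_prim hv h2 hh
  refine ⟨⟨v, hw⟩, (iInf₂_le v hw).trans ?_⟩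
  have e1 : l2Sq (fun s => h s / (s : ℂ)) = l2Sq (fun s => prim v s / (s : ℂ)) := by
    refine l2Sq_congr ?_
    filter_upwards [ae_restrict_mem measurableSet_Ioi] with s hs
    rw [hh s hs]
  rw [e1, ENNReal.coe_add, ENNReal.coe_one, add_mul, one_mul]
  gcongr
  exact hC v hv

/-! ### The space `H¹` -/

lemma IsTestClosed.deriv_test {u : ℝ → ℂ} (hu : IsTestClosed u) :
    Continuous (deriv u) ∧ HasCompactSupport (deriv u) :=
  ⟨hu.1.continuous_deriv (by norm_num), hu.2.deriv⟩

lemma IsTestClosed.eq_add_prim {u : ℝ → ℂ} (hu : IsTestClosed u) (s : ℝ) :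
    u s = u 0 + prim (deriv u) s := by
  rw [prim, intervalIntegral.integral_deriv_eq_sub
    (fun x _ => (hu.1.differentiable (by norm_num)).differentiableAt)
    (hu.deriv_test.1.intervalIntegrable _ _)]
  ring

lemma tendsto_prim {w : ℕ → ℝ → ℂ} {v : ℝ → ℂ} (hv : AEStronglyMeasurable v halfLine)
    (hv2 : l2Sq v ≠ ⊤) (hw : ∀ n, AEStronglyMeasurable (w n) halfLine) (hw2 : ∀ n, l2Sq (w n) ≠ ⊤)
    (h : Tendsto (fun n => l2Sq (fun s => w n s - v s)) atTop (𝓝 0)) {s : ℝ} (hs : 0 ≤ s) :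
    Tendsto (fun n => prim (w n) s) atTop (𝓝 (prim v s)) := by
  rw [tendsto_iff_edist_tendsto_0]
  have h1 : Tendsto (fun n => ENNReal.ofReal s * l2Sq (fun s => w n s - v s)) atTop (𝓝 0) := by
    simpa using ENNReal.Tendsto.const_mul h (Or.inr (ENNReal.ofReal_ne_top (r := s)))
  have h2 : Tendsto (fun n => (ENNReal.ofReal s * l2Sq (fun s => w n s - v s)) ^ (1 / 2 : ℝ)) atTop
      (𝓝 0) := by
    simpa using h1.ennrpow_const (1 / 2)
  refine tendsto_of_tendsto_of_tendsto_of_le_of_le tendsto_const_nhds h2 (fun _ => zero_le)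
    fun n => ?_
  have h3 := enorm_prim_sq_le (v := fun x => w n x - v x) ((hw n).sub hv) hs
  rw [prim_sub (hw n) (hw2 n) hv hv2 hs] at h3
  rw [edist_eq_enorm_sub, one_div, ENNReal.le_rpow_inv_iff (by norm_num)]
  simpa using h3

lemma l2Sq_ne_top_of_tendsto {u : ℕ → ℝ → ℂ} {f : ℝ → ℂ}
    (hu : ∀ n, AEStronglyMeasurable (u n) halfLine) (hu2 : ∀ n, l2Sq (u n) ≠ ⊤)
    (h : Tendsto (fun n => l2Sq (fun s => u n s - f s)) atTop (𝓝 0)) : l2Sq f ≠ ⊤ := by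
  obtain ⟨n, hn⟩ := (h.eventually (gt_mem_nhds zero_lt_one)).exists
  have h1 := l2Sq_sub_le (f := u n) (g := fun s => u n s - f s) (hu n)
  simp only [sub_sub_cancel] at h1
  exact ne_top_of_le_ne_top (ENNReal.mul_ne_top (by simp)
    (ENNReal.add_ne_top.2 ⟨hu2 n, (hn.trans ENNReal.one_lt_top).ne⟩)) h1

/-- Each approximant is its value at 0 plus the primitive of its derivative. The primitives converge
pointwise, and the approximants converge almost everywhere along a subsequence, so their values at 0
converge along it to the constant. -/
lemma IsHOneWith.exists_prim {g v : ℝ → ℂ} (h : IsHOneWith g v) :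
    l2Sq g ≠ ⊤ ∧ l2Sq v ≠ ⊤ ∧ ∃ a : ℂ, ∀ᵐ s ∂halfLine, g s = a + prim v s := by
  obtain ⟨hg, hv, u, hu, hlim⟩ := h
  have hl1 : Tendsto (fun n => l2Sq (fun s => u n s - g s)) atTop (𝓝 0) :=
    tendsto_of_tendsto_of_tendsto_of_le_of_le tendsto_const_nhds hlim (fun _ => zero_le)
      fun n => le_self_add
  have hl2 : Tendsto (fun n => l2Sq (fun s => deriv (u n) s - v s)) atTop (𝓝 0) :=
    tendsto_of_tendsto_of_tendsto_of_le_of_le tendsto_const_nhds hlim (fun _ => zero_le)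
      fun n => le_add_self
  have hum : ∀ n, AEStronglyMeasurable (u n) halfLine := fun n =>
    (hu n).1.continuous.aestronglyMeasurable
  have hdm : ∀ n, AEStronglyMeasurable (deriv (u n)) halfLine := fun n =>
    (hu n).deriv_test.1.aestronglyMeasurable
  have hd2 : ∀ n, l2Sq (deriv (u n)) ≠ ⊤ := fun n =>
    l2Sq_ne_top_of_continuous (hu n).deriv_test.1 (hu n).deriv_test.2
  have hg2 := l2Sq_ne_top_of_tendsto hum
    (fun n => l2Sq_ne_top_of_continuous (hu n).1.continuous (hu n).2) hl1
  have hv2 := l2Sq_ne_top_of_tendsto hdm hd2 hl2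
  refine ⟨hg2, hv2, ?_⟩
  have hel : Tendsto (fun n => eLpNorm (u n - g) 2 halfLine) atTop (𝓝 0) := by
    have h1 := hl1.ennrpow_const (1 / 2 : ℝ)
    have h2 : ∀ n, l2Sq (fun s => u n s - g s) ^ (1 / 2 : ℝ) = eLpNorm (u n - g) 2 halfLine := by
      intro n
      rw [l2Sq_eq_eLpNorm, ← ENNReal.rpow_natCast, ← ENNReal.rpow_mul]
      norm_num
      rfl
    simp only [h2] at h1
    simpa using h1
  obtain ⟨ns, hns, hae⟩ := (tendstoInMeasure_of_tendsto_eLpNorm two_ne_zero hum hg hel).exists_seq_tendsto_ae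
  have hprim : ∀ s : ℝ, 0 ≤ s → Tendsto (fun i => prim (deriv (u (ns i))) s) atTop (𝓝 (prim v s)) :=
    fun s hs => (tendsto_prim hv hv2 hdm hd2 hl2 hs).comp hns.tendsto_atTop
  have hae2 : ∀ᵐ s ∂halfLine, Tendsto (fun i => u (ns i) 0) atTop (𝓝 (g s - prim v s)) := by
    filter_upwards [hae, ae_restrict_mem measurableSet_Ioi] with s hs h0
    refine (hs.sub (hprim s (le_of_lt h0))).congr fun i => ?_
    rw [(hu (ns i)).eq_add_prim s]
    ring
  have hne : (ae halfLine).NeBot := by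
    rw [ae_neBot, halfLine, Ne, Measure.restrict_eq_zero]
    simp
  obtain ⟨s₀, hs₀⟩ := hae2.exists
  refine ⟨g s₀ - prim v s₀, ?_⟩
  filter_upwards [hae2] with s hs
  rw [tendsto_nhds_unique hs₀ hs]
  ring

/-- Trace estimate: average a = g(s) - ∫₀ˢ v over s in (0, 1]. -/
lemma enorm_sq_le_of_eq_add_prim {g v : ℝ → ℂ} {a : ℂ} (hv : Measurable v)
    (h : ∀ᵐ s ∂halfLine, g s = a + prim v s) : ‖a‖ₑ ^ 2 ≤ 2 * (l2Sq g + l2Sq v) := by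
  have h1 : ∫⁻ _ in Ioc (0 : ℝ) 1, ‖a‖ₑ ^ 2 ≤ ∫⁻ s in Ioc (0 : ℝ) 1, 2 * (‖g s‖ₑ ^ 2 + l2Sq v) := by
    refine lintegral_mono_ae ?_
    have hle : volume.restrict (Ioc (0 : ℝ) 1) ≤ halfLine :=
      Measure.restrict_mono Ioc_subset_Ioi_self le_rfl
    filter_upwards [ae_mono hle h, ae_restrict_mem measurableSet_Ioc] with s hs hs1
    have h2 : a = g s + -prim v s := by rw [hs]; ring
    calc ‖a‖ₑ ^ 2 ≤ 2 * (‖g s‖ₑ ^ 2 + ‖-prim v s‖ₑ ^ 2) := by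
          conv_lhs => rw [h2]
          exact enorm_add_sq_le _ _
      _ ≤ 2 * (‖g s‖ₑ ^ 2 + l2Sq v) := by
          rw [enorm_neg]
          gcongr
          refine (enorm_prim_sq_le hv.aestronglyMeasurable hs1.1.le).trans ?_
          exact mul_le_of_le_one_left zero_le (by simpa using hs1.2)
  rw [lintegral_const, lintegral_const_mul' _ _ (by simp), lintegral_add_right _ measurable_const,
    lintegral_const] at h1
  simp only [Measure.restrict_apply_univ, Real.volume_Ioc, sub_zero, ENNReal.ofReal_one, mul_one] at h1
  refine h1.trans ?_
  gcongr
  exact lintegral_mono_set Ioc_subset_Ioi_self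

lemma prim_congr {v w : ℝ → ℂ} (h : v =ᵐ[halfLine] w) {s : ℝ} (hs : 0 ≤ s) : prim v s = prim w s := by
  rw [prim, prim, intervalIntegral.integral_of_le hs, intervalIntegral.integral_of_le hs]
  exact integral_congr_ae (ae_mono (Measure.restrict_mono Ioc_subset_Ioi_self le_rfl) h)

/-- A near-minimizer in the infimum defining the norm; allowing the factor 2 makes uniqueness of the
derivative unnecessary. -/
lemma MemHOne.exists_le {g : ℝ → ℂ} (h : MemHOne g) :
    ∃ v, IsHOneWith g v ∧ l2Sq g + l2Sq v ≤ 2 * hOneNorm g ^ 2 := by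
  set I := ⨅ (v : ℝ → ℂ) (_ : IsHOneWith g v), (l2Sq g + l2Sq v) with hI
  have hn : hOneNorm g ^ 2 = I := by
    rw [hOneNorm, ← ENNReal.rpow_natCast, ← ENNReal.rpow_mul]
    norm_num
    rfl
  rw [hn]
  obtain ⟨v₀, hv₀⟩ := h
  obtain ⟨hg2, hv2, -⟩ := hv₀.exists_prim
  have hle : I ≤ l2Sq g + l2Sq v₀ := iInf₂_le v₀ hv₀
  have hItop : I ≠ ⊤ := ne_top_of_le_ne_top (ENNReal.add_ne_top.2 ⟨hg2, hv2⟩) hle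
  -- When the infimum is 0 there is no room between I and 2I. Then g vanishes almost everywhere and
  -- the zero derivative serves.
  by_cases hI0 : I = 0
  · have hg0 : l2Sq g = 0 := by
      refine le_antisymm ?_ zero_le
      rw [← hI0]
      exact le_iInf₂ fun v _ => le_self_add
    have hz : l2Sq (fun _ => 0) = 0 := by simp [l2Sq]
    refine ⟨fun _ => 0, ⟨hv₀.1, aestronglyMeasurable_const, fun _ _ => 0,
      fun _ => ⟨contDiff_const, HasCompactSupport.zero⟩, ?_⟩, by rw [hg0, hz]; simp⟩
    have : l2Sq (fun s => 0 - g s) = 0 := by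
      rw [← hg0]
      simp [l2Sq]
    simp [-zero_sub, this, hz]
  · have hlt : I < 2 * I := by
      rw [two_mul]
      exact ENNReal.lt_add_right hItop hI0
    obtain ⟨v, hv⟩ := iInf_lt_iff.1 hlt
    obtain ⟨hv1, hv2⟩ := iInf_lt_iff.1 hv
    exact ⟨v, hv1, hv2.le⟩

lemma MemHOne.exists_prim {g : ℝ → ℂ} (h : MemHOne g) :
    ∃ (a : ℂ) (v : ℝ → ℂ), Measurable v ∧ l2Sq g ≠ ⊤ ∧ l2Sq v ≠ ⊤ ∧
      (∀ᵐ s ∂halfLine, g s = a + prim v s) ∧ l2Sq g + l2Sq v ≤ 2 * hOneNorm g ^ 2 := by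
  obtain ⟨v, hv, hle⟩ := h.exists_le
  obtain ⟨hg2, hv2, a, ha⟩ := hv.exists_prim
  have hae : v =ᵐ[halfLine] hv.2.1.mk v := hv.2.1.ae_eq_mk
  rw [l2Sq_congr hae] at hv2 hle
  refine ⟨a, hv.2.1.mk v, hv.2.1.stronglyMeasurable_mk.measurable, hg2, hv2, ?_, hle⟩
  filter_upwards [ha, ae_restrict_mem measurableSet_Ioi] with s hs h0
  rw [hs, prim_congr hae (le_of_lt h0)]

/-! ### The space `H^{1/2}` -/

lemma MemHHalf.l2Sq_ne_top {f : ℝ → ℂ} (h : MemHHalf f) : l2Sq f ≠ ⊤ := by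
  obtain ⟨-, u, hu, hlim⟩ := h
  refine l2Sq_ne_top_of_tendsto (u := u) (fun n => (hu n).1.continuous.aestronglyMeasurable)
    (fun n => l2Sq_ne_top_of_continuous (hu n).1.continuous (hu n).2) ?_
  exact tendsto_of_tendsto_of_tendsto_of_le_of_le tendsto_const_nhds hlim (fun _ => zero_le)
      fun n => le_self_add

/-- f differs by finite seminorm from a test function, which is Lipschitz and so has bounded
difference quotients on the unit square. -/
lemma MemHHalf.lintegral_ne_top {f : ℝ → ℂ} (h : MemHHalf f) :
    ∫⁻ s in Ioo (0 : ℝ) 1, ∫⁻ t in Ioo (0 : ℝ) 1,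
      ‖f s - f t‖ₑ ^ 2 / ENNReal.ofReal (|s - t| ^ 2) ≠ ⊤ := by
  obtain ⟨-, u, hu, hlim⟩ := h
  obtain ⟨n, hn⟩ := (hlim.eventually (gt_mem_nhds zero_lt_one)).exists
  have hgag : gagliardoSq (fun s => u n s - f s) ≠ ⊤ :=
    ((le_add_self.trans_lt hn).trans ENNReal.one_lt_top).ne
  obtain ⟨L, hL⟩ := (hu n).1.lipschitzWith_of_hasCompactSupport (hu n).2 (by norm_num)
  have hpt : ∀ s t, ‖f s - f t‖ₑ ^ 2 / ENNReal.ofReal (|s - t| ^ 2) ≤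
      2 * (‖(u n s - f s) - (u n t - f t)‖ₑ ^ 2 / ENNReal.ofReal (|s - t| ^ 2) + (L : ℝ≥0∞) ^ 2) := by
    intro s t
    have h1 : f s - f t = -((u n s - f s) - (u n t - f t)) + (u n s - u n t) := by ring
    have h2 : ‖u n s - u n t‖ₑ ^ 2 ≤ (L : ℝ≥0∞) ^ 2 * ENNReal.ofReal (|s - t| ^ 2) := by
      rw [ENNReal.ofReal_pow (abs_nonneg _), ← mul_pow, ← edist_eq_enorm_sub]
      refine pow_le_pow_left₀ zero_le ((hL s t).trans (le_of_eq ?_)) 2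
      rw [edist_dist, Real.dist_eq]
    calc _ ≤ 2 * (‖(u n s - f s) - (u n t - f t)‖ₑ ^ 2 + ‖u n s - u n t‖ₑ ^ 2) /
          ENNReal.ofReal (|s - t| ^ 2) := by
          rw [h1]
          gcongr
          refine (enorm_add_sq_le _ _).trans_eq ?_
          rw [enorm_neg]
      _ = 2 * (‖(u n s - f s) - (u n t - f t)‖ₑ ^ 2 / ENNReal.ofReal (|s - t| ^ 2) +
          ‖u n s - u n t‖ₑ ^ 2 / ENNReal.ofReal (|s - t| ^ 2)) := by
          rw [mul_div_assoc, ENNReal.add_div]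
      _ ≤ _ := by
          gcongr
          exact ENNReal.div_le_of_le_mul h2
  have hle : volume.restrict (Ioo (0 : ℝ) 1) ≤ halfLine :=
      Measure.restrict_mono Ioo_subset_Ioi_self le_rfl
  have hin : ∀ s, ∫⁻ t in Ioo (0 : ℝ) 1, ‖f s - f t‖ₑ ^ 2 / ENNReal.ofReal (|s - t| ^ 2) ≤
      2 * ((∫⁻ t, ‖(u n s - f s) - (u n t - f t)‖ₑ ^ 2 / ENNReal.ofReal (|s - t| ^ 2) ∂halfLine) +
        (L : ℝ≥0∞) ^ 2) := by
    intro s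
    refine (lintegral_mono (hpt s)).trans ?_
    rw [lintegral_const_mul' _ _ (by simp), lintegral_add_right _ measurable_const, lintegral_const]
    simp only [Measure.restrict_apply_univ, Real.volume_Ioo, sub_zero, ENNReal.ofReal_one, mul_one]
    gcongr
  refine ne_top_of_le_ne_top ?_ (lintegral_mono hin)
  rw [lintegral_const_mul' _ _ (by simp), lintegral_add_right _ measurable_const, lintegral_const]
  simp only [Measure.restrict_apply_univ, Real.volume_Ioo, sub_zero, ENNReal.ofReal_one, mul_one]
  refine ENNReal.mul_ne_top (by simp) (ENNReal.add_ne_top.2 ⟨?_, by simp⟩)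
  exact ne_top_of_le_ne_top hgag (lintegral_mono' hle le_rfl)

/-- A function of `H^{1/2}` has no power singularity at the origin. -/
lemma MemHHalf.eq_zero_of_singular {f : ℝ → ℂ} (hf : MemHHalf f) {z β : ℂ} {M : ℝ} (hz : 0 < z.re)
    (h : ∀ᵐ s ∂halfLine, s < 1 → ‖f s - β * (s : ℂ) ^ (-z)‖ ≤ M) : β = 0 := by
  by_contra hβ
  have hβ' : 0 < ‖β‖ := norm_pos_iff.2 hβ
  -- For t ≥ 2s the moduli of s^(-z) and t^(-z) differ by at least q s^(-Re z), whatever the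
  -- oscillation. Near 0 this outweighs the bounded error 2M.
  set q : ℝ := 1 - (2 : ℝ) ^ (-z.re) with hq
  have hq0 : 0 < q := by
    have : (2 : ℝ) ^ (-z.re) < 1 := Real.rpow_lt_one_of_one_lt_of_neg (by norm_num) (by linarith)
    linarith
  have hM : 0 ≤ M := by
    have hne : (ae halfLine).NeBot := by
      rw [ae_neBot, halfLine, Ne, Measure.restrict_eq_zero]
      simp
    have hle : volume.restrict (Ioo (0 : ℝ) 1) ≤ halfLine :=
      Measure.restrict_mono Ioo_subset_Ioi_self le_rfl
    have hne' : (ae (volume.restrict (Ioo (0 : ℝ) 1))).NeBot := by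
      rw [ae_neBot, Ne, Measure.restrict_eq_zero]
      simp
    have h' : ∀ᵐ s ∂(volume.restrict (Ioo (0 : ℝ) 1)), s < 1 → ‖f s - β * (s : ℂ) ^ (-z)‖ ≤ M :=
      ae_mono hle h
    obtain ⟨s, hs, hs1⟩ := (h'.and (ae_restrict_mem measurableSet_Ioo)).exists
    exact (norm_nonneg _).trans (hs hs1.2)
  obtain ⟨s₀, hs₀, hs₀1, hbig⟩ : ∃ s₀ : ℝ, 0 < s₀ ∧ s₀ ≤ 1 / 4 ∧
      ∀ s, 0 < s → s < s₀ → 2 * M + 1 ≤ ‖β‖ * (s ^ (-z.re) * q) := by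
    have h1 : Tendsto (fun s : ℝ => ‖β‖ * (s ^ (-z.re) * q)) (𝓝[>] 0) atTop := by
      have := tendsto_rpow_neg_nhdsGT_zero (y := -z.re) (by linarith)
      exact (this.atTop_mul_const hq0).const_mul_atTop hβ'
    obtain ⟨s₁, hs₁, h2⟩ := mem_nhdsGT_iff_exists_Ioo_subset.1 (h1.eventually_ge_atTop (2 * M + 1))
    refine ⟨min s₁ (1 / 4), lt_min hs₁ (by norm_num), min_le_right _ _, fun s h3 h4 =>
      h2 ⟨h3, h4.trans_le (min_le_left _ _)⟩⟩
  refine hf.lintegral_ne_top (top_le_iff.1 ?_)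
  rw [ae_halfLine_iff] at h
  -- For t in (2s, 3s) the increment of f is at least 1 and |s - t| ≤ 2s; an interval of length s
  -- thus contributes s/(2s)², which is not integrable at 0.
  have hinner : ∀ᵐ s ∂(volume.restrict (Ioo (0 : ℝ) s₀)), ENNReal.ofReal (1 / 4 * s⁻¹) ≤
      ∫⁻ t in Ioo (0 : ℝ) 1, ‖f s - f t‖ₑ ^ 2 / ENNReal.ofReal (|s - t| ^ 2) := by
    filter_upwards [ae_restrict_of_ae h, ae_restrict_mem measurableSet_Ioo] with s hs hs1
    have hs0 : 0 < s := hs1.1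
    have hs2 : s < 1 / 4 := hs1.2.trans_le hs₀1
    calc ENNReal.ofReal (1 / 4 * s⁻¹)
        = ∫⁻ _ in Ioo (2 * s) (3 * s), ENNReal.ofReal (1 / (2 * s) ^ 2) := by
          rw [lintegral_const, Measure.restrict_apply_univ, Real.volume_Ioo,
            ← ENNReal.ofReal_mul (by positivity)]
          congr 1
          field_simp
          ring
      _ ≤ ∫⁻ t in Ioo (2 * s) (3 * s), ‖f s - f t‖ₑ ^ 2 / ENNReal.ofReal (|s - t| ^ 2) := by
          refine lintegral_mono_ae ?_
          filter_upwards [ae_restrict_of_ae h, ae_restrict_mem measurableSet_Ioo] with t ht ht1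
          have ht0 : 0 < t := by linarith [ht1.1]
          have hs3 := hs hs0 (by linarith)
          have ht3 := ht ht0 (by linarith [ht1.2])
          have hnorm : 1 ≤ ‖f s - f t‖ := by
            have e1 : ‖β‖ * (s ^ (-z.re) * q) ≤ ‖β * (s : ℂ) ^ (-z) - β * (t : ℂ) ^ (-z)‖ := by
              rw [← mul_sub, norm_mul]
              refine mul_le_mul_of_nonneg_left ?_ (norm_nonneg _)
              refine le_trans ?_ (norm_sub_norm_le _ _)
              rw [Complex.norm_cpow_eq_rpow_re_of_pos hs0, Complex.norm_cpow_eq_rpow_re_of_pos ht0,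
                Complex.neg_re, hq, mul_sub, mul_one, ← Real.mul_rpow hs0.le (by norm_num)]
              have := Real.rpow_le_rpow_of_nonpos (x := s * 2) (y := t) (z := -z.re) (by linarith)
                (by linarith [ht1.1]) (by linarith)
              linarith
            have e2 := hbig s hs0 hs1.2
            have e3 : β * (s : ℂ) ^ (-z) - β * (t : ℂ) ^ (-z) =
                (f s - f t) - (f s - β * (s : ℂ) ^ (-z)) + (f t - β * (t : ℂ) ^ (-z)) := by ring
            have e4 := norm_add_le ((f s - f t) - (f s - β * (s : ℂ) ^ (-z)))
              (f t - β * (t : ℂ) ^ (-z))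
            have e5 := norm_sub_le (f s - f t) (f s - β * (s : ℂ) ^ (-z))
            rw [← e3] at e4
            linarith
          have hst : |s - t| ≤ 2 * s := by
            rw [abs_sub_comm, abs_of_nonneg (by linarith [ht1.1])]
            linarith [ht1.2]
          have hst0 : 0 < |s - t| := abs_pos.2 (by linarith [ht1.1])
          rw [← ofReal_norm, ← ENNReal.ofReal_pow (norm_nonneg _),
            ← ENNReal.ofReal_div_of_pos (by positivity)]
          refine ENNReal.ofReal_le_ofReal ?_
          have : (1 : ℝ) ≤ ‖f s - f t‖ ^ 2 := one_le_pow₀ hnorm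
          gcongr
      _ ≤ _ := lintegral_mono_set (Ioo_subset_Ioo (by linarith) (by linarith))
  calc (⊤ : ℝ≥0∞) = ∫⁻ s in Ioo (0 : ℝ) s₀, ENNReal.ofReal (1 / 4 * s⁻¹) := by
        symm
        by_contra hfin
        have h1 : IntegrableOn (fun s : ℝ => 1 / 4 * s⁻¹) (Ioo 0 s₀) := by
          refine ⟨(measurable_const.mul measurable_inv).aestronglyMeasurable, ?_⟩
          rw [hasFiniteIntegral_iff_ofReal]
          · exact lt_top_iff_ne_top.2 hfin
          · filter_upwards [ae_restrict_mem measurableSet_Ioo] with s hs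
            have := hs.1
            simp only [Pi.zero_apply]
            positivity
        have h2 : IntegrableOn (fun s : ℝ => s⁻¹) (Ioo 0 s₀) := by
          have := h1.const_mul 4
          refine this.congr (Eventually.of_forall fun s => ?_)
          simp only
          ring
        have h3 := (intervalIntegrable_iff_integrableOn_Ioo_of_le hs₀.le).2 h2
        rw [intervalIntegrable_inv_iff] at h3
        rcases h3 with h3 | h3
        · exact hs₀.ne h3
        · exact h3 left_mem_uIcc
    _ ≤ ∫⁻ s in Ioo (0 : ℝ) s₀, ∫⁻ t in Ioo (0 : ℝ) 1,
          ‖f s - f t‖ₑ ^ 2 / ENNReal.ofReal (|s - t| ^ 2) := lintegral_mono_ae hinner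
    _ ≤ _ := lintegral_mono_set (Ioo_subset_Ioo le_rfl (by linarith))

/-! ### The cut-off function -/

namespace IsCutoff

variable {φ : ℝ → ℝ}

lemma nonneg (hφ : IsCutoff φ) {s : ℝ} (hs : 0 ≤ s) : 0 ≤ φ s := by
  obtain ⟨r, hr, h⟩ := hφ.eq_zero
  rw [← h (max r s) (hs.trans (le_max_right _ _)) (le_max_left _ _)]
  exact hφ.antitone hs (hs.trans (le_max_right r s)) (le_max_right _ _)

lemma le_one (hφ : IsCutoff φ) {s : ℝ} (hs : 0 ≤ s) : φ s ≤ 1 := by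
  obtain ⟨δ, hδ, h⟩ := hφ.eq_one
  rw [← h 0 ⟨le_rfl, hδ.le⟩]
  exact hφ.antitone (mem_Ici.2 le_rfl) hs hs

lemma hasDerivAt (hφ : IsCutoff φ) {s : ℝ} (hs : 0 < s) : HasDerivAt φ (deriv φ s) s :=
  ((hφ.smooth.differentiableOn (by norm_num) s hs.le).differentiableAt
    (Ici_mem_nhds hs)).hasDerivAt

lemma continuousOn_deriv (hφ : IsCutoff φ) : ContinuousOn (deriv φ) (Ioi 0) :=
  (hφ.smooth.mono Ioi_subset_Ici_self).continuousOn_deriv_of_isOpen isOpen_Ioi (by norm_num)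

/-- The function vanishes near 0 and its derivative is O(s^(Re z - 1)), square integrable at
infinity because Re z < 1/2. So s^z and φ s^z differ by an element of W¹₀. -/
lemma exists_prim_one_sub_mul_cpow (hφ : IsCutoff φ) {z : ℂ} (hz : z.re < 1 / 2) :
    ∃ q : ℝ → ℂ, Measurable q ∧ l2Sq q ≠ ⊤ ∧
      ∀ s : ℝ, 0 < s → (1 - (φ s : ℂ)) * (s : ℂ) ^ z = prim q s := by
  obtain ⟨δ, hδ, h1⟩ := hφ.eq_one
  obtain ⟨r, hr, h0⟩ := hφ.eq_zero
  set q : ℝ → ℂ := indicator (Ioi 0) fun s =>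
    -((deriv φ s : ℝ) : ℂ) * (s : ℂ) ^ z + (1 - (φ s : ℂ)) * (z * (s : ℂ) ^ (z - 1)) with hq
  -- Nothing is known of φ on the negative axis; extending by 0 gives a function vanishing on a full
  -- neighbourhood of 0, hence continuous there.
  set F : ℝ → ℂ := fun s => if s ≤ 0 then 0 else (1 - (φ s : ℂ)) * (s : ℂ) ^ z with hF
  have hFz : ∀ s, s ≤ δ → F s = 0 := by
    intro s hs
    by_cases hs0 : s ≤ 0
    · simp [hF, hs0]
    · simp [hF, hs0, h1 s ⟨(not_le.1 hs0).le, hs⟩]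
  have hFd : ∀ s, 0 < s → HasDerivAt F (q s) s := by
    intro s hs
    have e1 : HasDerivAt (fun x : ℝ => (1 - (φ x : ℂ)) * (x : ℂ) ^ z)
        (-((deriv φ s : ℝ) : ℂ) * (s : ℂ) ^ z + (1 - (φ s : ℂ)) * (z * (s : ℂ) ^ (z - 1))) s := by
      have e2 : HasDerivAt (fun x : ℝ => 1 - (φ x : ℂ)) (-((deriv φ s : ℝ) : ℂ)) s :=
        (hφ.hasDerivAt hs).ofReal_comp.const_sub 1
      have e3 : HasDerivAt (fun x : ℝ => (x : ℂ) ^ z) (z * (s : ℂ) ^ (z - 1)) s := by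
        have := (hasDerivAt_id (s : ℂ)).cpow_const (c := z) (Or.inl (by simpa using hs))
        simpa using this.comp_ofReal
      exact e2.mul e3
    have e4 : q s = -((deriv φ s : ℝ) : ℂ) * (s : ℂ) ^ z + (1 - (φ s : ℂ)) * (z * (s : ℂ) ^ (z - 1)) :=
      indicator_of_mem (mem_Ioi.2 hs) _
    rw [e4]
    refine e1.congr_of_eventuallyEq ?_
    filter_upwards [lt_mem_nhds hs] with x hx
    simp [hF, not_le.2 hx]
  have hqm : Measurable q := by
    have hc : ContinuousOn (fun s : ℝ => -((deriv φ s : ℝ) : ℂ) * (s : ℂ) ^ z +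
        (1 - (φ s : ℂ)) * (z * (s : ℂ) ^ (z - 1))) (Ioi 0) := by
      have c1 : ∀ p : ℂ, ContinuousOn (fun s : ℝ => (s : ℂ) ^ p) (Ioi 0) := fun p s hs =>
        (Complex.continuousAt_ofReal_cpow_const _ _ (Or.inr (ne_of_gt hs))).continuousWithinAt
      have c2 : ContinuousOn (fun s => (φ s : ℂ)) (Ioi 0) :=
        Complex.continuous_ofReal.comp_continuousOn
          (hφ.smooth.continuousOn.mono Ioi_subset_Ici_self)
      have c3 : ContinuousOn (fun s => ((deriv φ s : ℝ) : ℂ)) (Ioi 0) :=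
        Complex.continuous_ofReal.comp_continuousOn hφ.continuousOn_deriv
      exact (c3.neg.mul (c1 z)).add ((continuousOn_const.sub c2).mul (continuousOn_const.mul (c1 _)))
    rw [hq, ← piecewise_eq_indicator]
    exact hc.measurable_piecewise continuousOn_const measurableSet_Ioi
  have hq0 : ∀ s, s < δ → q s = 0 := by
    intro s hs
    by_cases hs0 : 0 < s
    · refine (hFd s hs0).unique ((hasDerivAt_const s 0).congr_of_eventuallyEq ?_)
      filter_upwards [gt_mem_nhds hs] with x hx using hFz x hx.le
    · exact indicator_of_notMem (fun h => hs0 h) _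
  obtain ⟨M, hM0, hM⟩ : ∃ M : ℝ, 0 ≤ M ∧ ∀ s, δ ≤ s → |deriv φ s| * s ≤ M := by
    obtain ⟨M, hM⟩ := (isCompact_Icc (a := δ) (b := 1)).exists_bound_of_continuousOn
      (f := fun s => deriv φ s * s)
      ((hφ.continuousOn_deriv.mono fun s hs => hδ.trans_le hs.1).mul continuousOn_id)
    refine ⟨max M 0, le_max_right _ _, fun s hs => ?_⟩
    by_cases hs1 : s ≤ 1
    · have := hM s ⟨hs, hs1⟩
      rw [norm_mul, Real.norm_eq_abs, Real.norm_of_nonneg (by linarith)] at this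
      exact this.trans (le_max_left _ _)
    · have : deriv φ s = 0 := by
        have hev : φ =ᶠ[𝓝 s] fun _ => 0 := by
          filter_upwards [lt_mem_nhds (not_le.1 hs1)] with x hx
          exact h0 x (by linarith) (by linarith)
        rw [hev.deriv_eq, deriv_const]
      rw [this, abs_zero, zero_mul]
      exact le_max_right _ _
  have hqb : ∀ s, δ ≤ s → ‖q s‖ ≤ (M + ‖z‖) * s ^ (z.re - 1) := by
    intro s hs
    have hs0 : 0 < s := by linarith
    rw [hq, indicator_of_mem (mem_Ioi.2 hs0), add_mul]
    refine (norm_add_le _ _).trans (add_le_add ?_ ?_)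
    · rw [norm_mul, norm_neg, Complex.norm_real, Complex.norm_cpow_eq_rpow_re_of_pos hs0,
        Real.norm_eq_abs]
      have : s ^ z.re = s * s ^ (z.re - 1) := by
        rw [Real.rpow_sub_one hs0.ne']
        field_simp
      rw [this, ← mul_assoc]
      exact mul_le_mul_of_nonneg_right (hM s hs) (by positivity)
    · rw [norm_mul, norm_mul, Complex.norm_cpow_eq_rpow_re_of_pos hs0, Complex.sub_re,
        Complex.one_re]
      refine mul_le_of_le_one_left (by positivity) ?_
      rw [← Complex.ofReal_one, ← Complex.ofReal_sub, Complex.norm_real,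
        Real.norm_of_nonneg (by linarith [hφ.le_one hs0.le])]
      linarith [hφ.nonneg hs0.le]
  have hq2 : l2Sq q ≠ ⊤ := by
    have hint : IntegrableOn (fun s : ℝ => (M + ‖z‖) ^ 2 * s ^ (2 * z.re - 2)) (Ioi (δ / 2)) :=
      (integrableOn_Ioi_rpow_of_lt (by linarith) (by positivity)).const_mul _
    have hfin : ∫⁻ s in Ioi (δ / 2), ENNReal.ofReal ((M + ‖z‖) ^ 2 * s ^ (2 * z.re - 2)) ≠ ⊤ := by
      have := hint.lintegral_lt_top
      exact this.ne
    refine ne_top_of_le_ne_top hfin ?_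
    rw [l2Sq_eq, ← lintegral_indicator measurableSet_Ioi, ← lintegral_indicator measurableSet_Ioi]
    refine lintegral_mono fun s => ?_
    by_cases hs : δ ≤ s
    · have hs0 : 0 < s := by linarith
      have hs1 : s ∈ Ioi (δ / 2) := by simp only [mem_Ioi]; linarith
      rw [indicator_of_mem (mem_Ioi.2 hs0), indicator_of_mem hs1, ← ofReal_norm,
        ← ENNReal.ofReal_pow (norm_nonneg _)]
      refine ENNReal.ofReal_le_ofReal ((pow_le_pow_left₀ (norm_nonneg _) (hqb s hs) 2).trans_eq ?_)
      rw [mul_pow, ← Real.rpow_natCast (s ^ _), ← Real.rpow_mul hs0.le]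
      congr 2
      push_cast
      ring
    · have : q s = 0 := hq0 s (not_le.1 hs)
      refine le_trans (le_of_eq ?_) zero_le
      by_cases h3 : s ∈ Ioi (0 : ℝ) <;> simp [this, h3]
  refine ⟨q, hqm, hq2, fun s hs => ?_⟩
  have hint := intervalIntegrable_of_l2Sq hqm.aestronglyMeasurable hq2 hs.le
  have hcont : ContinuousOn F (Icc 0 s) := by
    intro x hx
    by_cases hx0 : 0 < x
    · exact (hFd x hx0).continuousAt.continuousWithinAt
    · have hev : F =ᶠ[𝓝 x] fun _ => 0 := by
        filter_upwards [gt_mem_nhds (show x < δ by linarith)] with y hy using hFz y hy.le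
      exact (continuousAt_const.congr hev.symm).continuousWithinAt
  have hftc := intervalIntegral.integral_eq_sub_of_hasDerivAt_of_le hs.le hcont
    (fun x hx => hFd x hx.1) hint
  rw [prim, hftc, hFz 0 hδ.le, sub_zero]
  simp [hF, not_le.2 hs]

lemma exists_eq_one_add_prim (hφ : IsCutoff φ) :
    ∃ p : ℝ → ℂ, Measurable p ∧ l2Sq p ≠ ⊤ ∧ ∀ s : ℝ, 0 < s → (φ s : ℂ) = 1 + prim p s := by
  obtain ⟨q, hq, hq2, h⟩ := hφ.exists_prim_one_sub_mul_cpow (z := 0) (by norm_num)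
  refine ⟨fun s => -1 * q s, hq.const_mul _, ?_, fun s hs => ?_⟩
  · rw [l2Sq_const_mul]
    exact ENNReal.mul_ne_top (by simp) hq2
  · rw [prim_const_mul, ← h s hs, Complex.cpow_zero]
    ring

end IsCutoff

/-! ### Mellin transforms on the line of homogeneous solutions -/

lemma sq_lintegral_mul_le {ι : Type*} [MeasurableSpace ι] {μ : Measure ι} {k g : ι → ℝ≥0∞}
    (hk : AEMeasurable k μ) (hg : AEMeasurable g μ) :
    (∫⁻ t, k t * g t ∂μ) ^ 2 ≤ (∫⁻ t, k t ^ 2 ∂μ) * ∫⁻ t, g t ^ 2 ∂μ := by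
  have h := ENNReal.lintegral_mul_le_Lp_mul_Lq μ (p := 2) (q := 2)
    Real.HolderConjugate.two_two hk hg
  simp only [Pi.mul_apply, ENNReal.rpow_two] at h
  refine (pow_le_pow_left₀ zero_le h 2).trans_eq ?_
  rw [mul_pow, ← ENNReal.rpow_natCast, ← ENNReal.rpow_natCast, ← ENNReal.rpow_mul,
    ← ENNReal.rpow_mul]
  norm_num

lemma lintegral_rpow_div_sq_ne_top {y : ℝ} (hy : |y| < 1 / 2) :
    ∫⁻ t in Ioi (0 : ℝ), ENNReal.ofReal (t ^ y / (1 + t)) ^ 2 ≠ ⊤ := by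
  obtain ⟨hy1, hy2⟩ := abs_lt.1 hy
  rw [← Ioc_union_Ioi_eq_Ioi zero_le_one]
  refine ne_top_of_le_ne_top ?_ (lintegral_union_le _ _ _)
  have hb : ∀ t : ℝ, 0 < t → t ^ y / (1 + t) ≤ t ^ y ∧ t ^ y / (1 + t) ≤ t ^ (y - 1) := by
    intro t ht
    have := Real.rpow_pos_of_pos ht y
    constructor
    · rw [div_le_iff₀ (by linarith)]
      nlinarith
    · rw [Real.rpow_sub_one ht.ne']
      gcongr
      linarith
  refine ENNReal.add_ne_top.2 ⟨?_, ?_⟩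
  · have h1 : IntegrableOn (fun t : ℝ => t ^ (y * 2)) (Ioc 0 1) :=
      (intervalIntegral.intervalIntegrable_rpow' (by linarith)).1
    refine ne_top_of_le_ne_top h1.lintegral_lt_top.ne
      (setLIntegral_mono' measurableSet_Ioc fun t ht => ?_)
    have h0 : (0 : ℝ) < t := ht.1
    rw [← ENNReal.ofReal_pow (by positivity), Real.rpow_mul h0.le, Real.rpow_two]
    exact ENNReal.ofReal_le_ofReal (pow_le_pow_left₀ (by positivity) (hb t h0).1 2)
  · have h1 : IntegrableOn (fun t : ℝ => t ^ ((y - 1) * 2)) (Ioi 1) :=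
      integrableOn_Ioi_rpow_of_lt (by linarith) one_pos
    refine ne_top_of_le_ne_top h1.lintegral_lt_top.ne
      (setLIntegral_mono' measurableSet_Ioi fun t ht => ?_)
    have h0 : (0 : ℝ) < t := one_pos.trans ht
    rw [← ENNReal.ofReal_pow (by positivity), Real.rpow_mul h0.le, Real.rpow_two]
    exact ENNReal.ofReal_le_ofReal (pow_le_pow_left₀ (by positivity) (hb t h0).2 2)

/-- The integrand has modulus t^(Re p)/(1 + t) times |G| + |G|/t, and the first factor is square
integrable exactly because |Re p| < 1/2: Cauchy–Schwarz. -/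
lemma exists_lintegral_cpow_mul_sq_le {p : ℂ} (hp : |p.re| < 1 / 2) :
    ∃ C : ℝ≥0, ∀ G : ℝ → ℂ, AEStronglyMeasurable G halfLine →
      (∫⁻ t in Ioi (0 : ℝ), ‖(t : ℂ) ^ (p - 1) * G t‖ₑ) ^ 2 ≤
        C * (l2Sq G + l2Sq (fun t => G t / (t : ℂ))) := by
  have hfin := lintegral_rpow_div_sq_ne_top hp
  refine ⟨((∫⁻ t in Ioi (0 : ℝ), ENNReal.ofReal (t ^ p.re / (1 + t)) ^ 2) * 2).toNNReal,
    fun G hG => ?_⟩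
  rw [ENNReal.coe_toNNReal (ENNReal.mul_ne_top hfin (by simp))]
  have hGt : AEStronglyMeasurable (fun t : ℝ => G t / (t : ℂ)) halfLine :=
    (hG.aemeasurable.div Complex.measurable_ofReal.aemeasurable).aestronglyMeasurable
  have hpt : ∀ t ∈ Ioi (0 : ℝ), ‖(t : ℂ) ^ (p - 1) * G t‖ₑ =
      ENNReal.ofReal (t ^ p.re / (1 + t)) * (‖G t‖ₑ + ‖G t / (t : ℂ)‖ₑ) := by
    intro t ht
    have ht' : (0 : ℝ) < t := ht
    rw [← ofReal_norm, ← ofReal_norm, ← ofReal_norm, ← ENNReal.ofReal_add (norm_nonneg _)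
      (norm_nonneg _), ← ENNReal.ofReal_mul (by positivity), norm_mul,
      Complex.norm_cpow_eq_rpow_re_of_pos ht', Complex.sub_re, Complex.one_re,
      Real.rpow_sub_one ht'.ne', norm_div, Complex.norm_real, Real.norm_of_nonneg ht'.le]
    congr 1
    field_simp
    ring
  rw [setLIntegral_congr_fun measurableSet_Ioi hpt]
  have hm : Measurable fun t : ℝ => ENNReal.ofReal (t ^ p.re / (1 + t)) := by fun_prop
  refine (sq_lintegral_mul_le hm.aemeasurable (hG.enorm.add hGt.enorm)).trans ?_
  rw [mul_assoc]
  refine mul_le_mul_right ?_ _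
  calc ∫⁻ t in Ioi (0 : ℝ), (‖G t‖ₑ + ‖G t / (t : ℂ)‖ₑ) ^ 2
      ≤ ∫⁻ t in Ioi (0 : ℝ), 2 * (‖G t‖ₑ ^ 2 + ‖G t / (t : ℂ)‖ₑ ^ 2) :=
        lintegral_mono fun t => add_sq_le_two_mul _ _
    _ = _ := by
        have hG' : AEMeasurable (fun t => ‖G t‖ₑ ^ 2) (volume.restrict (Ioi 0)) :=
          hG.enorm.pow_const 2
        rw [lintegral_const_mul' _ _ (by simp), lintegral_add_left' hG']
        rfl

lemma integral_cpow_comp_mul {p : ℂ} {G : ℝ → ℂ}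
    (hi : IntegrableOn (fun t : ℝ => (t : ℂ) ^ (p - 1) * G t) (Ioi 0)) {s : ℝ} (hs : 0 < s) :
    IntegrableOn (fun τ : ℝ => (τ : ℂ) ^ (p - 1) * G (τ * s)) (Ioi 0) ∧
      ∫ τ in Ioi (0 : ℝ), (τ : ℂ) ^ (p - 1) * G (τ * s) =
        (s : ℂ) ^ (-p) * ∫ t in Ioi (0 : ℝ), (t : ℂ) ^ (p - 1) * G t := by
  have hsne : (s : ℂ) ≠ 0 := by exact_mod_cast hs.ne'
  have e : ∀ τ ∈ Ioi (0 : ℝ), (τ : ℂ) ^ (p - 1) * G (τ * s) =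
      (s : ℂ) ^ (1 - p) * (((τ * s : ℝ) : ℂ) ^ (p - 1) * G (τ * s)) := by
    intro τ hτ
    have hτ' : (0 : ℝ) < τ := hτ
    rw [Complex.ofReal_mul, Complex.mul_cpow_ofReal_nonneg hτ'.le hs.le]
    have : (s : ℂ) ^ (1 - p) * (s : ℂ) ^ (p - 1) = 1 := by
      rw [← Complex.cpow_add _ _ hsne]
      simp
    linear_combination -((τ : ℂ) ^ (p - 1) * G (τ * s)) * this
  constructor
  · rw [integrableOn_congr_fun e measurableSet_Ioi]
    have := (integrableOn_Ioi_comp_mul_right_iff (fun t : ℝ => (t : ℂ) ^ (p - 1) * G t) 0 hs).2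
      (by rwa [zero_mul])
    exact this.const_mul _
  · have h := integral_comp_mul_right_Ioi (fun t : ℝ => (t : ℂ) ^ (p - 1) * G t) 0 hs
    rw [zero_mul] at h
    rw [setIntegral_congr_fun measurableSet_Ioi e, integral_const_mul, h, Complex.real_smul,
      ← mul_assoc, Complex.ofReal_inv, ← Complex.cpow_neg_one, ← Complex.cpow_add _ _ hsne]
    congr 2
    ring

/-- The effect of the homogeneous kernel. -/
lemma exists_homKernel_average {z : ℂ} (h0 : 0 < z.re) (h1 : z.re < 1 / 2) :
    ∃ C : ℝ≥0, ∀ G : ℝ → ℂ, AEStronglyMeasurable G halfLine → l2Sq G ≠ ⊤ →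
      l2Sq (fun t => G t / (t : ℂ)) ≠ ⊤ → ∃ β γ : ℂ,
        ‖γ‖ₑ ^ 2 ≤ C * (l2Sq G + l2Sq (fun t => G t / (t : ℂ))) ∧ ∀ s : ℝ, 0 < s →
          IntegrableOn (fun τ => homKernel z τ * G (τ * s)) (Ioi 0) ∧
          dilAvg (homKernel z) G s = β * (s : ℂ) ^ (-z) - γ * (s : ℂ) ^ z := by
  obtain ⟨C₁, hC₁⟩ := exists_lintegral_cpow_mul_sq_le (p := z) (by rwa [abs_of_pos h0])
  obtain ⟨C₂, hC₂⟩ := exists_lintegral_cpow_mul_sq_le (p := -z)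
    (by rwa [Complex.neg_re, abs_neg, abs_of_pos h0])
  refine ⟨C₂, fun G hG hG2 hGt => ?_⟩
  have hint : ∀ (p : ℂ) (C : ℝ≥0), (∫⁻ t in Ioi (0 : ℝ), ‖(t : ℂ) ^ (p - 1) * G t‖ₑ) ^ 2 ≤
      C * (l2Sq G + l2Sq (fun t => G t / (t : ℂ))) →
      IntegrableOn (fun t : ℝ => (t : ℂ) ^ (p - 1) * G t) (Ioi 0) := by
    intro p C h
    refine ⟨((Complex.measurable_ofReal.pow_const (p - 1)).aestronglyMeasurable).mul hG, ?_⟩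
    rw [HasFiniteIntegral]
    refine lt_top_iff_ne_top.2 fun h' => ?_
    rw [h'] at h
    refine absurd h (not_le.2 ?_)
    rw [ENNReal.top_pow two_ne_zero]
    exact ENNReal.mul_lt_top ENNReal.coe_lt_top (ENNReal.add_lt_top.2
      ⟨lt_top_iff_ne_top.2 hG2, lt_top_iff_ne_top.2 hGt⟩)
  have i1 := hint z C₁ (hC₁ G hG)
  have i2 := hint (-z) C₂ (hC₂ G hG)
  refine ⟨∫ t in Ioi (0 : ℝ), (t : ℂ) ^ (z - 1) * G t,
    ∫ t in Ioi (0 : ℝ), (t : ℂ) ^ (-z - 1) * G t, ?_, fun s hs => ?_⟩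
  · exact (pow_le_pow_left₀ zero_le (enorm_integral_le_lintegral_enorm _) 2).trans (hC₂ G hG)
  · obtain ⟨j1, k1⟩ := integral_cpow_comp_mul i1 hs
    obtain ⟨j2, k2⟩ := integral_cpow_comp_mul i2 hs
    simp only [dilAvg, homKernel, sub_mul]
    refine ⟨j1.sub j2, ?_⟩
    rw [integral_sub j1 j2, k1, k2, neg_neg]
    ring

/-! ### Reduction to a right-hand side vanishing at the origin -/

lemma ae_eq_of_forall_pos {f g : ℝ → ℂ} (h : ∀ s, 0 < s → f s = g s) : f =ᵐ[halfLine] g := by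
  filter_upwards [ae_restrict_mem measurableSet_Ioi] with s hs using h s hs

lemma aestronglyMeasurable_prim {v : ℝ → ℂ} (hv : Measurable v) (h2 : l2Sq v ≠ ⊤) :
    AEStronglyMeasurable (prim v) halfLine :=
  ((continuousOn_prim hv.aestronglyMeasurable h2).mono Ioi_subset_Ici_self).aestronglyMeasurable
    measurableSet_Ioi

lemma schurNorm_mul_kap {α : ℝ} (hα0 : 0 < α) (hαπ : α < Real.pi) :
    schurNorm (fun τ => (τ : ℂ) * kap α τ) ≠ ⊤ := by
  simpa using schurNorm_kap_cpow hα0 hαπ (r := 1) (by norm_num [abs_lt])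

lemma integral_kap {α : ℝ} (hα0 : 0 < α) (hαπ : α < Real.pi) :
    IntegrableOn (fun τ : ℝ => (kap α τ : ℂ)) (Ioi 0) ∧
      ∫ τ in Ioi (0 : ℝ), (kap α τ : ℂ) = symbol α 0 := by
  simpa using integral_kap_cpow hα0 hαπ (p := 0) (by simp [strip])

/-- The action of `K` on a function `1 + ∫ p`. -/
lemma dilAvg_kap_of_eq_one_add_prim {α : ℝ} (hα0 : 0 < α) (hαπ : α < Real.pi) {Φ p : ℝ → ℂ}
    (hp : Measurable p) (hp2 : l2Sq p ≠ ⊤) (h : ∀ s, 0 < s → Φ s = 1 + prim p s) {s : ℝ}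
    (hs : 0 < s) :
    IntegrableOn (fun τ => (kap α τ : ℂ) * Φ (τ * s)) (Ioi 0) ∧
      dilAvg (fun τ => (kap α τ : ℂ)) Φ s =
        symbol α 0 + prim (dilAvg (fun τ => (τ : ℂ) * kap α τ) p) s := by
  obtain ⟨h1, h2⟩ := dilAvg_prim (measurable_ofReal_kap hα0 hαπ) hp (schurNorm_mul_kap hα0 hαπ)
    hp2 hs
  obtain ⟨h3, h4⟩ := integral_kap hα0 hαπ
  have e : ∀ τ ∈ Ioi (0 : ℝ), (kap α τ : ℂ) * Φ (τ * s) =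
      (kap α τ : ℂ) + (kap α τ : ℂ) * prim p (τ * s) := fun τ hτ => by
    rw [h _ (mul_pos hτ hs)]
    ring
  refine ⟨(integrableOn_congr_fun e measurableSet_Ioi).2 (h3.add h2), ?_⟩
  rw [dilAvg, setIntegral_congr_fun measurableSet_Ioi e, integral_add h3 h2, h4, ← h1]
  rfl

/-- (K - w)φ is σ(0) - w plus a primitive of an L² function. With a the boundary value of g,
subtracting dφ for d = a/(σ(0) - w) therefore leaves a right-hand side that is itself such a
primitive. -/
lemma exists_reduction {α : ℝ} (hα0 : 0 < α) (hαπ : α < Real.pi) {φ : ℝ → ℝ} (hφ : IsCutoff φ)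
    {w : ℂ} (hw : symbol α 0 ≠ w) :
    ∃ C : ℝ≥0, ∀ f g : ℝ → ℂ, MemHOne g → MemHHalf f → Solves α w f g →
      ∃ (d : ℂ) (F v : ℝ → ℂ), Measurable F ∧ l2Sq F ≠ ⊤ ∧ Measurable v ∧ l2Sq v ≠ ⊤ ∧
        l2Sq (prim v) ≠ ⊤ ∧ (f =ᵐ[halfLine] fun s => d * (φ s : ℂ) + F s) ∧
        (∀ᵐ s ∂halfLine, dilAvg (fun τ => (kap α τ : ℂ)) F s - w * F s = prim v s) ∧
        ‖d‖ₑ ^ 2 ≤ C * hOneNorm g ^ 2 ∧ l2Sq v ≤ C * hOneNorm g ^ 2 ∧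
        l2Sq (prim v) ≤ C * hOneNorm g ^ 2 := by
  obtain ⟨p, hp, hp2, hφp⟩ := hφ.exists_eq_one_add_prim
  have hκ := measurable_ofReal_kap hα0 hαπ
  have hκs := schurNorm_kap hα0 hαπ
  have hκ1 : Measurable fun τ : ℝ => (τ : ℂ) * kap α τ := Complex.measurable_ofReal.mul hκ
  have hκ1s := schurNorm_mul_kap hα0 hαπ
  -- the cut-off function, made measurable
  set Φ : ℝ → ℂ := indicator (Ioi 0) fun s => (φ s : ℂ) with hΦ
  have hΦφ : ∀ s, 0 < s → Φ s = φ s := fun s hs => indicator_of_mem (mem_Ioi.2 hs) _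
  have hΦm : Measurable Φ := by
    have hc : ContinuousOn (fun s => (φ s : ℂ)) (Ioi 0) :=
      Complex.continuous_ofReal.comp_continuousOn (hφ.smooth.continuousOn.mono Ioi_subset_Ici_self)
    rw [hΦ, ← piecewise_eq_indicator]
    exact hc.measurable_piecewise continuousOn_const measurableSet_Ioi
  have hΦ2 : l2Sq Φ ≠ ⊤ := by
    obtain ⟨r, hr, hr0⟩ := hφ.eq_zero
    have hle : l2Sq Φ ≤ ∫⁻ s in Ioc (0 : ℝ) 1, 1 := by
      rw [l2Sq_eq, ← lintegral_indicator measurableSet_Ioi, ← lintegral_indicator measurableSet_Ioc]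
      refine lintegral_mono fun s => ?_
      by_cases hs : 0 < s
      · rw [indicator_of_mem (mem_Ioi.2 hs), hΦφ s hs]
        by_cases hs1 : s ≤ 1
        · rw [indicator_of_mem (mem_Ioc.2 ⟨hs, hs1⟩), ← ofReal_norm, Complex.norm_real,
            Real.norm_of_nonneg (hφ.nonneg hs.le)]
          refine pow_le_one₀ zero_le ?_
          simpa using hφ.le_one hs.le
        · rw [hr0 s hs.le (by linarith)]
          simp
      · rw [indicator_of_notMem (by simpa using hs)]
        exact zero_le
    refine ne_top_of_le_ne_top ?_ hle
    simp
  have hΦp : ∀ s, 0 < s → Φ s = 1 + prim p s := fun s hs => by rw [hΦφ s hs, hφp s hs]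
  set KΦ : ℝ → ℂ := dilAvg (fun τ => (kap α τ : ℂ)) Φ with hKΦ
  have hKΦm : Measurable KΦ := measurable_dilAvg hκ hΦm
  have hKΦ2 : l2Sq KΦ ≠ ⊤ :=
    ne_top_of_le_ne_top (ENNReal.mul_ne_top (ENNReal.pow_ne_top hκs) hΦ2) (l2Sq_dilAvg_le hκ hΦm)
  set P : ℝ → ℂ := dilAvg (fun τ => (τ : ℂ) * kap α τ) p with hP
  have hPm : Measurable P := measurable_dilAvg hκ1 hp
  have hP2 : l2Sq P ≠ ⊤ :=
    ne_top_of_le_ne_top (ENNReal.mul_ne_top (ENNReal.pow_ne_top hκ1s) hp2) (l2Sq_dilAvg_le hκ1 hp)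
  have hKΦP : ∀ s, 0 < s → IntegrableOn (fun τ => (kap α τ : ℂ) * Φ (τ * s)) (Ioi 0) ∧
      KΦ s = symbol α 0 + prim P s := fun s hs =>
    dilAvg_kap_of_eq_one_add_prim hα0 hαπ hp hp2 hΦp hs
  set q : ℝ → ℂ := fun s => P s - w * p s with hq
  have hwp2 : l2Sq (fun s => w * p s) ≠ ⊤ := by
    rw [l2Sq_const_mul]
    exact ENNReal.mul_ne_top (by simp) hp2
  have hqm : Measurable q := hPm.sub (hp.const_mul w)
  have hq2 : l2Sq q ≠ ⊤ := ne_top_of_le_ne_top (ENNReal.mul_ne_top (by simp)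
    (ENNReal.add_ne_top.2 ⟨hP2, hwp2⟩)) (l2Sq_sub_le hPm.aestronglyMeasurable)
  have hqprim : ∀ s, 0 < s → KΦ s - w * Φ s = symbol α 0 - w + prim q s := fun s hs => by
    rw [hq, prim_sub hPm.aestronglyMeasurable hP2 (hp.const_mul w).aestronglyMeasurable hwp2 hs.le,
      prim_const_mul, (hKΦP s hs).2, hΦp s hs]
    ring
  set QΦ := l2Sq (fun s => KΦ s - w * Φ s) with hQΦ
  have hQΦ2 : QΦ ≠ ⊤ := by
    refine ne_top_of_le_ne_top (ENNReal.mul_ne_top (by simp) (ENNReal.add_ne_top.2 ⟨hKΦ2, ?_⟩))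
      (l2Sq_sub_le hKΦm.aestronglyMeasurable)
    rw [l2Sq_const_mul]
    exact ENNReal.mul_ne_top (by simp) hΦ2
  have hw' : symbol α 0 - w ≠ 0 := sub_ne_zero.2 hw
  set D : ℝ≥0∞ := ‖(symbol α 0 - w)⁻¹‖ₑ ^ 2 with hD
  have hDt : D ≠ ⊤ := by simp [hD]
  -- The three summands bound d, the new derivative and the new right-hand side; D comes from d, its
  -- factor 4 from the trace estimate and the near-minimal choice of derivative.
  have hCt : 4 * D + 2 * (2 + 4 * D * l2Sq q) + 2 * (2 + 4 * D * QΦ) ≠ ⊤ := by finiteness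
  refine ⟨(4 * D + 2 * (2 + 4 * D * l2Sq q) + 2 * (2 + 4 * D * QΦ)).toNNReal,
    fun f g hg hf hs => ?_⟩
  rw [ENNReal.coe_toNNReal hCt]
  set N := hOneNorm g ^ 2 with hN
  obtain ⟨a, v, hv, hg2, hv2, hgv, hle⟩ := hg.exists_prim
  have hgN : l2Sq g ≤ 2 * N := le_self_add.trans hle
  have hvN : l2Sq v ≤ 2 * N := le_add_self.trans hle
  obtain ⟨fm, hfm, hffm⟩ := hf.1
  have hfm' : Measurable fm := hfm.measurable
  have hfm2 : l2Sq fm ≠ ⊤ := by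
    rw [← l2Sq_congr hffm]
    exact hf.l2Sq_ne_top
  set d : ℂ := (symbol α 0 - w)⁻¹ * a with hd
  have hdN : ‖d‖ₑ ^ 2 ≤ 4 * D * N := by
    rw [hd, enorm_mul, mul_pow, mul_comm 4 D, mul_assoc D]
    gcongr
    refine (enorm_sq_le_of_eq_add_prim hv hgv).trans ?_
    calc 2 * (l2Sq g + l2Sq v) ≤ 2 * (2 * N) := by gcongr
      _ = 4 * N := by rw [← mul_assoc]; norm_num
  have hdΦ2 : l2Sq (fun s => d * Φ s) ≠ ⊤ := by
    rw [l2Sq_const_mul]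
    exact ENNReal.mul_ne_top (by simp) hΦ2
  have hdq2 : l2Sq (fun s => d * q s) ≠ ⊤ := by
    rw [l2Sq_const_mul]
    exact ENNReal.mul_ne_top (by simp) hq2
  set F : ℝ → ℂ := fun s => fm s - d * Φ s with hF
  set v₁ : ℝ → ℂ := fun s => v s - d * q s with hv₁
  have hv₁N : l2Sq v₁ ≤ 2 * (2 + 4 * D * l2Sq q) * N := by
    refine (l2Sq_sub_le hv.aestronglyMeasurable).trans ?_
    rw [l2Sq_const_mul, mul_assoc, add_mul]
    refine mul_le_mul_right (add_le_add hvN ?_) _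
    calc ‖d‖ₑ ^ 2 * l2Sq q ≤ 4 * D * N * l2Sq q := by gcongr
      _ = _ := by ring
  have hv₁prim : ∀ s, 0 < s → prim v₁ s = prim v s - d * prim q s := fun s hs => by
    rw [hv₁, prim_sub hv.aestronglyMeasurable hv2 (hqm.const_mul d).aestronglyMeasurable hdq2 hs.le,
      prim_const_mul]
  have hda : d * (symbol α 0 - w) = a := by
    rw [hd]
    field_simp
  have hprimg : prim v₁ =ᵐ[halfLine] fun s => g s - d * (KΦ s - w * Φ s) := by
    filter_upwards [hgv, ae_restrict_mem measurableSet_Ioi] with s hs h0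
    rw [hv₁prim s h0, hs, hqprim s h0, ← hda]
    ring
  have hprim2 : l2Sq (prim v₁) ≤ 2 * (l2Sq g + ‖d‖ₑ ^ 2 * QΦ) := by
    rw [l2Sq_congr hprimg]
    refine (l2Sq_sub_le ?_).trans_eq (by rw [l2Sq_const_mul])
    exact (hg.choose_spec).1
  refine ⟨d, F, v₁, hfm'.sub (hΦm.const_mul d), ?_, hv.sub (hqm.const_mul d), ?_, ?_, ?_, ?_,
    ?_, ?_, ?_⟩
  · exact ne_top_of_le_ne_top (ENNReal.mul_ne_top (by simp) (ENNReal.add_ne_top.2 ⟨hfm2, hdΦ2⟩))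
      (l2Sq_sub_le hfm'.aestronglyMeasurable)
  · exact ne_top_of_le_ne_top (ENNReal.mul_ne_top (by simp) (ENNReal.add_ne_top.2 ⟨hv2, hdq2⟩))
      (l2Sq_sub_le hv.aestronglyMeasurable)
  · exact ne_top_of_le_ne_top (ENNReal.mul_ne_top (by simp) (ENNReal.add_ne_top.2
      ⟨hg2, ENNReal.mul_ne_top (by simp) hQΦ2⟩)) hprim2
  · filter_upwards [hffm, ae_restrict_mem measurableSet_Ioi] with s hs h0
    rw [hs, hF, ← hΦφ s h0]
    ring
  · filter_upwards [hs, hffm, hprimg, ae_absDilAvg_lt_top hκ hfm' hκs hfm2,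
      ae_restrict_mem measurableSet_Ioi] with s h1 h2 h3 h4 h0
    have i1 := integrableOn_of_absDilAvg_lt_top hκ hfm' h4
    have e1 : dilAvg (fun τ => (kap α τ : ℂ)) F s =
        dilAvg (fun τ => (kap α τ : ℂ)) fm s - d * KΦ s := by
      simp only [hKΦ, dilAvg, hF]
      rw [← integral_const_mul, ← integral_sub i1 ((hKΦP s h0).1.const_mul d)]
      congr 1
      ext τ
      ring
    rw [h3, e1, ← h1, opK_eq_dilAvg hα0 hαπ f h0, dilAvg_congr hffm h0, h2]
    ring
  · exact hdN.trans (by gcongr; rw [add_assoc]; exact le_self_add)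
  · exact hv₁N.trans (by gcongr; rw [add_assoc, add_left_comm]; exact le_self_add)
  · refine hprim2.trans ?_
    calc 2 * (l2Sq g + ‖d‖ₑ ^ 2 * QΦ) ≤ 2 * (2 * N + 4 * D * N * QΦ) := by gcongr
      _ = 2 * (2 + 4 * D * QΦ) * N := by ring
      _ ≤ _ := by gcongr; exact le_add_self

/-! ### Representation of the solutions -/

/-- Averaging commutes with taking primitives at the price of a factor τ in the kernel, and τ `mR`
has a finite Schur bound. So the right kernel keeps primitives of L² functions in that class. -/
lemma IsResolventKernel.exists_dilAvg_right {α : ℝ} {w z c : ℂ} {mL mR : ℝ → ℂ}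
    (hk : IsResolventKernel α w z c mL mR) :
    ∃ C : ℝ≥0, ∀ v : ℝ → ℂ, Measurable v → l2Sq v ≠ ⊤ →
      ∃ W : ℝ → ℂ, Measurable W ∧ l2Sq W ≠ ⊤ ∧ l2Sq W ≤ C * l2Sq v ∧ ∀ s, 0 < s →
        IntegrableOn (fun τ => mR τ * prim v (τ * s)) (Ioi 0) ∧
        dilAvg mR (prim v) s - w⁻¹ * prim v s = prim W s := by
  have hm : Measurable fun τ : ℝ => (τ : ℂ) * mR τ :=
    Complex.measurable_ofReal.mul hk.measurable_right
  set S := schurNorm fun τ => (τ : ℂ) * mR τ with hS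
  have hC : 2 * (S ^ 2 + ‖w⁻¹‖ₑ ^ 2) ≠ ⊤ := by
    have := hk.schur_right
    finiteness
  refine ⟨(2 * (S ^ 2 + ‖w⁻¹‖ₑ ^ 2)).toNNReal, fun v hv h2 => ?_⟩
  rw [ENNReal.coe_toNNReal hC]
  have hAm := measurable_dilAvg hm hv
  have hA2 := l2Sq_dilAvg_le hm hv
  have hA2' := ne_top_of_le_ne_top
    (ENNReal.mul_ne_top (ENNReal.pow_ne_top (n := 2) hk.schur_right) h2) hA2
  have hw2 : l2Sq (fun s => w⁻¹ * v s) ≠ ⊤ := by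
    rw [l2Sq_const_mul]
    exact ENNReal.mul_ne_top (by simp) h2
  have hle : l2Sq (fun s => dilAvg (fun τ => (τ : ℂ) * mR τ) v s - w⁻¹ * v s) ≤
      2 * (S ^ 2 + ‖w⁻¹‖ₑ ^ 2) * l2Sq v := by
    refine (l2Sq_sub_le hAm.aestronglyMeasurable).trans ?_
    rw [l2Sq_const_mul, mul_assoc, add_mul]
    exact mul_le_mul_right (add_le_add hA2 le_rfl) _
  refine ⟨fun s => dilAvg (fun τ => (τ : ℂ) * mR τ) v s - w⁻¹ * v s, hAm.sub (hv.const_mul _),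
    ne_top_of_le_ne_top (ENNReal.mul_ne_top hC h2) hle, hle, fun s hs => ?_⟩
  obtain ⟨e1, e2⟩ := dilAvg_prim hk.measurable_right hv hk.schur_right h2 hs
  refine ⟨e2, ?_⟩
  rw [prim_sub hAm.aestronglyMeasurable hA2' (hv.const_mul _).aestronglyMeasurable hw2 hs.le,
    prim_const_mul, e1]

lemma norm_prim_le {v : ℝ → ℂ} (hv : Measurable v) (h2 : l2Sq v ≠ ⊤) {s : ℝ} (hs : 0 ≤ s)
    (hs1 : s ≤ 1) : ‖prim v s‖ ≤ √(l2Sq v).toReal := by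
  refine Real.le_sqrt_of_sq_le ?_
  have h := enorm_prim_sq_le hv.aestronglyMeasurable hs
  have h' : ‖prim v s‖ₑ ^ 2 ≤ l2Sq v :=
    h.trans (mul_le_of_le_one_left zero_le (by simpa using hs1))
  have := ENNReal.toReal_mono h2 h'
  simpa using this

/-- Solutions in `H^{1/2}` split into a multiple of the cut-off function, a function of `W₀¹`, and
a homogeneous solution without singularity at the origin. -/
lemma IsResolventKernel.exists_representation {α : ℝ} (hα0 : 0 < α) (hαπ : α < Real.pi)
    {φ : ℝ → ℝ} (hφ : IsCutoff φ) {w z c : ℂ} {mL mR : ℝ → ℂ}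
    (hk : IsResolventKernel α w z c mL mR) (hw : w ≠ 0) (hw0 : symbol α 0 ≠ w)
    (h0 : 0 < z.re) (h1 : z.re < 1 / 2) :
    ∃ C : ℝ≥0, ∀ f g : ℝ → ℂ, MemHOne g → MemHHalf f → Solves α w f g →
      ∃ (d γ : ℂ) (W : ℝ → ℂ), Measurable W ∧ l2Sq W ≠ ⊤ ∧
        (f =ᵐ[halfLine] fun s => d * (φ s : ℂ) + prim W s + c * γ * (s : ℂ) ^ z) ∧
        ‖d‖ₑ ^ 2 ≤ C * hOneNorm g ^ 2 ∧ ‖γ‖ₑ ^ 2 ≤ C * hOneNorm g ^ 2 ∧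
        l2Sq W ≤ C * hOneNorm g ^ 2 := by
  obtain ⟨C₁, hC₁⟩ := exists_reduction hα0 hαπ hφ hw0
  obtain ⟨C₂, hC₂⟩ := hk.exists_dilAvg_right
  obtain ⟨C₃, hC₃⟩ := exists_homKernel_average h0 h1
  obtain ⟨C₄, hC₄⟩ := exists_hardy
  refine ⟨C₁ + C₃ * (C₁ + C₄ * C₁) + C₂ * C₁, fun f g hg hf hs => ?_⟩
  obtain ⟨d, F, v, hF, hF2, hv, hv2, hpv2, hfF, hsol, hdN, hvN, hpvN⟩ := hC₁ f g hg hf hs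
  obtain ⟨W, hW, hW2, hWv, hWprim⟩ := hC₂ v hv hv2
  have hH := hC₄ v hv
  obtain ⟨β, γ, hγ, hhom⟩ := hC₃ (prim v) (aestronglyMeasurable_prim hv hv2) hpv2
    (ne_top_of_le_ne_top (ENNReal.mul_ne_top (by simp) hv2) hH)
  set N := hOneNorm g ^ 2 with hN
  -- L² inversion uses the left kernel. Replacing it by the right one plus c times the homogeneous
  -- kernel separates the W¹₀ part from the powers s^(±z).
  have hrep : ∀ᵐ s ∂halfLine, f s =
      d * (φ s : ℂ) + prim W s - c * γ * (s : ℂ) ^ z + c * β * (s : ℂ) ^ (-z) := by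
    filter_upwards [hfF, hk.eq_of_solves hα0 hαπ hw hF hF2 hsol,
      ae_restrict_mem measurableSet_Ioi] with s e1 e2 hs0
    obtain ⟨i1, e3⟩ := hWprim s hs0
    obtain ⟨i2, e4⟩ := hhom s hs0
    have e5 : dilAvg mL (prim v) s = dilAvg mR (prim v) s + c * dilAvg (homKernel z) (prim v) s := by
      have e6 : ∀ τ ∈ Ioi (0 : ℝ), mL τ * prim v (τ * s) =
          mR τ * prim v (τ * s) + c * (homKernel z τ * prim v (τ * s)) := fun τ hτ => by
        rw [hk.sub_eq τ hτ]
        ring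
      rw [dilAvg, setIntegral_congr_fun measurableSet_Ioi e6, integral_add i1 (i2.const_mul c),
        integral_const_mul]
      rfl
    rw [e1, e2, e5, e4, ← e3]
    ring
  -- All other terms are bounded on (0, 1), so membership in H^{1/2} forbids the power s^(-z).
  have hβ : c * β = 0 := by
    refine hf.eq_zero_of_singular (M := ‖d‖ + √(l2Sq W).toReal + ‖c * γ‖) h0 ?_
    filter_upwards [hrep, ae_restrict_mem measurableSet_Ioi] with s e1 hs0 hs1
    have hs0' : (0 : ℝ) < s := hs0
    rw [e1, add_sub_cancel_right]
    refine (norm_sub_le _ _).trans (add_le_add ((norm_add_le _ _).trans (add_le_add ?_ ?_)) ?_)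
    · rw [norm_mul, Complex.norm_real, Real.norm_of_nonneg (hφ.nonneg hs0'.le)]
      exact mul_le_of_le_one_right (norm_nonneg _) (hφ.le_one hs0'.le)
    · exact norm_prim_le hW hW2 hs0'.le hs1.le
    · rw [norm_mul _ ((s : ℂ) ^ z), Complex.norm_cpow_eq_rpow_re_of_pos hs0']
      exact mul_le_of_le_one_right (norm_nonneg _) (Real.rpow_le_one hs0'.le hs1.le h0.le)
  push_cast
  refine ⟨d, -γ, W, hW, hW2, ?_, ?_, ?_, ?_⟩
  · filter_upwards [hrep] with s e1
    rw [e1, hβ]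
    ring
  · exact hdN.trans (by gcongr; rw [add_assoc]; exact le_self_add)
  · rw [enorm_neg]
    calc ‖γ‖ₑ ^ 2 ≤ C₃ * (C₁ * N + C₄ * (C₁ * N)) :=
          hγ.trans (mul_le_mul_right (add_le_add hpvN (hH.trans (mul_le_mul_right hvN _))) _)
      _ = C₃ * (C₁ + C₄ * C₁) * N := by ring
      _ ≤ _ := by
          refine mul_le_mul_left ?_ _
          rw [add_right_comm]
          exact le_add_self
  · calc l2Sq W ≤ C₂ * (C₁ * N) := hWv.trans (mul_le_mul_right hvN _)
      _ = C₂ * C₁ * N := by ring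
      _ ≤ _ := mul_le_mul_left le_add_self _

/-- The norm of `d φ + ∫ v` in `W¹`. -/
lemma exists_wOneNorm_sq_le (φ : ℝ → ℝ) : ∃ C : ℝ≥0, ∀ (f : ℝ → ℂ) (d : ℂ) (v : ℝ → ℂ),
    Measurable v → l2Sq v ≠ ⊤ → (f =ᵐ[halfLine] fun s => d * (φ s : ℂ) + prim v s) →
      MemWOne φ f ∧ wOneNorm φ f ^ 2 ≤ ‖d‖ₑ ^ 2 + C * l2Sq v := by
  obtain ⟨C, hC⟩ := exists_wZeroNormSq_le
  refine ⟨C, fun f d v hv h2 hf => ?_⟩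
  obtain ⟨h1, h3⟩ := hC (prim v) v hv h2 fun _ _ => rfl
  have hdec : IsWOneDecomp φ f d (prim v) := ⟨h1, hf⟩
  refine ⟨⟨d, prim v, hdec⟩, ?_⟩
  have e : wOneNorm φ f ^ 2 =
      ⨅ (d : ℂ) (h : ℝ → ℂ) (_ : IsWOneDecomp φ f d h), (‖d‖ₑ ^ 2 + wZeroNormSq h) := by
    rw [wOneNorm, ← ENNReal.rpow_natCast, ← ENNReal.rpow_mul]
    norm_num
  rw [e]
  refine (iInf_le_of_le d (iInf₂_le (prim v) hdec)).trans ?_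
  gcongr

/-- The exponent z of the singular term is whichever of ± `muInv` has positive real part. Both are
simple roots and there are no others in the closed strip, so the representation of solutions applies
with this z. -/
theorem exists_singular_decomposition {α : ℝ} (hα0 : 0 < α) (hαπ : α < Real.pi) {φ : ℝ → ℝ}
    (hφ : IsCutoff φ) {w : ℂ} (hw : w ∈ sigmaInterior 1 α) (hw' : w.im ≠ 0) :
    ∃ C : ℝ≥0, ∀ f g : ℝ → ℂ, MemHOne g → MemHHalf f → Solves α w f g →
      ∃ (c : ℂ) (ft : ℝ → ℂ),
        (f =ᵐ[halfLine] fun s =>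
          c * (φ s : ℂ) * (s : ℂ) ^ (-((Real.sign w.im : ℂ) * muInv α w)) + ft s) ∧
        MemWOne φ ft ∧ ‖c‖ₑ ^ 2 + wOneNorm φ ft ^ 2 ≤ (C : ℝ≥0∞) * hOneNorm g ^ 2 := by
  obtain ⟨hm, hs⟩ := muInv_spec hα0 hαπ hw hw'
  have hw0 : w ≠ 0 := by
    rintro rfl
    exact hw' rfl
  have hsym : symbol α 0 ≠ w := fun h => hw' (by rw [← h, symbol_im_of_im_eq_zero α Complex.zero_im])
  set z : ℂ := -((Real.sign w.im : ℂ) * muInv α w) with hz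
  have hz0 : 0 < z.re := by
    have := sign_mul_muInv_re_neg hα0 hαπ hw hw'
    rw [hz, Complex.neg_re, Complex.re_ofReal_mul]
    linarith
  have hderiv_neg : deriv (symbol α) (-muInv α w) = -deriv (symbol α) (muInv α w) := by
    have h1 := deriv_comp_neg (symbol α) (-muInv α w)
    simp only [symbol_neg, neg_neg] at h1
    exact h1
  have hd := deriv_symbol_ne_zero hα0 hαπ hm
  have hzm : z = muInv α w ∨ z = -muInv α w := by
    rcases lt_or_gt_of_ne hw' with h | h
    · left
      rw [hz, Real.sign_of_neg h]
      simp
    · right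
      rw [hz, Real.sign_of_pos h]
      simp
  have habs : |z.re| < 1 / 2 := by
    have := hm.1
    rcases hzm with h | h
    · rwa [h]
    · rwa [h, Complex.neg_re, abs_neg]
  have hz1 : z.re < 1 / 2 := (abs_lt.1 habs).2
  obtain ⟨c, mL, mR, hk⟩ := exists_resolventKernel_of_simple hα0 hαπ hw0 hz0 hz1
    (by rcases hzm with h | h
        · rw [h, hs]
        · rw [h, symbol_neg, hs])
    (by rcases hzm with h | h
        · rwa [h]
        · rw [h, hderiv_neg]
          exact neg_ne_zero.2 hd)
    (fun y hy hyw => by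
      rcases hzm with h | h
      · rw [h]
        exact eq_or_eq_neg_muInv hα0 hαπ hw hw' hy hyw
      · rw [h, neg_neg]
        exact (eq_or_eq_neg_muInv hα0 hαπ hw hw' hy hyw).symm)
  obtain ⟨C₁, hC₁⟩ := hk.exists_representation hα0 hαπ hφ hw0 hsym hz0 hz1
  obtain ⟨C₂, hC₂⟩ := exists_wOneNorm_sq_le φ
  obtain ⟨q, hq, hq2, hφq⟩ := hφ.exists_prim_one_sub_mul_cpow hz1
  have hqc : ((l2Sq q).toNNReal : ℝ≥0∞) = l2Sq q := ENNReal.coe_toNNReal hq2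
  have hcc : ((‖c‖₊ : ℝ≥0) : ℝ≥0∞) = ‖c‖ₑ := rfl
  refine ⟨‖c‖₊ ^ 2 * C₁ + C₁ + C₂ * (2 * (C₁ + ‖c‖₊ ^ 2 * C₁ * (l2Sq q).toNNReal)),
    fun f g hg hf hsol => ?_⟩
  obtain ⟨d, γ, W, hW, hW2, hrep, hdN, hγN, hWN⟩ := hC₁ f g hg hf hsol
  set N := hOneNorm g ^ 2 with hN
  have hcγ : ‖c * γ‖ₑ ^ 2 ≤ ‖c‖ₑ ^ 2 * C₁ * N := by
    rw [enorm_mul, mul_pow, mul_assoc]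
    exact mul_le_mul_right hγN _
  have hγq2 : l2Sq (fun s => c * γ * q s) ≤ ‖c‖ₑ ^ 2 * C₁ * N * l2Sq q := by
    rw [l2Sq_const_mul]
    exact mul_le_mul_left hcγ _
  have hγqt : l2Sq (fun s => c * γ * q s) ≠ ⊤ := by
    rw [l2Sq_const_mul]
    exact ENNReal.mul_ne_top (ENNReal.pow_ne_top enorm_ne_top) hq2
  have hsum : l2Sq (fun s => W s + c * γ * q s) ≤
      2 * (C₁ * N + ‖c‖ₑ ^ 2 * C₁ * N * l2Sq q) :=
    (l2Sq_add_le hW.aestronglyMeasurable).trans (mul_le_mul_right (add_le_add hWN hγq2) _)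
  -- The singular power splits as φ s^z + (1 - φ)s^z. The second piece is a primitive of an L²
  -- function and joins the W¹ part.
  obtain ⟨hmem, hle⟩ := hC₂
    (fun s => d * (φ s : ℂ) + (prim W s + c * γ * ((1 - (φ s : ℂ)) * (s : ℂ) ^ z))) d
    (fun s => W s + c * γ * q s) (hW.add (hq.const_mul _))
    (ne_top_of_le_ne_top (ENNReal.mul_ne_top (by simp) (ENNReal.add_ne_top.2 ⟨hW2, hγqt⟩))
      (l2Sq_add_le hW.aestronglyMeasurable))
    (ae_eq_of_forall_pos fun s hs0 => by
      have e : prim (fun x => W x + c * γ * q x) s = prim W s + prim (fun x => c * γ * q x) s :=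
        intervalIntegral.integral_add
          (intervalIntegrable_of_l2Sq hW.aestronglyMeasurable hW2 hs0.le)
          (intervalIntegrable_of_l2Sq (hq.const_mul _).aestronglyMeasurable hγqt hs0.le)
      rw [e, prim_const_mul, hφq s hs0])
  refine ⟨c * γ, _, ?_, hmem, ?_⟩
  · filter_upwards [hrep] with s e
    rw [e]
    ring
  · push_cast
    rw [hqc, hcc]
    calc ‖c * γ‖ₑ ^ 2 + _ ≤ ‖c‖ₑ ^ 2 * C₁ * N + (C₁ * N +
          C₂ * (2 * (C₁ * N + ‖c‖ₑ ^ 2 * C₁ * N * l2Sq q))) :=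
          add_le_add hcγ (hle.trans (add_le_add hdN (mul_le_mul_right hsum _)))
      _ = _ := by ring

/-- Without roots in the closed strip the coefficient of the homogeneous kernel is 0, so the
representation consists of a multiple of φ and a W¹₀ function only. -/
theorem exists_regularity {α : ℝ} (hα0 : 0 < α) (hαπ : α < Real.pi) {φ : ℝ → ℝ}
    (hφ : IsCutoff φ) {w : ℂ} (hw : w ∉ closure (sigmaInterior 1 α)) :
    ∃ C : ℝ≥0, ∀ j g : ℝ → ℂ, MemHOne g → MemHHalf j → Solves α w j g →
      MemWOne φ j ∧ wOneNorm φ j ≤ (C : ℝ≥0∞) * hOneNorm g := by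
  have hne : ∀ z : ℂ, |z.re| ≤ 1 / 2 → symbol α z ≠ w := by
    rintro z hz rfl
    exact hw (symbol_mem_closure_sigmaInterior hα0 hαπ hz)
  have hw0 : w ≠ 0 := by
    rintro rfl
    exact hw (zero_mem_closure_sigmaInterior hα0 hαπ)
  obtain ⟨mL, mR, hk⟩ := exists_resolventKernel_of_ne hα0 hαπ hw0 hne
  obtain ⟨C₁, hC₁⟩ := hk.exists_representation hα0 hαπ hφ hw0 (hne 0 (by norm_num)) (by norm_num)
    (by norm_num)
  obtain ⟨C₂, hC₂⟩ := exists_wOneNorm_sq_le φ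
  refine ⟨NNReal.sqrt (C₁ + C₂ * C₁), fun j g hg hj hsol => ?_⟩
  obtain ⟨d, γ, W, hW, hW2, hrep, hdN, -, hWN⟩ := hC₁ j g hg hj hsol
  simp only [zero_mul, add_zero] at hrep
  obtain ⟨hmem, hle⟩ := hC₂ j d W hW hW2 hrep
  refine ⟨hmem, ?_⟩
  rw [← ENNReal.rpow_le_rpow_iff (z := 2) two_pos, ENNReal.rpow_two, ENNReal.rpow_two]
  calc wOneNorm φ j ^ 2 ≤ C₁ * hOneNorm g ^ 2 + C₂ * (C₁ * hOneNorm g ^ 2) :=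
        hle.trans (add_le_add hdN (mul_le_mul_right hWN _))
    _ = ((C₁ + C₂ * C₁ : ℝ≥0) : ℝ≥0∞) * hOneNorm g ^ 2 := by
        push_cast
        ring
    _ = _ := by
        rw [mul_pow, ← ENNReal.coe_pow, NNReal.sq_sqrt]

end MellinCorner

open MellinCorner
theorem theorem4 (α : ℝ) (hα0 : 0 < α) (hαπ : α < Real.pi) (φ : ℝ → ℝ) (hφ : IsCutoff φ) :
    (∀ w ∈ sigmaInterior 1 α, w.im ≠ 0 →
      ∃ C : ℝ≥0, ∀ f g : ℝ → ℂ, MemHOne g → MemHHalf f → Solves α w f g →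
        ∃ (c : ℂ) (ft : ℝ → ℂ),
          (f =ᵐ[halfLine] fun s =>
            c * (φ s : ℂ) * (s : ℂ) ^ (-((Real.sign w.im : ℂ) * muInv α w)) + ft s) ∧
          MemWOne φ ft ∧
          ‖c‖ₑ ^ 2 + wOneNorm φ ft ^ 2 ≤ (C : ℝ≥0∞) * hOneNorm g ^ 2) ∧
    (∀ w ∉ closure (sigmaInterior 1 α),
      ∃ C : ℝ≥0, ∀ j g : ℝ → ℂ, MemHOne g → MemHHalf j → Solves α w j g →
        MemWOne φ j ∧ wOneNorm φ j ≤ (C : ℝ≥0∞) * hOneNorm g) :=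
  ⟨fun _ hw hw' => exists_singular_decomposition hα0 hαπ hφ hw hw',
    fun _ hw => exists_regularity hα0 hαπ hφ hw⟩
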